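/- **Setting.** Let $\mathcal A$ be a finite-dimensional $C^*$-algebra with a faithful tracial positive linear functional $\tau$. A *differential structure* $(\mathcal A,\nabla,\sigma)$ consists of a finite index set $\mathcal J$; finite-dimensional $C^*$-algebras $\mathcal B_j$ with faithful tracial positive functionals $\tau_j$; unital $*$-homomorphisms $\ell_j,r_j:\mathcal A\to\mathcal B_j$ with $\tau_j(\ell_j(A))=\tau_j(r_j(A))=\tau(A)$; non-zero $V_j\in\mathcal B_j$ and an involution $j\mapsto j^*$ of $\mathcal J$ with $(\mathcal B_{j^*},\tau_{j^*})=(\mathcal B_j,\tau_j)$, $V_{j^*}=V_j^*$ and $$\tau_j[V_j^*\ell_j(A_1)V_jr_j(A_2)]=\tau_j[V_j^*r_{j^*}(A_1)V_j\ell_{j^*}(A_2)]\qquad(A_1,A_2\in\mathcal A);$$ and a positive definite $\sigma\in\mathcal A$ with $\tau[\sigma]=1$ and $\ell_j(\sigma)V_jr_j(\sigma)^{-1}=e^{-\omega_j}V_j$ for some $\omega_j\in\mathbb R$. Put $\mathcal B=\prod_j\mathcal B_j$, $\partial_jA=V_jr_j(A)-\ell_j(A)V_j$ and $\nabla A=(\partial_jA)_j$.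 Adjoints $\dagger$ are taken for the inner products $\tau[A^*B]$, $\tau_j[A^*B]$ and $\sum_j\tau_j[A_j^*B_j]$. The quantum Markov semigroup is $\mathscr P_t=e^{t\mathscr L}$, where $\mathscr L$ is defined by $$-\tau[A^*\sigma^{1/2}\mathscr L(B)\sigma^{1/2}]=\sum_j\tau_j[(\partial_jA)^*\ell_j(\sigma^{1/2})\,\partial_jB\;r_j(\sigma^{1/2})]\qquad(A,B\in\mathcal A).$$ It is *ergodic* if $\operatorname{Ker}\mathscr L=\mathbb C\mathbf 1$. Let $\mathfrak P$ be the set of density matrices ($\rho\ge0$, $\tau[\rho]=1$) and $\mathfrak P_+$ the subset of the positive definite ones. For $\theta:[0,\infty)^2\to\mathbb R$ and self-adjoint $R,S$ with spectral projections $E^R_x,E^S_y$, put $\theta(R,S)\#B=\sum_{x,y}\theta(x,y)E^R_xBE^S_y$. Let $\Lambda$ be the logarithmic mean, $\theta_j(x,y)=\Lambda(e^{\omega_j/2}x,e^{-\omega_j/2}y)$, and for $\rho\in\mathfrak P_+$ $$\mathscr K_\rho A=\sum_j\partial_j^\dagger\big(\theta_j(\ell_j(\rho),r_j(\rho))\#\partial_jA\big),\qquad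 \mathscr A(\rho,\mathbf B)=\sum_j\tau_j\big[B_j^*\,\big(\tfrac1{\theta_j}(\ell_j(\rho),r_j(\rho))\#B_j\big)\big].$$ Let $\mathcal A_0$ be the set of self-adjoint elements of $\operatorname{Ran}\mathscr L^\dagger$. In the ergodic case, $\mathscr W$ is the Riemannian distance on $\mathfrak P_+$, $\mathscr W(\rho_0,\rho_1)^2=\inf\int_0^1\tau[(\mathscr K_{\rho_t}A_t)^*A_t]\,dt$ over smooth $(\rho_t)\subset\mathfrak P_+$, $(A_t)\subset\mathcal A_0$ with $\partial_t\rho_t=\mathscr K_{\rho_t}A_t$ joining $\rho_0$ to $\rho_1$; it is extended continuously to $\mathfrak P$. Let $\operatorname{Ent}_\sigma(\rho)=\tau[\rho(\log\rho-\log\sigma)]$. We write $\operatorname{Ric}(\mathcal A,\nabla,\sigma)\ge\lambda$ if the following (mutually equivalent) conditions all hold: 1. any two points of $(\mathfrak P,\mathscr W)$ are joined by a constant speed geodesic $(\gamma_t)_{t\in[0,1]}$ with $\operatorname{Ent}_\sigma(\gamma_t)\le(1-t)\operatorname{Ent}_\sigma(\gamma_0)+t\operatorname{Ent}_\sigma(\gamma_1)-\frac\lambda2t(1-t)\mathscr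 W(\gamma_0,\gamma_1)^2$ for all $t\in[0,1]$; 2. this inequality holds along every constant speed geodesic of $(\mathfrak P,\mathscr W)$; 3. $\frac12\frac{d^+}{dt}\mathscr W^2(\mathscr P_t^\dagger\rho,\nu)+\frac\lambda2\mathscr W^2(\mathscr P_t^\dagger\rho,\nu)\le\operatorname{Ent}_\sigma(\nu)-\operatorname{Ent}_\sigma(\mathscr P_t^\dagger\rho)$ for all $\rho,\nu\in\mathfrak P$ and $t\ge0$, with $\frac{d^+}{dt}$ the upper right derivative; 4. $\operatorname{Hess}\operatorname{Ent}_\sigma(\rho)[A,A]\ge\lambda\,\tau[A\,\mathscr K_\rho A]$ for all $\rho\in\mathfrak P_+$, $A\in\mathcal A_0$, where the Hessian is the second derivative of $\operatorname{Ent}_\sigma$ along the solution of the geodesic equations $\partial_s\rho_s=\mathscr K_{\rho_s}A_s$, $\partial_sA_s=-\frac12\langle D\mathscr K_{\rho_s}A_s,A_s\rangle$ started at $(\rho,A)$. **Action of $\mathscr P_t^\dagger$ on $\mathcal B_j$.** Assume that $\mathscr P_t^\dagger$, $t\ge0$, acts on every $\mathcal B_j$ compatibly with $\ell_j$ and $r_j$,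 in one of the following two senses. * (a) There are completely positive trace preserving maps on $\mathcal B_j$, again denoted by $\mathscr P_t^\dagger$, with $\mathscr P_t^\dagger\ell_j(A)=\ell_j(\mathscr P_t^\dagger A)$ and $\mathscr P_t^\dagger r_j(A)=r_j(\mathscr P_t^\dagger A)$ for $A\in\mathcal A$. * (b) Each $(\mathcal B_j,\tau_j)$ is identified with $(\mathcal A,\tau)$ by a trace preserving $*$-isomorphism, $\mathscr P_t^\dagger$ acts on $\mathcal B_j=\mathcal A$ as itself, and $\ell_j,r_j:\mathcal A\to\mathcal A$ commute with $\mathscr P_t$. For $\lambda\in\mathbb R$, a family $(\vec{\mathscr P}_t)_{t\ge0}$ of linear operators on $\mathcal B$ is *$\lambda$-intertwining* for $(\mathscr P_t)_{t\ge0}$ if for all $t\ge0$, $A\in\mathcal A$, $\rho\in\mathfrak P_+$, $\mathbf B\in\mathcal B$: $$\nabla\mathscr P_tA=\vec{\mathscr P}_t\nabla A,\qquad \mathscr A(\rho,\vec{\mathscr P}_t^{\,\dagger}\mathbf B)\le e^{-2\lambda t}\mathscr A\big(\rho,(\mathscr P_t^\dagger B_j)_j\big).$$ **Theorem.** Let $(\mathcal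 A,\nabla,\sigma)$ be a differential structure whose quantum Markov semigroup is ergodic, with an action of $\mathscr P_t^\dagger$ on the $\mathcal B_j$ as in (a) or (b), and let $\lambda\in\mathbb R$. If there is a family of linear operators on $\mathcal B$ that is $\lambda$-intertwining for $(\mathscr P_t)_{t\ge0}$, then $\operatorname{Ric}(\mathcal A,\nabla,\sigma)\ge\lambda$. As a consequence, let $n\ge1$, let $\mathcal A=\mathcal B_j$ ($1\le j\le n$) be the Clifford algebra generated by self-adjoint $Q_1,\dots,Q_n$ with $Q_iQ_j+Q_jQ_i=2\delta_{ij}$, with its canonical (normalised) trace, $r_j=\mathrm{id}$, $\ell_j=\Gamma$ the principal automorphism ($\Gamma(Q_j)=-Q_j$), $\sigma=\mathbf 1$, and $V_j=Q_j$, so that $\partial_jA=Q_jA-\Gamma(A)Q_j$. This fermionic Ornstein–Uhlenbeck structure is ergodic and has $\operatorname{Ric}\ge1$. The same holds with the normalization $V_j=\frac12Q_j$, for which $-\mathscr L$ is the number operator. -/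

import Mathlib

open Set Filter Topology

universe u v w x

namespace QuantumTransport

/-! ### Finite-dimensional tracial `*`-algebras -/

/-- A faithful tracial positive linear functional on a complex `*`-algebra. -/
structure FaithfulTrace (A : Type*) [Ring A] [StarRing A] [Algebra ℂ A] where
  toLin : A →ₗ[ℂ] ℂ
  nonneg : ∀ a : A, 0 ≤ (toLin (star a * a)).re ∧ (toLin (star a * a)).im = 0
  tracial : ∀ a b : A, toLin (a * b) = toLin (b * a)
  faithful : ∀ a : A, toLin (star a * a) = 0 → a = 0

instance {A : Type*} [Ring A] [StarRing A] [Algebra ℂ A] :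
    CoeFun (FaithfulTrace A) (fun _ => A → ℂ) := ⟨fun τ => τ.toLin⟩

/-- The sum of traces on a finite product of algebras. -/
def FaithfulTrace.pi {J : Type*} [Fintype J] {A : J → Type*} [∀ j, Ring (A j)]
    [∀ j, StarRing (A j)] [∀ j, Algebra ℂ (A j)] (τ : ∀ j, FaithfulTrace (A j)) :
    FaithfulTrace (∀ j, A j) where
  toLin := ∑ j, (τ j).toLin ∘ₗ LinearMap.proj j
  nonneg a := by
    simp only [LinearMap.sum_apply, LinearMap.comp_apply, LinearMap.proj_apply, Pi.mul_apply,
      Pi.star_apply, Complex.re_sum, Complex.im_sum]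
    exact ⟨Finset.sum_nonneg fun j _ => ((τ j).nonneg (a j)).1,
      Finset.sum_eq_zero fun j _ => ((τ j).nonneg (a j)).2⟩
  tracial a b := by
    simp only [LinearMap.sum_apply, LinearMap.comp_apply, LinearMap.proj_apply, Pi.mul_apply]
    exact Finset.sum_congr rfl fun j _ => (τ j).tracial _ _
  faithful a h := by
    simp only [LinearMap.sum_apply, LinearMap.comp_apply, LinearMap.proj_apply, Pi.mul_apply,
      Pi.star_apply] at h
    have h1 := congrArg Complex.re h
    rw [Complex.re_sum, Complex.zero_re,
      Finset.sum_eq_zero_iff_of_nonneg fun j _ => ((τ j).nonneg (a j)).1] at h1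
    funext j
    exact (τ j).faithful _ (Complex.ext (h1 j (Finset.mem_univ j)) ((τ j).nonneg (a j)).2)

section Adjoint

variable {A B : Type*} [Ring A] [StarRing A] [Algebra ℂ A] [StarModule ℂ A]
  [FiniteDimensional ℂ A] [Ring B] [StarRing B] [Algebra ℂ B] [StarModule ℂ B]

theorem FaithfulTrace.exists_adjoint (τA : FaithfulTrace A) (τB : FaithfulTrace B)
    (T : A →ₗ[ℂ] B) :
    ∃ S : B →ₗ[ℂ] A, ∀ (a : A) (b : B), τA (star a * S b) = τB (star (T a) * b) := by
  let Φ : A →ₗ[ℂ] (A →ₗ[ℂ] ℂ) :=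
    LinearMap.mk₂ ℂ (fun x a => τA.toLin (a * x))
      (fun x y a => by simp [mul_add]) (fun c x a => by simp)
      (fun x a b => by simp [add_mul]) (fun c x a => by simp)
  have hinj : Function.Injective Φ := by
    rw [← LinearMap.ker_eq_bot, LinearMap.ker_eq_bot']
    intro x hx
    exact τA.faithful x (LinearMap.congr_fun hx (star x))
  have hfin : Module.finrank ℂ A = Module.finrank ℂ (A →ₗ[ℂ] ℂ) :=
    (Subspace.dual_finrank_eq (K := ℂ) (V := A)).symm
  let e := LinearEquiv.ofInjectiveOfFinrankEq Φ hinj hfin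
  let Ψ : B →ₗ[ℂ] (A →ₗ[ℂ] ℂ) :=
    LinearMap.mk₂ ℂ (fun b a => τB.toLin (star (T (star a)) * b))
      (fun x y a => by simp [mul_add]) (fun c x a => by simp)
      (fun x a b => by simp [add_mul]) (fun c x a => by simp)
  refine ⟨e.symm.toLinearMap ∘ₗ Ψ, fun a b => ?_⟩
  have h : Φ (e.symm (Ψ b)) = Ψ b := e.apply_symm_apply (Ψ b)
  have h2 := LinearMap.congr_fun h (star a)
  simpa [Φ, Ψ] using h2

/-- The adjoint `T†` of `T` with respect to the inner products `⟨a, b⟩ = τ[a^* b]`. -/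
noncomputable def traceAdjoint (τA : FaithfulTrace A) (τB : FaithfulTrace B) (T : A →ₗ[ℂ] B) :
    B →ₗ[ℂ] A :=
  Classical.choose (τA.exists_adjoint τB T)

theorem traceAdjoint_spec (τA : FaithfulTrace A) (τB : FaithfulTrace B) (T : A →ₗ[ℂ] B)
    (a : A) (b : B) : τA (star a * traceAdjoint τA τB T b) = τB (star (T a) * b) :=
  Classical.choose_spec (τA.exists_adjoint τB T) a b

end Adjoint

/-- `T ⊗ id` preserves positivity on `A ⊗ M_n(ℂ)` for every `n`; the positive elements of a matrix
algebra over a finite-dimensional C*-algebra are those of the form `N^* N`. -/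
def IsCompletelyPositive {A B : Type*} [Ring A] [StarRing A] [Algebra ℂ A] [Ring B] [StarRing B]
    [Algebra ℂ B] (T : A →ₗ[ℂ] B) : Prop :=
  ∀ (n : ℕ) (N : Matrix (Fin n) (Fin n) A), ∃ N' : Matrix (Fin n) (Fin n) B,
    (N.conjTranspose * N).map T = N'.conjTranspose * N'

/-! ### Functional calculus -/

section Calculus

variable {A : Type*} [CStarAlgebra A]

/-- In finite dimension spectra are finite, so that every real function is continuous on them. -/
theorem spectrum_finite [FiniteDimensional ℂ A] (a : A) : (spectrum ℝ a).Finite := by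
  have : FiniteDimensional ℝ A := FiniteDimensional.complexToReal A
  have hint : IsIntegral ℝ a := Algebra.IsIntegral.isIntegral a
  refine ((minpoly ℝ a).roots.toFinset.finite_toSet).subset fun x hx => ?_
  have h : (minpoly ℝ a).eval x ∈ spectrum ℝ (Polynomial.aeval a (minpoly ℝ a)) :=
    spectrum.subset_polynomial_aeval a _ ⟨x, hx, rfl⟩
  rw [minpoly.aeval, spectrum.mem_iff, sub_zero] at h
  have hx0 : (minpoly ℝ a).eval x = 0 := by
    by_contra hne
    exact h ((IsUnit.mk0 _ hne).map (algebraMap ℝ A))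
  simpa [Polynomial.mem_roots (minpoly.ne_zero hint)] using hx0

/-- Positive definite: self-adjoint with spectrum in `(0, ∞)`. -/
def IsPosDef (a : A) : Prop := IsSelfAdjoint a ∧ ∀ x ∈ spectrum ℝ a, 0 < x

/-- Positive semidefinite: self-adjoint with spectrum in `[0, ∞)`. -/
def IsPosSemidef (a : A) : Prop := IsSelfAdjoint a ∧ ∀ x ∈ spectrum ℝ a, 0 ≤ x

/-- The spectral projection of a self-adjoint `R` at `x`. -/
noncomputable def spectralProj (R : A) (x : ℝ) : A :=
  cfc (Set.indicator {x} (fun _ => (1 : ℝ))) R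

/-- The contraction `θ(R, S) # C = ∑ θ(x, y) E_x^R C E_y^S` of the double operator sum. -/
noncomputable def doubleSum (θ : ℝ → ℝ → ℝ) (R S C : A) : A :=
  ∑ᶠ x ∈ spectrum ℝ R, ∑ᶠ y ∈ spectrum ℝ S,
    θ x y • (spectralProj R x * C * spectralProj S y)

end Calculus

open Classical in
/-- The logarithmic mean on `[0, ∞) × [0, ∞)`. -/
noncomputable def logMean (r s : ℝ) : ℝ :=
  if r = s then r else if r = 0 ∨ s = 0 then 0 else (r - s) / (Real.log r - Real.log s)

/-! ### Differential structures -/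

/-- A differential structure on the finite-dimensional C*-algebra `A`. The algebra attached to
`j : J` is `B (κ j)`; the label `κ j` makes it meaningful that `j` and `conj j` carry the same
algebra with the same trace. -/
structure DifferentialStructure (A : Type*) [CStarAlgebra A] (J : Type*) {ι : Type*}
    (B : ι → Type*) [∀ k, CStarAlgebra (B k)] where
  τ : FaithfulTrace A
  τB : ∀ k, FaithfulTrace (B k)
  κ : J → ι
  l : ∀ j, A →⋆ₐ[ℂ] B (κ j)
  r : ∀ j, A →⋆ₐ[ℂ] B (κ j)
  trace_l : ∀ j a, τB (κ j) (l j a) = τ a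
  trace_r : ∀ j a, τB (κ j) (r j a) = τ a
  V : ∀ j, B (κ j)
  V_ne_zero : ∀ j, V j ≠ 0
  conj : J → J
  conj_conj : ∀ j, conj (conj j) = j
  /-- `B_{j*} = B_j` and `V_{j*} = V_j^*`. -/
  V_conj : ∀ j, (⟨κ (conj j), V (conj j)⟩ : Σ k, B k) = ⟨κ j, star (V j)⟩
  /-- `τ_j[V_j^* l_j(a) V_j r_j(b)] = τ_j[V_j^* r_{j*}(a) V_j l_{j*}(b)]`, the right-hand side being
  written with `V_j^* = V_{j*}` and `V_j = V_{j*}^*`. -/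
  symm : ∀ j a b,
    τB (κ j) (star (V j) * l j a * V j * r j b) =
      τB (κ (conj j)) (V (conj j) * r (conj j) a * star (V (conj j)) * l (conj j) b)
  σ : A
  σ_posDef : IsPosDef σ
  trace_σ : τ σ = 1
  ω : J → ℝ
  /-- `V_j` is an eigenvector of the relative modular operator of `(l_j(σ), r_j(σ))`. -/
  modular : ∀ j, l j σ * V j * Ring.inverse (r j σ) = ((Real.exp (-ω j) : ℝ) : ℂ) • V j

namespace DifferentialStructure

variable {A : Type*} [CStarAlgebra A] [FiniteDimensional ℂ A] {J : Type*} [Fintype J] {ι : Type*}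
  {B : ι → Type*} [∀ k, CStarAlgebra (B k)] [∀ k, FiniteDimensional ℂ (B k)]
  (D : DifferentialStructure A J B)

/-- The trace on the product algebra `∏ j, B_j`. -/
noncomputable def τProd : FaithfulTrace (∀ j, B (D.κ j)) := FaithfulTrace.pi fun j => D.τB (D.κ j)

/-- `∂_j a = V_j r_j(a) - l_j(a) V_j`. -/
noncomputable def partialD (j : J) : A →ₗ[ℂ] B (D.κ j) where
  toFun a := D.V j * D.r j a - D.l j a * D.V j
  map_add' a b := by simp only [map_add, mul_add, add_mul]; abel
  map_smul' c a := by simp [smul_sub]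

/-- The gradient `∇ a = (∂_j a)_j`. -/
noncomputable def grad : A →ₗ[ℂ] (∀ j, B (D.κ j)) := LinearMap.pi D.partialD

/-- The adjoint of `∂_j` for the trace inner products. -/
noncomputable def partialAdj (j : J) : B (D.κ j) →ₗ[ℂ] A :=
  traceAdjoint D.τ (D.τB (D.κ j)) (D.partialD j)

/-- The divergence `div b = -∑ ∂_j† b_j`. -/
noncomputable def div (b : ∀ j, B (D.κ j)) : A := -∑ j, D.partialAdj j (b j)

/-- The power `σ^s`. -/
noncomputable def σpow (s : ℝ) : A := cfc (fun x : ℝ => x ^ s) D.σ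

/-- The KMS inner product on `A`. -/
noncomputable def kms (a b : A) : ℂ := D.τ (star a * D.σpow (1 / 2) * b * D.σpow (1 / 2))

/-- The KMS inner product on `B_j`. -/
noncomputable def kmsB (j : J) (a b : B (D.κ j)) : ℂ :=
  D.τB (D.κ j) (star a * D.l j (D.σpow (1 / 2)) * b * D.r j (D.σpow (1 / 2)))

/-- The Dirichlet form `E(a, b) = ∑ ⟨∂_j a, ∂_j b⟩_KMS`. -/
noncomputable def dirichletForm (a b : A) : ℂ :=
  ∑ j, D.kmsB j (D.partialD j a) (D.partialD j b)

/-- The operator `L` associated with the Dirichlet form, see `dirichletForm_eq`. -/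
noncomputable def generator : A →ₗ[ℂ] A :=
  -∑ j, LinearMap.mulLeft ℂ (D.σpow (-(1 / 2))) ∘ₗ LinearMap.mulRight ℂ (D.σpow (-(1 / 2))) ∘ₗ
    D.partialAdj j ∘ₗ LinearMap.mulLeft ℂ (D.l j (D.σpow (1 / 2))) ∘ₗ
    LinearMap.mulRight ℂ (D.r j (D.σpow (1 / 2))) ∘ₗ D.partialD j

theorem σpow_mul_σpow_neg (s : ℝ) : D.σpow s * D.σpow (-s) = 1 ∧ D.σpow (-s) * D.σpow s = 1 := by
  have hc : ∀ f : ℝ → ℝ, ContinuousOn f (spectrum ℝ D.σ) := fun f =>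
    (spectrum_finite D.σ).continuousOn f
  have hsa : IsSelfAdjoint D.σ := D.σ_posDef.1
  have key : ∀ u : ℝ, D.σpow u * D.σpow (-u) = 1 := fun u => by
    unfold σpow
    rw [← cfc_mul _ _ _ (hc _) (hc _), ← cfc_one ℝ D.σ]
    refine cfc_congr fun x hx => ?_
    have hx0 := D.σ_posDef.2 x hx
    simp only [Pi.one_apply]
    rw [← Real.rpow_add hx0, add_neg_cancel, Real.rpow_zero]
  exact ⟨key s, by simpa using key (-s)⟩

/-- `E(a, b) = -⟨a, L b⟩_KMS`. -/
theorem dirichletForm_eq (a b : A) : D.dirichletForm a b = -D.kms a (D.generator b) := by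
  have h1 := (D.σpow_mul_σpow_neg (1 / 2)).1
  have h2 := (D.σpow_mul_σpow_neg (1 / 2)).2
  have hk : ∀ x : A, D.kms a (D.σpow (-(1 / 2)) * (x * D.σpow (-(1 / 2)))) = D.τ (star a * x) := by
    intro x
    unfold kms
    congr 1
    calc star a * D.σpow (1 / 2) * (D.σpow (-(1 / 2)) * (x * D.σpow (-(1 / 2)))) * D.σpow (1 / 2)
        = star a * (D.σpow (1 / 2) * D.σpow (-(1 / 2))) * x *
          (D.σpow (-(1 / 2)) * D.σpow (1 / 2)) := by noncomm_ring
      _ = star a * x := by rw [h1, h2]; simp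
  have hlin : ∀ y : A, D.kms a y =
      (D.τ.toLin ∘ₗ LinearMap.mulRight ℂ (D.σpow (1 / 2)) ∘ₗ
        LinearMap.mulLeft ℂ (star a * D.σpow (1 / 2))) y := fun y => rfl
  have hg : D.generator b = -∑ j, D.σpow (-(1 / 2)) * (D.partialAdj j
      (D.l j (D.σpow (1 / 2)) * (D.partialD j b * D.r j (D.σpow (1 / 2)))) *
        D.σpow (-(1 / 2))) := by
    simp [generator]
  rw [hg, hlin, map_neg, neg_neg, map_sum, dirichletForm]
  refine Finset.sum_congr rfl fun j _ => ?_
  rw [← hlin, hk, partialAdj, traceAdjoint_spec, kmsB]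
  congr 1
  noncomm_ring

/-- The adjoint `L†` of the generator for the trace inner product. -/
noncomputable def generatorAdj : A →ₗ[ℂ] A := traceAdjoint D.τ D.τ D.generator

/-- The quantum Markov semigroup `P_t = exp(t L)`. -/
noncomputable def semigroup (t : ℝ) : A →ₗ[ℂ] A :=
  (NormedSpace.exp ((t : ℂ) • LinearMap.toContinuousLinearMap D.generator : A →L[ℂ] A) : A →L[ℂ] A)

/-- The adjoint `P_t†`. -/
noncomputable def semigroupAdj (t : ℝ) : A →ₗ[ℂ] A := traceAdjoint D.τ D.τ (D.semigroup t)

/-- The semigroup is ergodic: the kernel of `L` consists of the multiples of the identity. -/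
def IsErgodic : Prop := LinearMap.ker D.generator = Submodule.span ℂ {(1 : A)}

/-! ### The transport metric -/

/-- The set of density matrices. -/
def density : Set A := {ρ | IsPosSemidef ρ ∧ D.τ ρ = 1}

/-- The set of positive definite density matrices. -/
def densityPos : Set A := {ρ | IsPosDef ρ ∧ D.τ ρ = 1}

/-- The tangent space `Ran(L†) ∩ A_h`. -/
def tangent : Set A := {a | IsSelfAdjoint a ∧ a ∈ LinearMap.range D.generatorAdj}

/-- The tilted logarithmic mean `θ_j(x, y) = Λ(e^{ω_j/2} x, e^{-ω_j/2} y)`. -/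
noncomputable def θ (j : J) (x y : ℝ) : ℝ :=
  logMean (Real.exp (D.ω j / 2) * x) (Real.exp (-D.ω j / 2) * y)

/-- `K_ρ a = ∑ ∂_j†(θ_j(l_j(ρ), r_j(ρ)) # ∂_j a)`. -/
noncomputable def Kop (ρ a : A) : A :=
  ∑ j, D.partialAdj j (doubleSum (D.θ j) (D.l j ρ) (D.r j ρ) (D.partialD j a))

/-- The quadratic form `⟨K_ρ a, a⟩ = ‖∇a‖_ρ^2`. -/
noncomputable def energy (ρ a : A) : ℝ := (D.τ (star (D.Kop ρ a) * a)).re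

/-- The action `𝒜(ρ, b) = ∑ τ_j[b_j^* ((1/θ_j)(l_j(ρ), r_j(ρ)) # b_j)]`. -/
noncomputable def action (ρ : A) (b : ∀ j, B (D.κ j)) : ℝ :=
  ∑ j, (D.τB (D.κ j) (star (b j) *
    doubleSum (fun x y => (D.θ j x y)⁻¹) (D.l j ρ) (D.r j ρ) (b j))).re

/-- `(ρ_t, a_t)` is a smooth solution on `[0, 1]` of `∂_t ρ_t = K_{ρ_t} a_t` from `ρ₀` to `ρ₁`
in the set of positive definite density matrices. -/
def IsAdmissible (ρ₀ ρ₁ : A) (ρ a : ℝ → A) : Prop :=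
  ContDiffOn ℝ ((⊤ : ℕ∞) : WithTop ℕ∞) ρ (Icc 0 1) ∧
  ContDiffOn ℝ ((⊤ : ℕ∞) : WithTop ℕ∞) a (Icc 0 1) ∧
  ρ 0 = ρ₀ ∧ ρ 1 = ρ₁ ∧
  ∀ t ∈ Icc (0 : ℝ) 1, ρ t ∈ D.densityPos ∧ a t ∈ D.tangent ∧
    HasDerivWithinAt ρ (D.Kop (ρ t) (a t)) (Icc 0 1) t

/-- The Riemannian distance on positive definite density matrices. -/
noncomputable def distPos (ρ₀ ρ₁ : A) : ℝ :=
  Real.sqrt (sInf {c : ℝ | ∃ ρ a : ℝ → A, D.IsAdmissible ρ₀ ρ₁ ρ a ∧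
    c = ∫ t in (0 : ℝ)..1, D.energy (ρ t) (a t)})

/-- The continuous extension `W` of the Riemannian distance to all density matrices. -/
noncomputable def W (ρ₀ ρ₁ : A) : ℝ :=
  extendFrom (D.densityPos ×ˢ D.densityPos) (fun p : A × A => D.distPos p.1 p.2) (ρ₀, ρ₁)

/-- The relative entropy `τ[ρ (log ρ - log σ)]`, with `0 log 0 = 0`. -/
noncomputable def entropy (ρ : A) : ℝ :=
  (D.τ (cfc (fun x : ℝ => x * Real.log x) ρ - ρ * cfc Real.log D.σ)).re

/-! ### Lower Ricci curvature bounds -/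

/-- `γ` is a constant speed geodesic of `(density, W)`, parametrised by `[0, 1]`. -/
def IsGeodesic (γ : ℝ → A) : Prop :=
  (∀ t ∈ Icc (0 : ℝ) 1, γ t ∈ D.density) ∧
  ∀ s ∈ Icc (0 : ℝ) 1, ∀ t ∈ Icc (0 : ℝ) 1, D.W (γ s) (γ t) = |s - t| * D.W (γ 0) (γ 1)

/-- The `lam`-convexity inequality for the entropy along `γ`. -/
def ConvexAlong (lam : ℝ) (γ : ℝ → A) : Prop :=
  ∀ t ∈ Icc (0 : ℝ) 1, D.entropy (γ t) ≤
    (1 - t) * D.entropy (γ 0) + t * D.entropy (γ 1)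
      - lam / 2 * (t * (1 - t)) * D.W (γ 0) (γ 1) ^ 2

/-- Weak geodesic `lam`-convexity of the entropy. -/
def WeaklyConvex (lam : ℝ) : Prop :=
  ∀ ρ₀ ∈ D.density, ∀ ρ₁ ∈ D.density, ∃ γ : ℝ → A,
    γ 0 = ρ₀ ∧ γ 1 = ρ₁ ∧ D.IsGeodesic γ ∧ D.ConvexAlong lam γ

/-- Strong geodesic `lam`-convexity of the entropy. -/
def StronglyConvex (lam : ℝ) : Prop :=
  ∀ γ : ℝ → A, D.IsGeodesic γ → D.ConvexAlong lam γ

/-- The upper right Dini derivative, as an extended real number. -/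
noncomputable def _root_.QuantumTransport.upperRightDeriv (f : ℝ → ℝ) (t : ℝ) : EReal :=
  Filter.limsup (fun h : ℝ => (((f (t + h) - f t) / h : ℝ) : EReal)) (𝓝[>] 0)

/-- The evolution variational inequality. -/
def EVI (lam : ℝ) : Prop :=
  ∀ ρ ∈ D.density, ∀ ν ∈ D.density, ∀ t : ℝ, 0 ≤ t →
    ((1 / 2 : ℝ) : EReal) * upperRightDeriv (fun s => D.W (D.semigroupAdj s ρ) ν ^ 2) t
      + ((lam / 2 * D.W (D.semigroupAdj t ρ) ν ^ 2 : ℝ) : EReal)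
      ≤ ((D.entropy ν - D.entropy (D.semigroupAdj t ρ) : ℝ) : EReal)

/-- `(ρ_s, a_s)` solves the geodesic equations `∂_s ρ_s = K_{ρ_s} a_s` and
`∂_s a_s = -½ ⟨DK_{ρ_s} a_s, a_s⟩` in a neighbourhood of `s = 0`, the second one being tested
against tangent vectors `b`. -/
def IsGeodesicFlow (ρ a : ℝ → A) : Prop :=
  ∃ δ > 0, ∀ s ∈ Ioo (-δ) δ, ρ s ∈ D.densityPos ∧ a s ∈ D.tangent ∧
    HasDerivAt ρ (D.Kop (ρ s) (a s)) s ∧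
    ∃ a' : A, HasDerivAt a a' s ∧ ∀ b ∈ D.tangent,
      (D.τ (a' * b)).re = -(1 / 2) * deriv (fun ε : ℝ => D.energy (ρ s + ε • b) (a s)) 0

/-- The Hessian bound `Hess Ent(ρ)[a, a] ≥ lam ⟨K_ρ a, a⟩`; the Hessian is the second derivative of
the entropy along the solution of the geodesic equations started at `(ρ, a)`. -/
def HessianBound (lam : ℝ) : Prop :=
  ∀ ρ a : ℝ → A, D.IsGeodesicFlow ρ a →
    lam * D.energy (ρ 0) (a 0) ≤ deriv (deriv fun s => D.entropy (ρ s)) 0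

/-- `Ric ≥ lam`: the (mutually equivalent) characterisations of geodesic `lam`-convexity of the
entropy hold. -/
def RicciBoundedBelow (lam : ℝ) : Prop :=
  D.WeaklyConvex lam ∧ D.StronglyConvex lam ∧ D.EVI lam ∧ D.HessianBound lam

/-! ### The intertwining property -/

/-- For every `t ≥ 0` and every `j`, the operator `Q t j` extends `P_t†` to `B_j`: it is completely
positive, trace preserving, and compatible with `l_j` and `r_j`. -/
def IsExtension (Q : ℝ → ∀ j, B (D.κ j) →ₗ[ℂ] B (D.κ j)) : Prop :=
  ∀ t : ℝ, 0 ≤ t → ∀ j, IsCompletelyPositive (Q t j) ∧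
    (∀ b, D.τB (D.κ j) (Q t j b) = D.τB (D.κ j) b) ∧
    (∀ a, Q t j (D.l j a) = D.l j (D.semigroupAdj t a)) ∧
    (∀ a, Q t j (D.r j a) = D.r j (D.semigroupAdj t a))

/-- The isomorphisms `φ_j` identify every `(B_j, τ_j)` with `(A, τ)`, in such a way that `l_j` and
`r_j`, read as maps on `A`, commute with `P_t`. -/
def IsIdentification (φ : ∀ j, A ≃⋆ₐ[ℂ] B (D.κ j)) : Prop :=
  ∀ j, (∀ a, D.τB (D.κ j) (φ j a) = D.τ a) ∧
    ∀ t : ℝ, 0 ≤ t → ∀ a,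
      D.semigroup t ((φ j).symm (D.l j a)) = (φ j).symm (D.l j (D.semigroup t a)) ∧
      D.semigroup t ((φ j).symm (D.r j a)) = (φ j).symm (D.r j (D.semigroup t a))

/-- The operator `P_t†`, acting on `B_j` through the identification `φ_j` of `A` with `B_j`. -/
noncomputable def transported (φ : ∀ j, A ≃⋆ₐ[ℂ] B (D.κ j)) (t : ℝ) (j : J) :
    B (D.κ j) →ₗ[ℂ] B (D.κ j) :=
  (φ j : A →ₗ[ℂ] B (D.κ j)) ∘ₗ D.semigroupAdj t ∘ₗ ((φ j).symm : B (D.κ j) →ₗ[ℂ] A)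

/-- The family `Pv` on `∏ j, B_j` is `lam`-intertwining, where `Q t j` is `P_t†` acting on `B_j`. -/
def IsIntertwining (lam : ℝ) (Q : ℝ → ∀ j, B (D.κ j) →ₗ[ℂ] B (D.κ j))
    (Pv : ℝ → (∀ j, B (D.κ j)) →ₗ[ℂ] (∀ j, B (D.κ j))) : Prop :=
  (∀ a : A, ∀ t : ℝ, 0 ≤ t → D.grad (D.semigroup t a) = Pv t (D.grad a)) ∧
  ∀ ρ ∈ D.densityPos, ∀ b : ∀ j, B (D.κ j), ∀ t : ℝ, 0 ≤ t →
    D.action ρ (traceAdjoint D.τProd D.τProd (Pv t) b) ≤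
      Real.exp (-2 * lam * t) * D.action ρ (fun j => Q t j (b j))

end DifferentialStructure

/-! ### The fermionic Ornstein-Uhlenbeck structure -/

section Clifford

open scoped Matrix.Norms.L2Operator ComplexOrder

/-- The sign `(-1)^{#{i ∈ S : i < j}}`. -/
def fermiSign {n : ℕ} (j : Fin n) (S : Finset (Fin n)) : ℂ := (-1) ^ (S.filter (· < j)).card

/-- The operators `Q_j e_S = ± e_{S ∆ {j}}` on `ℂ^{2^n}`; they are self-adjoint and satisfy the
canonical anti-commutation relations, see `fermiQ_star` and `fermiQ_car`. -/
def fermiQ {n : ℕ} (j : Fin n) : Matrix (Finset (Fin n)) (Finset (Fin n)) ℂ :=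
  fun S T => if S = symmDiff T {j} then fermiSign j T else 0

/-- The parity operator `e_S ↦ (-1)^{#S} e_S`. -/
def fermiParity (n : ℕ) : Matrix (Finset (Fin n)) (Finset (Fin n)) ℂ :=
  Matrix.diagonal fun S => (-1) ^ S.card

theorem fermiSign_symmDiff {n : ℕ} (i j : Fin n) (S : Finset (Fin n)) :
    fermiSign i (symmDiff S {j}) = (if j < i then -1 else 1) * fermiSign i S := by
  unfold fermiSign
  have hf : (symmDiff S {j}).filter (· < i) =
      symmDiff (S.filter (· < i)) (if j < i then {j} else ∅) := by
    ext x
    by_cases hji : j < i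
    · by_cases hxj : x = j <;> simp [Finset.mem_symmDiff, hji, hxj]
    · by_cases hxj : x = j
      · simp [Finset.mem_symmDiff, hji, hxj]
      · simp [Finset.mem_symmDiff, hji, hxj]
  rw [hf]
  by_cases hji : j < i
  · rw [if_pos hji, if_pos hji]
    by_cases hj : j ∈ S
    · have h : symmDiff (S.filter (· < i)) {j} = (S.filter (· < i)).erase j := by
        ext x
        by_cases hxj : x = j <;> simp [Finset.mem_symmDiff, hxj, hj, hji]
      have hm : j ∈ S.filter (· < i) := by simp [hj, hji]
      rw [h, ← Finset.card_erase_add_one hm, pow_succ]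
      ring
    · have h : symmDiff (S.filter (· < i)) {j} = insert j (S.filter (· < i)) := by
        ext x
        by_cases hxj : x = j <;> simp [Finset.mem_symmDiff, hxj, hj]
      have hm : j ∉ S.filter (· < i) := by simp [hj]
      rw [h, Finset.card_insert_of_notMem hm, pow_succ]
      ring
  · rw [if_neg hji, if_neg hji, one_mul, ← Finset.bot_eq_empty, symmDiff_bot]

theorem fermiSign_sq {n : ℕ} (j : Fin n) (S : Finset (Fin n)) :
    fermiSign j S * fermiSign j S = 1 := by
  unfold fermiSign
  rw [← mul_pow]
  simp

theorem fermiQ_star {n : ℕ} (j : Fin n) : star (fermiQ j) = fermiQ j := by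
  ext S T
  rw [Matrix.star_apply]
  unfold fermiQ
  by_cases h : S = symmDiff T {j}
  · have h' : T = symmDiff S {j} := by rw [h, symmDiff_symmDiff_cancel_right]
    rw [if_pos h, if_pos h', h, fermiSign_symmDiff]
    simp [fermiSign]
  · have h' : ¬ T = symmDiff S {j} := fun h' => h (by rw [h', symmDiff_symmDiff_cancel_right])
    rw [if_neg h, if_neg h', star_zero]

theorem fermiQ_mul_apply {n : ℕ} (i j : Fin n) (S T : Finset (Fin n)) :
    (fermiQ i * fermiQ j) S T =
      if S = symmDiff (symmDiff T {j}) {i} then fermiSign i (symmDiff T {j}) * fermiSign j T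
      else 0 := by
  rw [Matrix.mul_apply, Finset.sum_eq_single (symmDiff T {j})]
  · simp [fermiQ]
  · intro U _ hU
    simp [fermiQ, hU]
  · simp

/-- The canonical anti-commutation relations `Q_i Q_j + Q_j Q_i = 2 δ_{ij}`. -/
theorem fermiQ_car {n : ℕ} (i j : Fin n) :
    fermiQ i * fermiQ j + fermiQ j * fermiQ i = if i = j then 2 else 0 := by
  ext S T
  rw [Matrix.add_apply, fermiQ_mul_apply, fermiQ_mul_apply, fermiSign_symmDiff, fermiSign_symmDiff,
    symmDiff_right_comm T {i} {j}]
  by_cases hij : i = j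
  · subst hij
    have h2 : (2 : Matrix (Finset (Fin n)) (Finset (Fin n)) ℂ) = 1 + 1 := by norm_num
    simp only [lt_irrefl, if_false, if_true, one_mul, symmDiff_symmDiff_cancel_right, fermiSign_sq,
      h2, Matrix.add_apply, Matrix.one_apply]
  · rw [if_neg hij, Matrix.zero_apply]
    rcases lt_or_gt_of_ne hij with h | h
    · simp only [if_pos h, if_neg h.not_gt]
      split_ifs <;> ring
    · simp only [if_pos h, if_neg (not_lt.mpr (le_of_lt h))]
      split_ifs <;> ring

theorem fermiParity_mul_self (n : ℕ) : fermiParity n * fermiParity n = 1 := by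
  unfold fermiParity
  rw [Matrix.diagonal_mul_diagonal, ← Matrix.diagonal_one]
  congr 1
  funext S
  rw [← mul_pow]
  simp

theorem fermiParity_star (n : ℕ) : star (fermiParity n) = fermiParity n := by
  unfold fermiParity
  rw [Matrix.star_eq_conjTranspose, Matrix.diagonal_conjTranspose]
  congr 1
  funext S
  simp

theorem fermiParity_conj_fermiQ {n : ℕ} (j : Fin n) :
    fermiParity n * fermiQ j * fermiParity n = -fermiQ j := by
  ext S T
  unfold fermiParity
  rw [Matrix.mul_diagonal, Matrix.diagonal_mul, Matrix.neg_apply]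
  unfold fermiQ
  by_cases h : S = symmDiff T {j}
  · rw [if_pos h, h]
    have hc : ((-1 : ℂ)) ^ (symmDiff T {j}).card = -(-1) ^ T.card := by
      by_cases hj : j ∈ T
      · have h1 : symmDiff T {j} = T.erase j := by
          ext x
          by_cases hxj : x = j <;> simp [Finset.mem_symmDiff, hxj, hj]
        rw [h1, ← Finset.card_erase_add_one hj, pow_succ]
        ring
      · have h1 : symmDiff T {j} = insert j T := by
          ext x
          by_cases hxj : x = j <;> simp [Finset.mem_symmDiff, hxj, hj]
        rw [h1, Finset.card_insert_of_notMem hj, pow_succ]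
        ring
    have hs : ((-1 : ℂ)) ^ T.card * (-1) ^ T.card = 1 := by rw [← mul_pow]; simp
    rw [hc]
    linear_combination -(fermiSign j T) * hs
  · rw [if_neg h]
    simp

/-- The Clifford algebra generated by `Q_1, …, Q_n`. -/
noncomputable def cliffordSubalgebra (n : ℕ) :
    StarSubalgebra ℂ (Matrix (Finset (Fin n)) (Finset (Fin n)) ℂ) :=
  StarAlgebra.adjoin ℂ (Set.range fermiQ)

/-- The Clifford algebra as a type. -/
def Cl (n : ℕ) : Type := cliffordSubalgebra n

noncomputable instance (n : ℕ) : CStarAlgebra (Cl n) :=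
  haveI : IsClosed (cliffordSubalgebra n : Set (Matrix (Finset (Fin n)) (Finset (Fin n)) ℂ)) :=
    Submodule.closed_of_finiteDimensional (cliffordSubalgebra n).toSubalgebra.toSubmodule
  StarSubalgebra.cstarAlgebra (cliffordSubalgebra n)

/-- The inclusion of the Clifford algebra into the matrices. -/
noncomputable def Cl.val {n : ℕ} :
    Cl n →⋆ₐ[ℂ] Matrix (Finset (Fin n)) (Finset (Fin n)) ℂ :=
  (cliffordSubalgebra n).subtype

theorem Cl.val_injective {n : ℕ} : Function.Injective (Cl.val (n := n)) := Subtype.val_injective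

instance (n : ℕ) : FiniteDimensional ℂ (Cl n) :=
  FiniteDimensional.of_injective (Cl.val (n := n)).toAlgHom.toLinearMap Cl.val_injective

/-- The generator `Q_j` as an element of the Clifford algebra. -/
noncomputable def Cl.Q {n : ℕ} (j : Fin n) : Cl n :=
  ⟨fermiQ j, StarAlgebra.subset_adjoin ℂ _ ⟨j, rfl⟩⟩

theorem Cl.val_Q {n : ℕ} (j : Fin n) : Cl.val (Cl.Q j) = fermiQ j := rfl

/-- Conjugation by the parity operator. -/
noncomputable def fermiConj (n : ℕ) :
    Matrix (Finset (Fin n)) (Finset (Fin n)) ℂ →⋆ₐ[ℂ] Matrix (Finset (Fin n)) (Finset (Fin n)) ℂ where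
  toFun a := fermiParity n * a * fermiParity n
  map_one' := by rw [mul_one, fermiParity_mul_self]
  map_mul' a b := by
    calc fermiParity n * (a * b) * fermiParity n
        = fermiParity n * a * 1 * b * fermiParity n := by noncomm_ring
      _ = _ := by rw [← fermiParity_mul_self]; noncomm_ring
  map_zero' := by simp
  map_add' a b := by noncomm_ring
  commutes' c := by
    rw [← Algebra.commutes, mul_assoc, fermiParity_mul_self, mul_one]
  map_star' a := by
    rw [star_mul, star_mul, fermiParity_star, mul_assoc]

theorem fermiConj_mem {n : ℕ} (a : Cl n) : fermiConj n (Cl.val a) ∈ cliffordSubalgebra n := by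
  have h : cliffordSubalgebra n ≤ (cliffordSubalgebra n).comap (fermiConj n) := by
    refine StarAlgebra.adjoin_le ?_
    rintro _ ⟨j, rfl⟩
    change fermiConj n (fermiQ j) ∈ cliffordSubalgebra n
    have h1 : fermiConj n (fermiQ j) = -fermiQ j := fermiParity_conj_fermiQ j
    rw [h1]
    exact neg_mem (StarAlgebra.subset_adjoin ℂ _ ⟨j, rfl⟩)
  exact h a.2

/-- The principal automorphism, determined by `Γ Q_j = -Q_j`. -/
noncomputable def Cl.Γ (n : ℕ) : Cl n →⋆ₐ[ℂ] Cl n :=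
  ((fermiConj n).comp Cl.val).codRestrict (cliffordSubalgebra n) fermiConj_mem

theorem Cl.val_Γ {n : ℕ} (a : Cl n) :
    Cl.val (Cl.Γ n a) = fermiParity n * Cl.val a * fermiParity n := rfl

theorem Cl.Γ_Q {n : ℕ} (j : Fin n) : Cl.Γ n (Cl.Q j) = -Cl.Q j :=
  Cl.val_injective (by rw [Cl.val_Γ, map_neg, Cl.val_Q, fermiParity_conj_fermiQ])

theorem Cl.Γ_Γ {n : ℕ} (a : Cl n) : Cl.Γ n (Cl.Γ n a) = a :=
  Cl.val_injective (by
    rw [Cl.val_Γ, Cl.val_Γ]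
    calc fermiParity n * (fermiParity n * Cl.val a * fermiParity n) * fermiParity n
        = (fermiParity n * fermiParity n) * Cl.val a * (fermiParity n * fermiParity n) := by
          noncomm_ring
      _ = Cl.val a := by rw [fermiParity_mul_self, one_mul, mul_one])

theorem Cl.star_Q {n : ℕ} (j : Fin n) : star (Cl.Q j) = Cl.Q j :=
  Cl.val_injective (by rw [map_star, Cl.val_Q, fermiQ_star])

theorem Cl.Q_ne_zero {n : ℕ} (j : Fin n) : Cl.Q j ≠ 0 := by
  intro h
  have h1 : fermiQ j {j} ∅ = 0 := by
    rw [← Cl.val_Q, h, map_zero, Matrix.zero_apply]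
  have h2 : symmDiff (∅ : Finset (Fin n)) {j} = {j} := by
    rw [← Finset.bot_eq_empty, bot_symmDiff]
  simp [fermiQ, fermiSign, h2] at h1

instance (n : ℕ) : Nontrivial (Cl n) :=
  ⟨⟨0, 1, fun h => zero_ne_one (α := Matrix (Finset (Fin n)) (Finset (Fin n)) ℂ) (by
    rw [← map_one (Cl.val (n := n)), ← map_zero (Cl.val (n := n)), h])⟩⟩

/-- The canonical trace, i.e. the normalised trace of matrices. -/
noncomputable def Cl.trace (n : ℕ) : FaithfulTrace (Cl n) where
  toLin := ((2 : ℂ) ^ n)⁻¹ • (Matrix.traceLinearMap (Finset (Fin n)) ℂ ℂ ∘ₗ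
    (Cl.val (n := n)).toAlgHom.toLinearMap)
  nonneg a := by
    have h : Matrix.trace (Cl.val (star a * a)) =
        ((∑ S, ∑ T, ‖Cl.val a T S‖ ^ 2 : ℝ) : ℂ) := by
      rw [map_mul, map_star, Matrix.trace]
      simp only [Matrix.diag_apply, Matrix.mul_apply, Matrix.star_apply]
      push_cast
      refine Finset.sum_congr rfl fun S _ => Finset.sum_congr rfl fun T _ => ?_
      rw [RCLike.star_def, Complex.conj_mul']
    have h2 : ((2 : ℂ) ^ n)⁻¹ = ((((2 : ℝ) ^ n)⁻¹ : ℝ) : ℂ) := by push_cast; rfl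
    change 0 ≤ (((2 : ℂ) ^ n)⁻¹ * Matrix.trace (Cl.val (star a * a))).re ∧
      (((2 : ℂ) ^ n)⁻¹ * Matrix.trace (Cl.val (star a * a))).im = 0
    rw [h, h2, ← Complex.ofReal_mul]
    exact ⟨by rw [Complex.ofReal_re]; positivity, Complex.ofReal_im _⟩
  tracial a b := by
    change ((2 : ℂ) ^ n)⁻¹ * Matrix.trace (Cl.val (a * b)) =
      ((2 : ℂ) ^ n)⁻¹ * Matrix.trace (Cl.val (b * a))
    rw [map_mul, map_mul, Matrix.trace_mul_comm]
  faithful a h := by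
    change ((2 : ℂ) ^ n)⁻¹ * Matrix.trace (Cl.val (star a * a)) = 0 at h
    rw [map_mul, map_star] at h
    have h1 : Matrix.trace ((Cl.val a).conjTranspose * Cl.val a) = 0 := by
      rcases mul_eq_zero.mp h with h0 | h0
      · simp at h0
      · exact h0
    have h2 := Matrix.trace_conjTranspose_mul_self_eq_zero_iff.mp h1
    exact Cl.val_injective (by rw [h2, map_zero])

theorem Cl.trace_apply {n : ℕ} (a : Cl n) :
    Cl.trace n a = ((2 : ℂ) ^ n)⁻¹ * Matrix.trace (Cl.val a) := rfl

theorem Cl.trace_one (n : ℕ) : Cl.trace n 1 = 1 := by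
  rw [Cl.trace_apply, map_one, Matrix.trace_one]
  simp

theorem Cl.trace_Γ {n : ℕ} (a : Cl n) : Cl.trace n (Cl.Γ n a) = Cl.trace n a := by
  rw [Cl.trace_apply, Cl.trace_apply, Cl.val_Γ, Matrix.trace_mul_comm, ← mul_assoc,
    fermiParity_mul_self, one_mul]

/-- The differential structure of the fermionic Ornstein-Uhlenbeck equation, with
`∂_j a = c (Q_j a - Γ(a) Q_j)`. -/
noncomputable def fermionicStructure (n : ℕ) (c : ℝ) (hc : c ≠ 0) :
    DifferentialStructure (Cl n) (Fin n) (fun _ : Unit => Cl n) where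
  τ := Cl.trace n
  τB _ := Cl.trace n
  κ _ := ()
  l _ := Cl.Γ n
  r _ := StarAlgHom.id ℂ (Cl n)
  trace_l _ a := Cl.trace_Γ a
  trace_r _ _ := rfl
  V j := (c : ℂ) • Cl.Q j
  V_ne_zero j := smul_ne_zero (by exact_mod_cast hc) (Cl.Q_ne_zero j)
  conj j := j
  conj_conj _ := rfl
  V_conj j := by
    rw [star_smul, Cl.star_Q]
    simp
  symm j a b := by
    have key : (Cl.trace n).toLin (Cl.Q j * Cl.Γ n a * Cl.Q j * b) =
        (Cl.trace n).toLin (Cl.Q j * a * Cl.Q j * Cl.Γ n b) := by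
      rw [← Cl.trace_Γ]
      congr 1
      rw [map_mul, map_mul, map_mul, Cl.Γ_Q, Cl.Γ_Γ]
      noncomm_ring
    have hs : ∀ x y : Cl n, (Cl.trace n).toLin
        (((c : ℂ) • Cl.Q j) * x * ((c : ℂ) • Cl.Q j) * y) =
          ((c : ℂ) * c) * (Cl.trace n).toLin (Cl.Q j * x * Cl.Q j * y) := by
      intro x y
      rw [smul_mul_assoc, smul_mul_assoc, smul_mul_assoc, mul_smul_comm, smul_mul_assoc, map_smul,
        map_smul, smul_eq_mul, smul_eq_mul, ← mul_assoc (c : ℂ)]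
    have hst : star ((c : ℂ) • Cl.Q j) = (c : ℂ) • Cl.Q j := by
      rw [star_smul, Cl.star_Q, RCLike.star_def, Complex.conj_ofReal]
    rw [hst]
    exact (hs _ _).trans ((congrArg _ key).trans (hs _ _).symm)
  σ := 1
  σ_posDef := by
    refine ⟨IsSelfAdjoint.one _, fun x hx => ?_⟩
    rw [spectrum.one_eq, Set.mem_singleton_iff] at hx
    rw [hx]
    exact one_pos
  trace_σ := Cl.trace_one n
  ω _ := 0
  modular j := by simp

end Clifford
end QuantumTransport

/-!
The semigroup `P_t` enters through a gradient estimate, from which the four conditions of the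
curvature bound follow without further use of the intertwining family.

Correlations. The forms `S_j(p, q) = τ_j[V_j^* l_j(p) V_j r_j(q)]` carry the symmetry under the
involution of the index set and the modular relation with `σ`. They express the generator
(`trace_mul_generator`), its dissipation inequality (`dissipation_nonneg`) and the operators `K_ρ`
(`trace_mul_Kop`). The dissipation inequality makes `P_t` positive and gives the Schwarz inequality
(`semigroup_schwarz`), which is all that is needed of complete positivity.

Gradient estimate. The reciprocal of the logarithmic mean is an average of reciprocals of weighted
arithmetic means. For each of these, the monotonicity of `τ[b^* (a L_R + a' R_S)^{-1} b]` under Schwarz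
maps is a duality argument; hence the action decreases along `P_t†` (`Acts.action_le`). Together with
the intertwining relation, duality between `θ` and `1 / θ` yields
`‖∇ P_t a‖²_ρ ≤ e^{-2 λ t} ‖∇ a‖²` at `P_t† ρ` (`IsIntertwining.gradientEstimate`).

Hessian. The chain rule `K_ρ (log ρ - log σ) = -L† ρ` (`Kop_log`) identifies `P_t†` with the gradient
flow of the entropy. Differentiating the gradient estimate at `t = 0` gives the Hessian bound
(`GradientEstimate.hessianBound`).

Evolution variational inequality and convexity. In a curve of nearly minimal energy, the point at time
`s` is moved by `P_{ts}†`. The gradient estimate and the chain rule for the entropy bound the energy of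
the new curve, and the result is a discrete evolution variational inequality, uniform in the end
points (`GradientEstimate.W_semigroupAdj_sq_le`). Its limit `t → 0` is the evolution variational
inequality, and applied from an intermediate point of a geodesic towards both ends it gives the
convexity of the entropy. These arguments avoid the regularity of geodesics: the distance extends
continuously to the compact set of all density matrices because a density matrix is at distance
`O(√ε)` from its mixture with the identity (`IsErgodic.exists_distPos_mix_sq_le`), and geodesics are
limits of nearly minimising curves along an ultrafilter (`IsErgodic.exists_isGeodesic`).

Fermions. The automorphisms `T_j(a) = Q_j Γ(a) Q_j` change the sign of the single generator `Q_j`, and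
for `V_j = c Q_j` the generator of the semigroup is `2 c² ∑ (T_j - 1)`. Only scalars are fixed by all
sign changes, which is ergodicity, and `∂_j P_t = e^{-4 c² t} P_t ∂_j`, so that damping `P_t` gives an
intertwining family.
-/

set_option linter.unusedSectionVars false

namespace QuantumTransport

/-! ### Faithful traces -/

section Trace

variable {A : Type*} [Ring A] [StarRing A] [Algebra ℂ A] [StarModule ℂ A] (τ : FaithfulTrace A)

/-- Positivity at `1 + a` and at `1 + i a` forces a faithful trace to be hermitian. -/
theorem FaithfulTrace.map_star (a : A) : τ (star a) = star (τ a) := by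
  have h1 := (τ.nonneg (1 + a)).2
  have h2 := (τ.nonneg (1 + Complex.I • a)).2
  have h3 := (τ.nonneg a).2
  have h4 := (τ.nonneg 1).2
  have e1 : star (1 + a) * (1 + a) = star (1 : A) * 1 + a + star a + star a * a := by
    simp only [star_add, star_one]; noncomm_ring
  have e2 : star (1 + Complex.I • a) * (1 + Complex.I • a) =
      star (1 : A) * 1 + Complex.I • a - Complex.I • star a + star a * a := by
    simp only [star_add, star_one, star_smul, RCLike.star_def, Complex.conj_I]
    simp only [add_mul, mul_add, one_mul, mul_one, smul_mul_assoc, mul_smul_comm, smul_add,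
      smul_smul, neg_smul, smul_neg, Complex.I_mul_I, neg_mul, neg_neg, one_smul]
    abel
  rw [e1] at h1
  rw [e2] at h2
  simp only [map_add, map_sub, map_smul, Complex.add_im, Complex.sub_im, smul_eq_mul,
    Complex.mul_im, Complex.I_re, Complex.I_im, h3, h4] at h1 h2
  rw [RCLike.star_def]
  apply Complex.ext
  · rw [Complex.conj_re]; linarith
  · rw [Complex.conj_im]; linarith

theorem FaithfulTrace.re_star (a : A) : (τ (star a)).re = (τ a).re := by
  rw [τ.map_star, RCLike.star_def, Complex.conj_re]

/-- The real part of the inner product `⟨a, b⟩ = τ[a^* b]` is symmetric. -/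
theorem FaithfulTrace.re_inner_comm (a b : A) :
    (τ (star a * b)).re = (τ (star b * a)).re := by
  rw [← τ.re_star (star a * b), star_mul, star_star]

theorem FaithfulTrace.inner_self_pos {a : A} (ha : a ≠ 0) : 0 < (τ (star a * a)).re := by
  rcases (τ.nonneg a).1.lt_or_eq with h | h
  · exact h
  · exact absurd (τ.faithful a (Complex.ext h.symm (τ.nonneg a).2)) ha

theorem FaithfulTrace.ext_inner {a b : A} (h : ∀ c, τ (star c * a) = τ (star c * b)) : a = b := by
  rw [← sub_eq_zero]
  apply τ.faithful
  rw [mul_sub, map_sub, h, sub_self]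

theorem FaithfulTrace.ext_mul {a b : A} (h : ∀ c, τ (c * a) = τ (c * b)) : a = b :=
  τ.ext_inner fun c => h (star c)

/-- Young's inequality for the trace inner product. -/
theorem FaithfulTrace.two_inner_le (a b : A) {k : ℝ} (hk : 0 < k) :
    2 * (τ (star a * b)).re ≤ k * (τ (star a * a)).re + k⁻¹ * (τ (star b * b)).re := by
  have h := (τ.nonneg ((k : ℂ) • a - b)).1
  have e : star ((k : ℂ) • a - b) * ((k : ℂ) • a - b) =
      ((k * k : ℝ) : ℂ) • (star a * a) - ((k : ℝ) : ℂ) • (star a * b) -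
        ((k : ℝ) : ℂ) • (star b * a) + star b * b := by
    simp only [star_sub, star_smul, RCLike.star_def, Complex.conj_ofReal, sub_mul, mul_sub,
      smul_mul_assoc, mul_smul_comm, smul_sub, smul_smul, Complex.ofReal_mul]
    abel
  rw [e] at h
  simp only [map_add, map_sub, map_smul, Complex.add_re, Complex.sub_re, smul_eq_mul,
    Complex.re_ofReal_mul] at h
  rw [τ.re_inner_comm b a] at h
  have : k⁻¹ * (0 : ℝ) ≤ k⁻¹ * (k * k * (τ (star a * a)).re - k * (τ (star a * b)).re -
      k * (τ (star a * b)).re + (τ (star b * b)).re) :=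
    mul_le_mul_of_nonneg_left h (inv_nonneg.mpr hk.le)
  have e2 : k⁻¹ * (k * k * (τ (star a * a)).re - k * (τ (star a * b)).re -
      k * (τ (star a * b)).re + (τ (star b * b)).re) =
      k * (τ (star a * a)).re - 2 * (τ (star a * b)).re + k⁻¹ * (τ (star b * b)).re := by
    field_simp; ring
  linarith

end Trace

/-! ### Spectral calculus in finite dimension -/

section Spectral

variable {A : Type*} [CStarAlgebra A] [FiniteDimensional ℂ A]

/-- The spectrum as a finite set. -/
noncomputable def spec (a : A) : Finset ℝ := (spectrum_finite a).toFinset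

theorem mem_spec {a : A} {x : ℝ} : x ∈ spec a ↔ x ∈ spectrum ℝ a := by
  simp [spec]

theorem continuousOn_spectrum (f : ℝ → ℝ) (a : A) : ContinuousOn f (spectrum ℝ a) :=
  (spectrum_finite a).continuousOn f

theorem star_spectralProj (a : A) (x : ℝ) : star (spectralProj a x) = spectralProj a x :=
  (cfc_predicate (R := ℝ) (p := IsSelfAdjoint) _ a : IsSelfAdjoint (spectralProj a x))

theorem spectralProj_mul (a : A) (x y : ℝ) :
    spectralProj a x * spectralProj a y = if x = y then spectralProj a x else 0 := by
  unfold spectralProj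
  rw [← cfc_mul _ _ a (continuousOn_spectrum _ _) (continuousOn_spectrum _ _)]
  split_ifs with h
  · subst h
    refine cfc_congr fun z _ => ?_
    by_cases hz : z = x <;> simp [Set.indicator, hz]
  · rw [← cfc_zero ℝ a]
    refine cfc_congr fun z _ => ?_
    by_cases hz : z = x
    · subst hz; simp [Set.indicator, h]
    · simp [Set.indicator, hz]

theorem spectralProj_eq_zero {a : A} {x : ℝ} (h : x ∉ spectrum ℝ a) : spectralProj a x = 0 := by
  unfold spectralProj
  rw [← cfc_zero ℝ a]
  refine cfc_congr fun z hz => ?_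
  have : z ≠ x := fun e => h (e ▸ hz)
  simp [Set.indicator, this]

theorem sum_smul_spectralProj (f : ℝ → ℝ) {a : A} :
    ∑ x ∈ spec a, f x • spectralProj a x = cfc f a := by
  unfold spectralProj
  have : ∀ x ∈ spec a, f x • cfc (Set.indicator {x} (fun _ => (1 : ℝ))) a =
      cfc (fun y => f x • Set.indicator {x} (fun _ => (1 : ℝ)) y) a := fun x _ =>
    (cfc_smul (f x) _ a (continuousOn_spectrum _ _)).symm
  rw [Finset.sum_congr rfl this, ← cfc_sum _ a _ fun _ _ => continuousOn_spectrum _ _]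
  refine cfc_congr fun z hz => ?_
  rw [Finset.sum_apply, Finset.sum_eq_single z]
  · simp
  · intro y _ hy
    simp [Set.indicator, hy.symm]
  · intro h
    exact absurd (mem_spec.mpr hz) h

theorem sum_spectralProj {a : A} (ha : IsSelfAdjoint a) : ∑ x ∈ spec a, spectralProj a x = 1 := by
  have := sum_smul_spectralProj (fun _ => 1) (a := a)
  simp only [one_smul] at this
  rw [this, cfc_const_one ℝ a]

theorem cfc_mul_spectralProj (f : ℝ → ℝ) (a : A) (x : ℝ) :
    cfc f a * spectralProj a x = f x • spectralProj a x := by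
  unfold spectralProj
  rw [← cfc_mul _ _ a (continuousOn_spectrum _ _) (continuousOn_spectrum _ _),
    ← cfc_smul _ _ a (continuousOn_spectrum _ _)]
  refine cfc_congr fun z _ => ?_
  by_cases hz : z = x <;> simp [Set.indicator, hz]

theorem spectralProj_mul_cfc (f : ℝ → ℝ) (a : A) (x : ℝ) :
    spectralProj a x * cfc f a = f x • spectralProj a x := by
  rw [← cfc_mul_spectralProj]
  exact (cfc_commute_cfc _ _ a).eq

theorem mul_spectralProj {a : A} (ha : IsSelfAdjoint a) (x : ℝ) :
    a * spectralProj a x = x • spectralProj a x := by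
  simpa [cfc_id' ℝ a] using cfc_mul_spectralProj (fun x => x) a x

theorem spectralProj_mul_self {a : A} (ha : IsSelfAdjoint a) (x : ℝ) :
    spectralProj a x * a = x • spectralProj a x := by
  simpa [cfc_id' ℝ a] using spectralProj_mul_cfc (fun x => x) a x

theorem spectralProj_ne_zero {a : A} (ha : IsSelfAdjoint a) {x : ℝ} (hx : x ∈ spectrum ℝ a) :
    spectralProj a x ≠ 0 := by
  intro h
  have hmem : (1 : ℝ) ∈ spectrum ℝ (cfc (Set.indicator {x} (fun _ => (1 : ℝ))) a) := by
    rw [cfc_map_spectrum _ a ha (continuousOn_spectrum _ _)]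
    exact ⟨x, hx, by simp⟩
  have h' : cfc (Set.indicator {x} (fun _ => (1 : ℝ))) a = 0 := h
  rw [h'] at hmem
  rcases subsingleton_or_nontrivial A with hs | hn
  · rw [spectrum.of_subsingleton] at hmem
    exact hmem
  · rw [spectrum.zero_eq] at hmem
    exact one_ne_zero hmem

theorem doubleSum_eq_sum (θ : ℝ → ℝ → ℝ) (R S C : A) :
    doubleSum θ R S C = ∑ x ∈ spec R, ∑ y ∈ spec S,
      θ x y • (spectralProj R x * C * spectralProj S y) := by
  unfold doubleSum
  rw [finsum_mem_eq_finite_toFinset_sum _ (spectrum_finite R)]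
  exact Finset.sum_congr rfl fun x _ => finsum_mem_eq_finite_toFinset_sum _ (spectrum_finite S)

theorem doubleSum_congr {θ η : ℝ → ℝ → ℝ} {R S : A}
    (h : ∀ x ∈ spectrum ℝ R, ∀ y ∈ spectrum ℝ S, θ x y = η x y) (C : A) :
    doubleSum θ R S C = doubleSum η R S C := by
  rw [doubleSum_eq_sum, doubleSum_eq_sum]
  exact Finset.sum_congr rfl fun x hx => Finset.sum_congr rfl fun y hy => by
    rw [h x (mem_spec.mp hx) y (mem_spec.mp hy)]

theorem doubleSum_add (θ : ℝ → ℝ → ℝ) (R S C C' : A) :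
    doubleSum θ R S (C + C') = doubleSum θ R S C + doubleSum θ R S C' := by
  simp only [doubleSum_eq_sum, mul_add, add_mul, smul_add, Finset.sum_add_distrib]

theorem doubleSum_smul (θ : ℝ → ℝ → ℝ) (R S : A) (c : ℂ) (C : A) :
    doubleSum θ R S (c • C) = c • doubleSum θ R S C := by
  simp only [doubleSum_eq_sum, mul_smul_comm, smul_mul_assoc, Finset.smul_sum]
  exact Finset.sum_congr rfl fun x _ => Finset.sum_congr rfl fun y _ => smul_comm _ _ _

/-- The contraction `C ↦ θ(R, S) # C` as a linear map. -/
noncomputable def doubleSumL (θ : ℝ → ℝ → ℝ) (R S : A) : A →ₗ[ℂ] A where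
  toFun := doubleSum θ R S
  map_add' := doubleSum_add θ R S
  map_smul' c C := doubleSum_smul θ R S c C

theorem proj_doubleSum_proj (θ : ℝ → ℝ → ℝ) (R S C : A) (x y : ℝ) :
    spectralProj R x * doubleSum θ R S C * spectralProj S y =
      θ x y • (spectralProj R x * C * spectralProj S y) := by
  rw [doubleSum_eq_sum]
  simp only [Finset.mul_sum, Finset.sum_mul, mul_smul_comm, smul_mul_assoc]
  have e : ∀ x' y', spectralProj R x * (spectralProj R x' * C * spectralProj S y') *
      spectralProj S y = if x = x' then (if y' = y then
        spectralProj R x * C * spectralProj S y else 0) else 0 := by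
    intro x' y'
    calc _ = (spectralProj R x * spectralProj R x') * C *
          (spectralProj S y' * spectralProj S y) := by noncomm_ring
      _ = _ := by
        rw [spectralProj_mul, spectralProj_mul]
        split_ifs with h1 h2 <;> simp_all
  simp only [e]
  by_cases hx : x ∈ spec R
  · by_cases hy : y ∈ spec S
    · simp [hx, hy]
    · rw [spectralProj_eq_zero (fun h => hy (mem_spec.mpr h))]; simp
  · rw [spectralProj_eq_zero (fun h => hx (mem_spec.mpr h))]; simp

theorem sum_proj_mul_proj {R S : A} (hR : IsSelfAdjoint R) (hS : IsSelfAdjoint S) (C : A) :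
    ∑ x ∈ spec R, ∑ y ∈ spec S, spectralProj R x * C * spectralProj S y = C := by
  simp only [← Finset.mul_sum, sum_spectralProj hS, mul_one]
  rw [← Finset.sum_mul, sum_spectralProj hR, one_mul]

theorem doubleSum_const {R S : A} (hR : IsSelfAdjoint R) (hS : IsSelfAdjoint S) (c : ℝ) (C : A) :
    doubleSum (fun _ _ => c) R S C = c • C := by
  rw [doubleSum_eq_sum]
  simp only [← Finset.smul_sum]
  rw [sum_proj_mul_proj hR hS]

theorem doubleSum_doubleSum (θ η : ℝ → ℝ → ℝ) (R S C : A) :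
    doubleSum θ R S (doubleSum η R S C) = doubleSum (fun x y => θ x y * η x y) R S C := by
  rw [doubleSum_eq_sum θ, doubleSum_eq_sum (fun x y => θ x y * η x y)]
  refine Finset.sum_congr rfl fun x _ => Finset.sum_congr rfl fun y _ => ?_
  rw [proj_doubleSum_proj, smul_smul]

/-- Functions of the form `f(x) + g(y)` act by left and right multiplication. -/
theorem doubleSum_add_eq {R S : A} (hR : IsSelfAdjoint R) (hS : IsSelfAdjoint S)
    (f g : ℝ → ℝ) (C : A) :
    doubleSum (fun x y => f x + g y) R S C = cfc f R * C + C * cfc g S := by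
  rw [doubleSum_eq_sum]
  simp only [add_smul, Finset.sum_add_distrib]
  congr 1
  · rw [← sum_smul_spectralProj f, Finset.sum_mul]
    refine Finset.sum_congr rfl fun x _ => ?_
    rw [← Finset.smul_sum, ← Finset.mul_sum, sum_spectralProj hS, mul_one, smul_mul_assoc]
  · rw [← sum_smul_spectralProj g, Finset.mul_sum, Finset.sum_comm]
    refine Finset.sum_congr rfl fun x _ => ?_
    rw [← Finset.smul_sum, ← Finset.sum_mul, ← Finset.sum_mul, sum_spectralProj hR, one_mul,
      mul_smul_comm]

/-- An element that intertwines `R` with `c S` intertwines their functional calculi. -/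
theorem cfc_mul_eq_mul_cfc {R S V : A} (hR : IsSelfAdjoint R) (hS : IsSelfAdjoint S) {c : ℝ}
    (h : R * V = c • (V * S)) {f g : ℝ → ℝ} (hfg : ∀ y ∈ spectrum ℝ S, f (c * y) = g y) :
    cfc f R * V = V * cfc g S := by
  have h0 : cfc f R * V = cfc f R * V + V * cfc (fun _ => (0 : ℝ)) S := by
    rw [cfc_const_zero ℝ S, mul_zero, add_zero]
  have h1 : V * cfc g S = cfc (fun _ => (0 : ℝ)) R * V + V * cfc g S := by
    rw [cfc_const_zero ℝ R, zero_mul, zero_add]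
  rw [h0, h1, ← doubleSum_add_eq hR hS f, ← doubleSum_add_eq hR hS _ g, doubleSum_eq_sum,
    doubleSum_eq_sum]
  refine Finset.sum_congr rfl fun x _ => Finset.sum_congr rfl fun y hy => ?_
  have hz : (x - c * y) • (spectralProj R x * V * spectralProj S y) = 0 := by
    have e1 : spectralProj R x * (R * V) * spectralProj S y =
        x • (spectralProj R x * V * spectralProj S y) := by
      rw [← mul_assoc, spectralProj_mul_self hR]; simp only [smul_mul_assoc]
    have e2 : spectralProj R x * (R * V) * spectralProj S y =
        (c * y) • (spectralProj R x * V * spectralProj S y) := by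
      rw [h, mul_smul_comm, smul_mul_assoc, mul_assoc, mul_assoc, mul_spectralProj hS, mul_smul]
      simp only [mul_smul_comm, mul_assoc]
    rw [sub_smul, ← e1, ← e2, sub_self]
  rcases smul_eq_zero.mp hz with h2 | h2
  · have : x = c * y := by linarith
    rw [this, hfg y (mem_spec.mp hy), add_zero, zero_add]
  · rw [h2, smul_zero, smul_zero]

/-- Expansion of the quadratic form of a contraction over the spectral blocks. -/
theorem trace_star_mul_doubleSum (τ : FaithfulTrace A) (θ : ℝ → ℝ → ℝ) (R S b c : A) :
    (τ (star b * doubleSum θ R S c)).re = ∑ x ∈ spec R, ∑ y ∈ spec S, θ x y *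
      (τ (star (spectralProj R x * b * spectralProj S y) *
        (spectralProj R x * c * spectralProj S y))).re := by
  rw [doubleSum_eq_sum, Finset.mul_sum, map_sum, Complex.re_sum]
  refine Finset.sum_congr rfl fun x _ => ?_
  rw [Finset.mul_sum, map_sum, Complex.re_sum]
  refine Finset.sum_congr rfl fun y _ => ?_
  have e : τ (star (spectralProj R x * b * spectralProj S y) *
      (spectralProj R x * c * spectralProj S y)) =
      τ (star b * (spectralProj R x * c * spectralProj S y)) := by
    rw [star_mul, star_mul, star_spectralProj, star_spectralProj, mul_assoc, τ.tracial]
    congr 1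
    calc _ = star b * ((spectralProj R x * spectralProj R x) * c *
          (spectralProj S y * spectralProj S y)) := by noncomm_ring
      _ = _ := by rw [spectralProj_mul, spectralProj_mul, if_pos rfl, if_pos rfl]
  rw [e, mul_smul_comm, ← Complex.coe_smul, map_smul, smul_eq_mul, Complex.re_ofReal_mul]

theorem trace_doubleSum_symm (τ : FaithfulTrace A) (θ : ℝ → ℝ → ℝ) (R S b c : A) :
    (τ (star b * doubleSum θ R S c)).re = (τ (star c * doubleSum θ R S b)).re := by
  rw [trace_star_mul_doubleSum, trace_star_mul_doubleSum]
  refine Finset.sum_congr rfl fun x _ => Finset.sum_congr rfl fun y _ => ?_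
  rw [τ.re_inner_comm]

theorem trace_doubleSum_mono (τ : FaithfulTrace A) {θ η : ℝ → ℝ → ℝ} {R S : A}
    (h : ∀ x ∈ spectrum ℝ R, ∀ y ∈ spectrum ℝ S, θ x y ≤ η x y) (c : A) :
    (τ (star c * doubleSum θ R S c)).re ≤ (τ (star c * doubleSum η R S c)).re := by
  rw [trace_star_mul_doubleSum, trace_star_mul_doubleSum]
  exact Finset.sum_le_sum fun x hx => Finset.sum_le_sum fun y hy =>
    mul_le_mul_of_nonneg_right (h x (mem_spec.mp hx) y (mem_spec.mp hy)) (τ.nonneg _).1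

theorem trace_doubleSum_nonneg (τ : FaithfulTrace A) {θ : ℝ → ℝ → ℝ} {R S : A}
    (h : ∀ x ∈ spectrum ℝ R, ∀ y ∈ spectrum ℝ S, 0 ≤ θ x y) (c : A) :
    0 ≤ (τ (star c * doubleSum θ R S c)).re := by
  rw [trace_star_mul_doubleSum]
  exact Finset.sum_nonneg fun x hx => Finset.sum_nonneg fun y hy =>
    mul_nonneg (h x (mem_spec.mp hx) y (mem_spec.mp hy)) (τ.nonneg _).1

/-- Young's inequality for the dual pair of quadratic forms given by `θ` and `1/θ`. -/
theorem two_inner_le_doubleSum (τ : FaithfulTrace A) {θ : ℝ → ℝ → ℝ} {R S : A}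
    (hR : IsSelfAdjoint R) (hS : IsSelfAdjoint S)
    (h : ∀ x ∈ spectrum ℝ R, ∀ y ∈ spectrum ℝ S, 0 < θ x y) (b c : A) {k : ℝ} (hk : 0 < k) :
    2 * (τ (star b * c)).re ≤ k * (τ (star b * doubleSum θ R S b)).re +
      k⁻¹ * (τ (star c * doubleSum (fun x y => (θ x y)⁻¹) R S c)).re := by
  have e : c = doubleSum (fun _ _ => 1) R S c := by rw [doubleSum_const hR hS, one_smul]
  conv_lhs => rw [e]
  rw [trace_star_mul_doubleSum, trace_star_mul_doubleSum, trace_star_mul_doubleSum,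
    Finset.mul_sum, Finset.mul_sum, Finset.mul_sum, ← Finset.sum_add_distrib]
  refine Finset.sum_le_sum fun x hx => ?_
  rw [Finset.mul_sum, Finset.mul_sum, Finset.mul_sum, ← Finset.sum_add_distrib]
  refine Finset.sum_le_sum fun y hy => ?_
  rw [one_mul]
  have hp := mul_pos hk (h x (mem_spec.mp hx) y (mem_spec.mp hy))
  have := τ.two_inner_le (spectralProj R x * b * spectralProj S y)
    (spectralProj R x * c * spectralProj S y) hp
  rw [mul_inv] at this
  linarith

end Spectral

/-! ### Positivity -/

section Positivity

variable {A : Type*} [CStarAlgebra A] [FiniteDimensional ℂ A] (τ : FaithfulTrace A)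

theorem isPosSemidef_star_mul_self (b : A) : IsPosSemidef (star b * b) :=
  ⟨IsSelfAdjoint.star_mul_self b, fun _ hx => spectrum_star_mul_self_nonneg _ hx⟩

theorem IsPosSemidef.exists_sqrt {a : A} (ha : IsPosSemidef a) :
    ∃ b : A, IsSelfAdjoint b ∧ a = b * b := by
  refine ⟨cfc Real.sqrt a, cfc_predicate _ a, ?_⟩
  rw [← cfc_mul _ _ a (continuousOn_spectrum _ _) (continuousOn_spectrum _ _)]
  conv_lhs => rw [← cfc_id' ℝ a ha.1]
  exact cfc_congr fun x hx => (Real.mul_self_sqrt (ha.2 x hx)).symm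

theorem FaithfulTrace.nonneg_mul {a : A} (ha : IsPosSemidef a) (c : A) :
    0 ≤ (τ (star c * c * a)).re := by
  obtain ⟨b, hb, rfl⟩ := ha.exists_sqrt
  have : τ (star c * c * (b * b)) = τ (star (c * b) * (c * b)) := by
    rw [star_mul, hb.star_eq, ← mul_assoc, τ.tracial]
    congr 1
    noncomm_ring
  rw [this]
  exact (τ.nonneg _).1

/-- The positive semidefinite elements form the dual cone of themselves. -/
theorem isPosSemidef_iff {a : A} :
    IsPosSemidef a ↔ IsSelfAdjoint a ∧ ∀ c, 0 ≤ (τ (star c * c * a)).re := by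
  refine ⟨fun h => ⟨h.1, τ.nonneg_mul h⟩, fun h => ⟨h.1, fun x hx => ?_⟩⟩
  have h1 := h.2 (spectralProj a x)
  rw [mul_assoc, spectralProj_mul_self h.1, mul_smul_comm, ← Complex.coe_smul, map_smul,
    smul_eq_mul, Complex.re_ofReal_mul] at h1
  exact (mul_nonneg_iff_of_pos_right (τ.inner_self_pos (spectralProj_ne_zero h.1 hx))).mp h1

theorem IsPosDef.isPosSemidef {a : A} (h : IsPosDef a) : IsPosSemidef a :=
  ⟨h.1, fun x hx => (h.2 x hx).le⟩

theorem isPosSemidef_sub_algebraMap {a : A} (ha : IsSelfAdjoint a) {ε : ℝ}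
    (h : ∀ x ∈ spectrum ℝ a, ε ≤ x) : IsPosSemidef (a - (ε : ℂ) • (1 : A)) := by
  have e : a - (ε : ℂ) • (1 : A) = cfc (fun x => x - ε) a := by
    rw [cfc_sub _ _ a (continuousOn_spectrum _ _) (continuousOn_spectrum _ _), cfc_id' ℝ a,
      cfc_const ε a, Algebra.algebraMap_eq_smul_one, Complex.coe_smul]
  rw [e]
  refine ⟨cfc_predicate _ a, fun x hx => ?_⟩
  rw [cfc_map_spectrum _ a ha (continuousOn_spectrum _ _)] at hx
  obtain ⟨y, hy, rfl⟩ := hx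
  exact sub_nonneg.mpr (h y hy)

theorem IsPosDef.of_trace_ge {a : A} (ha : IsSelfAdjoint a) {ε : ℝ} (hε : 0 < ε)
    (h : ∀ c, ε * (τ (star c * c)).re ≤ (τ (star c * c * a)).re) :
    IsPosDef a ∧ ∀ x ∈ spectrum ℝ a, ε ≤ x := by
  have key : ∀ x ∈ spectrum ℝ a, ε ≤ x := fun x hx => by
    have h1 := h (spectralProj a x)
    rw [mul_assoc, spectralProj_mul_self ha, mul_smul_comm, ← Complex.coe_smul, map_smul,
      smul_eq_mul, Complex.re_ofReal_mul] at h1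
    exact le_of_mul_le_mul_right h1 (τ.inner_self_pos (spectralProj_ne_zero ha hx))
  exact ⟨⟨ha, fun x hx => hε.trans_le (key x hx)⟩, key⟩

theorem IsPosDef.exists_lower {a : A} (ha : IsPosDef a) : ∃ ε > 0, ∀ x ∈ spectrum ℝ a, ε ≤ x := by
  rcases (spec a).eq_empty_or_nonempty with h | h
  · exact ⟨1, one_pos, fun x hx => by rw [← mem_spec, h] at hx; simp at hx⟩
  · exact ⟨(spec a).min' h, ha.2 _ (mem_spec.mp ((spec a).min'_mem h)),
      fun x hx => (spec a).min'_le x (mem_spec.mpr hx)⟩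

theorem FaithfulTrace.ge_of_spectrum_ge {a : A} (ha : IsSelfAdjoint a) {ε : ℝ}
    (h : ∀ x ∈ spectrum ℝ a, ε ≤ x) (c : A) :
    ε * (τ (star c * c)).re ≤ (τ (star c * c * a)).re := by
  have := τ.nonneg_mul (isPosSemidef_sub_algebraMap ha h) c
  rw [mul_sub, mul_smul_comm, mul_one, map_sub, map_smul, smul_eq_mul, Complex.sub_re,
    Complex.re_ofReal_mul] at this
  linarith

theorem FaithfulTrace.abs_le_norm_mul {d : A} (hd : IsSelfAdjoint d) (c : A) :
    |(τ (star c * c * d)).re| ≤ ‖d‖ * (τ (star c * c)).re := by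
  have hb : ∀ {d : A}, IsSelfAdjoint d → -(‖d‖ * (τ (star c * c)).re) ≤ (τ (star c * c * d)).re := by
    intro d hd
    have := τ.ge_of_spectrum_ge hd (ε := -‖d‖) (fun x hx => by
      rcases subsingleton_or_nontrivial A with hs | hn
      · rw [spectrum.of_subsingleton] at hx; exact hx.elim
      · have := spectrum.norm_le_norm_of_mem hx
        rw [Real.norm_eq_abs] at this
        exact (abs_le.mp this).1) c
    linarith
  have h1 := hb hd
  have h2 := hb hd.neg
  rw [norm_neg, mul_neg, map_neg, Complex.neg_re] at h2
  exact abs_le.mpr ⟨h1, by linarith⟩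

/-- Self-adjoint elements close to one bounded below by `ε` are bounded below by `ε / 2`. -/
theorem FaithfulTrace.spectrum_ge_of_norm_sub_le (τ : FaithfulTrace A) {a b : A} {ε : ℝ} (ha : IsSelfAdjoint a)
    (h : ∀ x ∈ spectrum ℝ a, ε ≤ x) (hε : 0 < ε) (hb : IsSelfAdjoint b) (hab : ‖b - a‖ ≤ ε / 2) :
    IsPosDef b ∧ ∀ x ∈ spectrum ℝ b, ε / 2 ≤ x := by
  refine IsPosDef.of_trace_ge τ hb (half_pos hε) fun c => ?_
  have h1 := τ.ge_of_spectrum_ge ha h c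
  have h2 := (abs_le.mp (τ.abs_le_norm_mul (hb.sub ha) c)).1
  have h3 : ‖b - a‖ * (τ (star c * c)).re ≤ ε / 2 * (τ (star c * c)).re :=
    mul_le_mul_of_nonneg_right hab (τ.nonneg c).1
  rw [mul_sub, map_sub, Complex.sub_re] at h2
  linarith

end Positivity

/-! ### One-parameter semigroups in finite dimension -/

section Flow

variable {E : Type*} [NormedAddCommGroup E] [NormedSpace ℂ E] [FiniteDimensional ℂ E]

/-- The one-parameter group `exp(t L)` of a linear map `L`. -/
noncomputable def flow (L : E →ₗ[ℂ] E) (t : ℝ) : E →L[ℂ] E :=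
  NormedSpace.exp ((t : ℂ) • LinearMap.toContinuousLinearMap L)

theorem flow_zero (L : E →ₗ[ℂ] E) : flow L 0 = 1 := by
  simp [flow, NormedSpace.exp_zero]

theorem hasDerivAt_flow (L : E →ₗ[ℂ] E) (t : ℝ) :
    HasDerivAt (flow L) (flow L t * LinearMap.toContinuousLinearMap L) t := by
  have : CompleteSpace E := FiniteDimensional.complete ℂ E
  exact ((hasDerivAt_exp_smul_const (LinearMap.toContinuousLinearMap L) (t : ℂ)).scomp t
    Complex.ofRealCLM.hasDerivAt).congr_deriv (by simp [flow])

theorem hasDerivAt_flow' (L : E →ₗ[ℂ] E) (t : ℝ) :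
    HasDerivAt (flow L) (LinearMap.toContinuousLinearMap L * flow L t) t := by
  have : CompleteSpace E := FiniteDimensional.complete ℂ E
  exact ((hasDerivAt_exp_smul_const' (LinearMap.toContinuousLinearMap L) (t : ℂ)).scomp t
    Complex.ofRealCLM.hasDerivAt).congr_deriv (by simp [flow])

theorem hasDerivAt_clm_apply {F : Type*} [NormedAddCommGroup F] [NormedSpace ℂ F]
    {c : ℝ → E →L[ℂ] F} {c' : E →L[ℂ] F} {y : ℝ → E} {y' : E} {t : ℝ}
    (hc : HasDerivAt c c' t) (hy : HasDerivAt y y' t) :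
    HasDerivAt (fun s => c s (y s)) (c' (y t) + c t y') t := by
  have h1 := hc.hasFDerivAt
  have h2 := hy.hasFDerivAt
  have hb : IsBoundedBilinearMap ℝ (fun p : (E →L[ℂ] F) × E => p.1 p.2) :=
    ⟨fun _ _ _ => rfl, fun _ _ _ => rfl, fun _ _ _ => map_add _ _ _,
      fun c x y => by simp,
      ⟨1, one_pos, fun x y => by simpa using x.le_opNorm y⟩⟩
  have h3 := (hb.hasFDerivAt (c t, y t)).comp t (h1.prodMk h2)
  have h4 := h3.hasDerivAt
  refine h4.congr_deriv ?_
  simp [IsBoundedBilinearMap.deriv, add_comm]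

theorem hasDerivAt_flow_apply (L : E →ₗ[ℂ] E) (a : E) (t : ℝ) :
    HasDerivAt (fun s => flow L s a) (L (flow L t a)) t := by
  have := hasDerivAt_clm_apply (hasDerivAt_flow' L t) (hasDerivAt_const t a)
  simpa using this

theorem flow_neg_apply_flow (L : E →ₗ[ℂ] E) (t : ℝ) (a : E) : flow L (-t) (flow L t a) = a := by
  have : CompleteSpace E := FiniteDimensional.complete ℂ E
  let _ : NormedAlgebra ℚ (E →L[ℂ] E) := NormedAlgebra.restrictScalars ℚ ℂ _
  have : flow L (-t) * flow L t = 1 := by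
    unfold flow
    rw [← NormedSpace.exp_add_of_commute]
    · rw [← add_smul]; simp [NormedSpace.exp_zero]
    · exact (Commute.refl _).smul_left _ |>.smul_right _
  exact congrArg (fun T : E →L[ℂ] E => T a) this

/-- Uniqueness for the linear equation `y' = L y`. -/
theorem eq_flow_of_hasDerivAt (L : E →ₗ[ℂ] E) {y : ℝ → E}
    (hy : ∀ t, HasDerivAt y (L (y t)) t) (t : ℝ) : y t = flow L t (y 0) := by
  have hd : ∀ s, HasDerivAt (fun s => flow L (-s) (y s)) 0 s := fun s => by
    have h1 : HasDerivAt (fun s : ℝ => flow L (-s))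
        (-(flow L (-s) * LinearMap.toContinuousLinearMap L)) s := by
      exact ((hasDerivAt_flow L (-s)).scomp s (hasDerivAt_neg s)).congr_deriv (by simp)
    have := hasDerivAt_clm_apply h1 (hy s)
    simpa using this
  have hc := is_const_of_deriv_eq_zero (fun s => (hd s).differentiableAt)
    (fun s => (hd s).deriv) t 0
  simp only [neg_zero, flow_zero, one_apply_eq_self] at hc
  have h2 := flow_neg_apply_flow L (-t) (y t)
  rw [neg_neg, hc] at h2
  exact h2.symm

theorem flow_add_apply (L : E →ₗ[ℂ] E) (s t : ℝ) (a : E) :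
    flow L (s + t) a = flow L s (flow L t a) := by
  have := eq_flow_of_hasDerivAt L (y := fun s => flow L (s + t) a) (fun r => by
    simpa using (hasDerivAt_flow_apply L a (r + t)).comp_add_const r t) s
  simpa using this

end Flow

namespace DifferentialStructure

variable {A : Type*} [CStarAlgebra A] [FiniteDimensional ℂ A] {J : Type*} [Fintype J] {ι : Type*}
  {B : ι → Type*} [∀ k, CStarAlgebra (B k)] [∀ k, FiniteDimensional ℂ (B k)]
  (D : DifferentialStructure A J B)

/-! ### The correlation forms of a differential structure -/

section Correlation

theorem map_cfc {A B : Type*} [CStarAlgebra A] [FiniteDimensional ℂ A] [CStarAlgebra B]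
    (φ : A →⋆ₐ[ℂ] B) (f : ℝ → ℝ) {a : A} (ha : IsSelfAdjoint a) :
    φ (cfc f a) = cfc f (φ a) := by
  have hφ : IsSelfAdjoint (φ a) := ha.map φ
  exact StarAlgHomClass.map_cfc φ f a (continuousOn_spectrum f a)
    φ.toAlgHom.toLinearMap.continuous_of_finiteDimensional

theorem spectrum_map_subset {A B : Type*} [CStarAlgebra A] [CStarAlgebra B]
    (φ : A →⋆ₐ[ℂ] B) (a : A) : spectrum ℝ (φ a) ⊆ spectrum ℝ a :=
  AlgHom.spectrum_apply_subset (φ.toAlgHom.restrictScalars ℝ) a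

theorem map_spectralProj {A B : Type*} [CStarAlgebra A] [FiniteDimensional ℂ A] [CStarAlgebra B]
    (φ : A →⋆ₐ[ℂ] B) {a : A} (ha : IsSelfAdjoint a) (x : ℝ) :
    φ (spectralProj a x) = spectralProj (φ a) x := map_cfc φ _ ha

theorem isUnit_σ : IsUnit D.σ := by
  rw [← spectrum.zero_notMem_iff ℝ]
  exact fun h => lt_irrefl _ (D.σ_posDef.2 0 h)

theorem l_σ_mul_V (j : J) :
    D.l j D.σ * D.V j = Real.exp (-D.ω j) • (D.V j * D.r j D.σ) := by
  have h := congrArg (· * D.r j D.σ) (D.modular j)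
  have hu : IsUnit (D.r j D.σ) := D.isUnit_σ.map (D.r j)
  simp only [mul_assoc, Ring.inverse_mul_cancel _ hu, mul_one, smul_mul_assoc] at h
  rw [h, Complex.coe_smul]

theorem l_cfc_mul_V (j : J) {f g : ℝ → ℝ}
    (h : ∀ y ∈ spectrum ℝ D.σ, f (Real.exp (-D.ω j) * y) = g y) :
    D.l j (cfc f D.σ) * D.V j = D.V j * D.r j (cfc g D.σ) := by
  rw [map_cfc _ _ D.σ_posDef.1, map_cfc _ _ D.σ_posDef.1]
  exact cfc_mul_eq_mul_cfc (D.σ_posDef.1.map _) (D.σ_posDef.1.map _) (D.l_σ_mul_V j)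
    fun y hy => h y (spectrum_map_subset _ _ hy)

theorem l_σpow_mul_V (j : J) (s : ℝ) :
    D.l j (D.σpow s) * D.V j = ((Real.exp (-D.ω j * s) : ℝ) : ℂ) • (D.V j * D.r j (D.σpow s)) := by
  have h := D.l_cfc_mul_V j (f := fun x => x ^ s) (g := fun y => Real.exp (-D.ω j * s) * y ^ s)
    (fun y hy => by
      rw [Real.mul_rpow (Real.exp_pos _).le (D.σ_posDef.2 y hy).le, Real.exp_mul])
  have e : cfc (fun y : ℝ => Real.exp (-D.ω j * s) * y ^ s) D.σ =
      Real.exp (-D.ω j * s) • D.σpow s := by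
    unfold σpow
    rw [← cfc_smul _ _ _ (continuousOn_spectrum _ _)]
    rfl
  rw [e] at h
  unfold σpow at h ⊢
  rw [h, ← Complex.coe_smul, map_smul, mul_smul_comm]

theorem star_σpow (s : ℝ) : star (D.σpow s) = D.σpow s :=
  (cfc_predicate (R := ℝ) (p := IsSelfAdjoint) _ D.σ : IsSelfAdjoint (D.σpow s))

/-- The correlation form `S_j(p, q) = τ_j[V_j^* l_j(p) V_j r_j(q)]`, through which the Dirichlet
form, the generator and the operators `K_ρ` are expressed. -/
noncomputable def corr (j : J) (p q : A) : ℂ :=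
  D.τB (D.κ j) (star (D.V j) * D.l j p * D.V j * D.r j q)

theorem corr_swap (j : J) (p q : A) : D.corr j p q = D.corr (D.conj j) q p := by
  unfold corr
  rw [D.symm j p q]
  have h1 : D.V (D.conj j) * D.r (D.conj j) p * star (D.V (D.conj j)) * D.l (D.conj j) q =
    (D.V (D.conj j) * D.r (D.conj j) p) * (star (D.V (D.conj j)) * D.l (D.conj j) q) := by
    noncomm_ring
  rw [h1, (D.τB _).tracial]
  congr 1
  noncomm_ring

theorem star_corr (j : J) (p q : A) : star (D.corr j p q) = D.corr j (star p) (star q) := by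
  unfold corr
  rw [← FaithfulTrace.map_star, star_mul, (D.τB _).tracial]
  congr 1
  simp only [star_mul, star_star, map_star, mul_assoc]

theorem corr_mul_σpow_left (j : J) (s : ℝ) (p q : A) :
    D.corr j (p * D.σpow s) q = (Real.exp (-D.ω j * s) : ℝ) * D.corr j p (D.σpow s * q) := by
  unfold corr
  have : star (D.V j) * D.l j (p * D.σpow s) * D.V j * D.r j q =
      ((Real.exp (-D.ω j * s) : ℝ) : ℂ) •
        (star (D.V j) * D.l j p * D.V j * D.r j (D.σpow s * q)) := by
    have := D.l_σpow_mul_V j s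
    calc _ = star (D.V j) * D.l j p * (D.l j (D.σpow s) * D.V j) * D.r j q := by
          rw [map_mul]; noncomm_ring
      _ = _ := by
        rw [this, map_mul]
        simp only [mul_smul_comm, smul_mul_assoc, mul_assoc]
  rw [this, map_smul, smul_eq_mul]

theorem corr_σpow_mul_left (j : J) (s : ℝ) (p q : A) :
    D.corr j (D.σpow s * p) q = (Real.exp (-D.ω j * s) : ℝ) * D.corr j p (q * D.σpow s) := by
  have h := congrArg star (D.corr_mul_σpow_left j s (star p) (star q))
  rw [star_corr, star_mul, star_star, star_star, star_σpow, star_mul' , star_corr, star_mul,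
    star_star, star_star, star_σpow, RCLike.star_def, Complex.conj_ofReal] at h
  exact h

theorem corr_one_one_ne_zero (j : J) : D.corr j 1 1 ≠ 0 := by
  unfold corr
  rw [map_one, map_one, mul_one, mul_one]
  exact fun h => D.V_ne_zero j ((D.τB _).faithful _ h)

theorem ω_conj (j : J) : D.ω (D.conj j) = -D.ω j := by
  have h1 := D.corr_mul_σpow_left j 1 1 (D.σpow (-1))
  have h2 := D.corr_mul_σpow_left (D.conj j) (-1) 1 (D.σpow 1)
  rw [one_mul, (D.σpow_mul_σpow_neg 1).1] at h1
  rw [one_mul, (D.σpow_mul_σpow_neg 1).2, ← corr_swap, h1, ← corr_swap D j 1 1] at h2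
  have h3 := mul_right_cancel₀ (D.corr_one_one_ne_zero j) h2
  have h4 := Real.exp_injective (Complex.ofReal_injective h3)
  linarith

theorem sum_conj {M : Type*} [AddCommMonoid M] (f : J → M) : ∑ j, f (D.conj j) = ∑ j, f j :=
  Equiv.sum_comp (Function.Involutive.toPerm D.conj D.conj_conj) f

theorem star_partialD (j : J) (a : A) :
    star (D.partialD j a) = D.r j (star a) * star (D.V j) - star (D.V j) * D.l j (star a) := by
  simp [partialD, star_sub, star_mul, map_star]

/-- The pairing of two derivatives in terms of the correlation form. -/
theorem trace_partialD_partialD (j : J) (u b p q : A) :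
    D.τB (D.κ j) (star (D.partialD j (star u)) * D.l j p * D.partialD j b * D.r j q) =
      D.corr j p (b * q * u) - D.corr j (p * b) (q * u) - D.corr j (u * p) (b * q) +
        D.corr j (u * p * b) q := by
  have cyc : ∀ X : B (D.κ j), D.τB (D.κ j) (D.r j u * X) = D.τB (D.κ j) (X * D.r j u) :=
    fun X => (D.τB _).tracial _ _
  have e : star (D.partialD j (star u)) * D.l j p * D.partialD j b * D.r j q =
      D.r j u * (star (D.V j) * D.l j p * D.V j * D.r j (b * q)) -
      D.r j u * (star (D.V j) * D.l j (p * b) * D.V j * D.r j q) -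
      star (D.V j) * D.l j (u * p) * D.V j * D.r j (b * q) +
      star (D.V j) * D.l j (u * p * b) * D.V j * D.r j q := by
    rw [star_partialD, star_star]
    simp only [partialD, LinearMap.coe_mk, AddHom.coe_mk, map_mul]
    noncomm_ring
  rw [e, map_add, map_sub, map_sub, cyc, cyc]
  simp only [corr, map_mul, mul_assoc]

/-- The generator in terms of the correlation forms. It exhibits the Lindblad structure
`L b = ∑ e^{-ω_j / 2} (2 r_j†(V_j^* l_j(b) V_j) - m_j b - b m_j)`. -/
theorem trace_mul_generator (c b : A) :
    D.τ (c * D.generator b) = ∑ j, ((Real.exp (-D.ω j / 2) : ℝ) : ℂ) *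
      (2 * D.corr j b c - D.corr j 1 (b * c) - D.corr j 1 (c * b)) := by
  set S := D.σpow (1 / 2) with hS
  set S' := D.σpow (-(1 / 2)) with hS'
  have h1 : S * S' = 1 := (D.σpow_mul_σpow_neg (1 / 2)).1
  have h2 : S' * S = 1 := (D.σpow_mul_σpow_neg (1 / 2)).2
  -- Testing the Dirichlet form against `u = σ^{-1/2} c σ^{-1/2}` turns the KMS pairing into the
  -- trace pairing with `c`.
  set u := S' * c * S' with hu
  have hSuS : S * u * S = c := by
    calc S * u * S = (S * S') * c * (S' * S) := by rw [hu]; noncomm_ring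
      _ = c := by rw [h1, h2, one_mul, mul_one]
  have hk : D.kms (star u) (D.generator b) = D.τ (c * D.generator b) := by
    unfold kms
    rw [star_star, D.τ.tracial]
    have : c * D.generator b = (S * u * S) * D.generator b := by rw [hSuS]
    rw [this]
    congr 1
    noncomm_ring
  have hE := D.dirichletForm_eq (star u) b
  rw [hk] at hE
  have e : ∀ j, D.kmsB j (D.partialD j (star u)) (D.partialD j b) =
      (((Real.exp (-D.ω j / 2) : ℝ) : ℂ) * (D.corr j 1 (b * c) - D.corr j b c)) -
      (((Real.exp (-D.ω (D.conj j) / 2) : ℝ) : ℂ) *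
        (D.corr (D.conj j) b c - D.corr (D.conj j) 1 (c * b))) := by
    intro j
    unfold kmsB
    have hω : ∀ j, -D.ω j * (1 / 2) = -D.ω j / 2 := fun j => by ring
    have t1 : D.corr j S (b * S * u) = ((Real.exp (-D.ω j / 2) : ℝ) : ℂ) * D.corr j 1 (b * c) := by
      have := D.corr_σpow_mul_left j (1 / 2) 1 (b * S * u)
      rw [mul_one, hω] at this
      rw [this]
      congr 2
      rw [← hSuS, ← hS]; noncomm_ring
    have t2 : D.corr j (S * b) (S * u) = ((Real.exp (-D.ω j / 2) : ℝ) : ℂ) * D.corr j b c := by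
      have := D.corr_σpow_mul_left j (1 / 2) b (S * u)
      rw [hω] at this
      rw [this, ← hS, hSuS]
    have t3 : D.corr j (u * S) (b * S) =
        ((Real.exp (-D.ω (D.conj j) / 2) : ℝ) : ℂ) * D.corr (D.conj j) b c := by
      rw [corr_swap]
      have := D.corr_mul_σpow_left (D.conj j) (1 / 2) b (u * S)
      rw [hω] at this
      rw [this, ← hS, ← mul_assoc, hSuS]
    have t4 : D.corr j (u * S * b) S =
        ((Real.exp (-D.ω (D.conj j) / 2) : ℝ) : ℂ) * D.corr (D.conj j) 1 (c * b) := by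
      rw [corr_swap]
      have := D.corr_mul_σpow_left (D.conj j) (1 / 2) 1 (u * S * b)
      rw [hω, one_mul] at this
      rw [this, ← hS]
      congr 2
      rw [← hSuS]; noncomm_ring
    rw [trace_partialD_partialD, ← hS, t1, t2, t3, t4]
    ring
  unfold dirichletForm at hE
  -- The second half of each summand is reindexed by the involution of the index set.
  rw [Finset.sum_congr rfl fun j _ => e j, Finset.sum_sub_distrib,
    D.sum_conj fun j => ((Real.exp (-D.ω j / 2) : ℝ) : ℂ) * (D.corr j b c - D.corr j 1 (c * b)),
    ← Finset.sum_sub_distrib] at hE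
  rw [← neg_eq_iff_eq_neg, ← Finset.sum_neg_distrib] at hE
  rw [← hE]
  exact Finset.sum_congr rfl fun j _ => by ring

theorem star_generator (b : A) : star (D.generator b) = D.generator (star b) := by
  refine D.τ.ext_mul fun c => ?_
  have h1 : D.τ (c * star (D.generator b)) = star (D.τ (star c * D.generator b)) := by
    rw [← D.τ.map_star, star_mul, star_star, D.τ.tracial]
  rw [h1, trace_mul_generator, trace_mul_generator, star_sum]
  refine Finset.sum_congr rfl fun j _ => ?_
  rw [star_mul', RCLike.star_def, Complex.conj_ofReal]
  congr 1
  rw [← RCLike.star_def, star_sub, star_sub, star_mul', star_corr, star_corr, star_corr, star_one,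
    star_mul, star_mul, star_star]
  rw [show star (2 : ℂ) = 2 by simp]
  ring

theorem generator_one : D.generator 1 = 0 := by
  refine D.τ.ext_mul fun c => ?_
  rw [trace_mul_generator, mul_zero, map_zero]
  refine Finset.sum_eq_zero fun j _ => ?_
  rw [one_mul, mul_one]
  ring

/-- The dissipation inequality `L(y y^*) - L(y) y^* - y L(y)^* ≥ 0`, in weak form. -/
theorem dissipation_nonneg (y : A) {R : A} (hR : IsPosSemidef R) :
    0 ≤ (D.τ ((D.generator (y * star y) - D.generator y * star y - y * star (D.generator y)) *
      R)).re := by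
  obtain ⟨b, hb, rfl⟩ := hR.exists_sqrt
  set R := b * b with hR
  have h1 : D.τ ((D.generator (y * star y) - D.generator y * star y - y * star (D.generator y)) *
      R) = D.τ (R * D.generator (y * star y)) - D.τ ((star y * R) * D.generator y) -
        D.τ ((R * y) * D.generator (star y)) := by
    rw [star_generator, sub_mul, sub_mul, map_sub, map_sub, D.τ.tracial _ R]
    congr 1
    · congr 1
      rw [mul_assoc, D.τ.tracial]
    · rw [D.τ.tracial]
      congr 1
      noncomm_ring
  have h2 : D.τ (R * D.generator (y * star y)) - D.τ ((star y * R) * D.generator y) -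
        D.τ ((R * y) * D.generator (star y)) = ∑ j, ((2 * Real.exp (-D.ω j / 2) : ℝ) : ℂ) *
        (D.τB (D.κ j) (star (D.partialD j (star y) * D.r j b) *
          (D.partialD j (star y) * D.r j b))) := by
    rw [trace_mul_generator, trace_mul_generator, trace_mul_generator, ← Finset.sum_sub_distrib,
      ← Finset.sum_sub_distrib]
    refine Finset.sum_congr rfl fun j _ => ?_
    have e1 : D.τB (D.κ j) (star (D.partialD j (star y) * D.r j b) *
          (D.partialD j (star y) * D.r j b)) =
        D.τB (D.κ j) (star (D.partialD j (star y)) * D.l j 1 * D.partialD j (star y) *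
          D.r j R) := by
      rw [star_mul, ← map_star, hb.star_eq, mul_assoc, (D.τB _).tracial, map_one, mul_one, hR,
        map_mul (D.r j)]
      congr 1
      noncomm_ring
    rw [e1, trace_partialD_partialD]
    simp only [one_mul, mul_one]
    push_cast
    have a1 : y * star y * R = y * (star y * R) := by noncomm_ring
    have a2 : star y * (R * y) = star y * R * y := by noncomm_ring
    have a3 : R * y * star y = R * (y * star y) := by noncomm_ring
    rw [a1, a2, a3]
    ring
  rw [h1, h2, Complex.re_sum]
  refine Finset.sum_nonneg fun j _ => ?_
  rw [Complex.re_ofReal_mul]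
  exact mul_nonneg (by positivity) ((D.τB _).nonneg _).1

end Correlation

/-! ### The semigroup and its adjoint -/

section Semigroup

theorem semigroup_apply (t : ℝ) (a : A) : D.semigroup t a = flow D.generator t a := rfl

theorem trace_mul_generatorAdj (a b : A) :
    D.τ (a * D.generatorAdj b) = D.τ (D.generator a * b) := by
  have := traceAdjoint_spec D.τ D.τ D.generator (star a) b
  rwa [star_star, ← star_generator, star_star] at this

theorem star_generatorAdj (b : A) : star (D.generatorAdj b) = D.generatorAdj (star b) := by
  refine D.τ.ext_mul fun c => ?_
  rw [trace_mul_generatorAdj, D.τ.tracial, ← star_star c, ← star_mul, D.τ.map_star,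
    trace_mul_generatorAdj, ← D.τ.map_star, star_mul, star_generator]
  rw [D.τ.tracial]

theorem semigroup_zero (a : A) : D.semigroup 0 a = a := by
  rw [semigroup_apply, flow_zero]; rfl

theorem semigroup_one (t : ℝ) : D.semigroup t 1 = 1 := by
  rw [semigroup_apply]
  refine (eq_flow_of_hasDerivAt D.generator (y := fun _ => 1) (fun t => ?_) t).symm
  rw [generator_one]
  exact hasDerivAt_const _ _

theorem star_semigroup (t : ℝ) (a : A) : star (D.semigroup t a) = D.semigroup t (star a) := by
  rw [semigroup_apply, semigroup_apply]
  have := eq_flow_of_hasDerivAt D.generator (y := fun t => star (flow D.generator t a))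
    (fun t => by
      rw [← star_generator]
      exact (hasDerivAt_flow_apply D.generator a t).star) t
  simpa [flow_zero] using this

theorem trace_mul_semigroupAdj (t : ℝ) (a b : A) :
    D.τ (a * D.semigroupAdj t b) = D.τ (D.semigroup t a * b) := by
  have := traceAdjoint_spec D.τ D.τ (D.semigroup t) (star a) b
  rwa [star_star, star_semigroup, star_star] at this

/-- The trace as a continuous real-linear functional `a ↦ Re τ[a]`. -/
noncomputable def reτ : A →L[ℝ] ℝ :=
  Complex.reCLM.comp ((LinearMap.toContinuousLinearMap D.τ.toLin).restrictScalars ℝ)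

theorem reτ_apply (a : A) : D.reτ a = (D.τ a).re := rfl

theorem continuous_trace : Continuous fun a : A => D.τ a :=
  D.τ.toLin.continuous_of_finiteDimensional

theorem hasDerivAt_trace {y : ℝ → A} {y' : A} {t : ℝ} (h : HasDerivAt y y' t) :
    HasDerivAt (fun s => (D.τ (y s))) (D.τ y') t := by
  have := ((LinearMap.toContinuousLinearMap D.τ.toLin).restrictScalars ℝ).hasFDerivAt
    (x := y t) |>.comp_hasDerivAt t h
  exact this

theorem semigroupAdj_apply (t : ℝ) (b : A) :
    D.semigroupAdj t b = flow D.generatorAdj t b := by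
  refine D.τ.ext_mul fun a => ?_
  rw [trace_mul_semigroupAdj, semigroup_apply]
  have hd : ∀ s, HasDerivAt (fun s => D.τ (flow D.generator (t - s) a *
      flow D.generatorAdj s b)) 0 s := fun s => by
    have h1 : HasDerivAt (fun s : ℝ => flow D.generator (t - s) a)
        (-D.generator (flow D.generator (t - s) a)) s := by
      exact (hasDerivAt_flow_apply D.generator a (t - s)).comp_const_sub t s
    have h2 := D.hasDerivAt_trace (h1.mul (hasDerivAt_flow_apply D.generatorAdj b s))
    refine h2.congr_deriv ?_
    rw [neg_mul, map_add, map_neg, trace_mul_generatorAdj, neg_add_cancel]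
  have := is_const_of_deriv_eq_zero (fun s => (hd s).differentiableAt) (fun s => (hd s).deriv) 0 t
  simpa [flow_zero] using this

theorem semigroupAdj_zero (a : A) : D.semigroupAdj 0 a = a := by
  rw [semigroupAdj_apply, flow_zero]; rfl

theorem semigroupAdj_add (s t : ℝ) (a : A) :
    D.semigroupAdj (s + t) a = D.semigroupAdj s (D.semigroupAdj t a) := by
  simp only [semigroupAdj_apply, flow_add_apply]

theorem star_semigroupAdj (t : ℝ) (b : A) :
    star (D.semigroupAdj t b) = D.semigroupAdj t (star b) := by
  refine D.τ.ext_mul fun c => ?_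
  rw [trace_mul_semigroupAdj, D.τ.tracial, ← star_star c, ← star_mul, D.τ.map_star,
    trace_mul_semigroupAdj, ← D.τ.map_star, star_mul, star_semigroup, D.τ.tracial]

theorem trace_semigroupAdj (t : ℝ) (b : A) : D.τ (D.semigroupAdj t b) = D.τ b := by
  have := D.trace_mul_semigroupAdj t 1 b
  rwa [one_mul, semigroup_one, one_mul] at this

theorem hasDerivAt_semigroup (a : A) (t : ℝ) :
    HasDerivAt (fun s => D.semigroup s a) (D.generator (D.semigroup t a)) t :=
  hasDerivAt_flow_apply D.generator a t

theorem hasDerivAt_semigroupAdj (a : A) (t : ℝ) :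
    HasDerivAt (fun s => D.semigroupAdj s a) (D.generatorAdj (D.semigroupAdj t a)) t := by
  simp only [semigroupAdj_apply]
  exact hasDerivAt_flow_apply D.generatorAdj a t

/-- At a zero of a positive element, in direction of which the spectrum could leave `[0, ∞)`, the
generator points inwards. -/
theorem trace_proj_mul_generator_nonneg {y p : A} (hy : IsPosSemidef y) (hp : star p * p = p)
    (hps : star p = p) (h0 : y * p = 0) : 0 ≤ (D.τ (p * D.generator y)).re := by
  obtain ⟨z, hz, rfl⟩ := hy.exists_sqrt
  have hzp : z * p = 0 := by
    apply D.τ.faithful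
    rw [star_mul, hz.star_eq, mul_assoc, ← mul_assoc z, h0, mul_zero, map_zero]
  have hpz : p * z = 0 := by
    have := congrArg star hzp
    rwa [star_mul, hz.star_eq, hps, star_zero] at this
  have hpp : IsPosSemidef p := hp ▸ isPosSemidef_star_mul_self p
  have h := D.dissipation_nonneg z hpp
  rw [hz.star_eq, sub_mul, sub_mul, mul_assoc _ z p, hzp, mul_zero, sub_zero, map_sub,
    mul_assoc z, D.τ.tracial z, mul_assoc _ p z, hpz, mul_zero, map_zero, sub_zero,
    D.τ.tracial] at h
  exact h

theorem isClosed_isPosSemidef (τ : FaithfulTrace A) : IsClosed {a : A | IsPosSemidef a} := by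
  have : {a : A | IsPosSemidef a} = {a | star a = a} ∩
      ⋂ c : A, {a | 0 ≤ (τ (star c * c * a)).re} := by
    ext a
    simp only [Set.mem_inter_iff, Set.mem_iInter, Set.mem_ofPred_eq]
    exact isPosSemidef_iff τ
  rw [this]
  refine (isClosed_eq continuous_star continuous_id).inter (isClosed_iInter fun c => ?_)
  have hc : Continuous fun a : A => τ (star c * c * a) :=
    τ.toLin.continuous_of_finiteDimensional.comp (continuous_const.mul continuous_id)
  exact isClosed_le continuous_const (Complex.continuous_re.comp hc)

/-- The semigroup preserves positivity: the first exit time from the positive cone of a strictly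
inward perturbation of the trajectory is ruled out by `trace_proj_mul_generator_nonneg`. -/
theorem isPosSemidef_semigroup {a : A} (ha : IsPosSemidef a) {t : ℝ} (ht : 0 ≤ t) :
    IsPosSemidef (D.semigroup t a) := by
  have hsa : ∀ s, IsSelfAdjoint (D.semigroup s a) := fun s => by
    rw [IsSelfAdjoint, star_semigroup, ha.1.star_eq]
  have key : ∀ ε > 0, IsPosSemidef (D.semigroup t a + ((ε * (1 + t) : ℝ) : ℂ) • (1 : A)) := by
    intro ε hε
    -- The perturbed trajectory starts in the interior of the cone, and its drift has the additional
    -- inward part `ε 1` because `L 1 = 0`.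
    set y : ℝ → A := fun s => D.semigroup s a + ((ε * (1 + s) : ℝ) : ℂ) • (1 : A) with hy
    have hyc : ∀ s, HasDerivAt y (D.generator (y s) + (ε : ℂ) • (1 : A)) s := fun s => by
      have h1 : HasDerivAt (fun s : ℝ => ((ε * (1 + s) : ℝ) : ℂ) • (1 : A)) ((ε : ℂ) • (1 : A)) s := by
        have h2 : HasDerivAt (fun s : ℝ => ε * (1 + s)) ε s := by
          simpa using ((hasDerivAt_id s).const_add 1).const_mul ε
        exact (h2.ofReal_comp).smul_const (1 : A)
      have h3 := (D.hasDerivAt_semigroup a s).add h1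
      refine h3.congr_deriv ?_
      rw [hy]
      simp only [map_add, map_smul, generator_one, smul_zero, add_zero]
    have hysa : ∀ s, IsSelfAdjoint (y s) := fun s => by
      refine (hsa s).add ?_
      rw [IsSelfAdjoint, star_smul, star_one, RCLike.star_def, Complex.conj_ofReal]
    have hycont : Continuous y := continuous_iff_continuousAt.mpr fun s => (hyc s).continuousAt
    by_contra hneg
    set T : Set ℝ := {s ∈ Icc 0 t | ¬ IsPosDef (y s)} with hT
    have hTne : T.Nonempty := ⟨t, ⟨ht, le_rfl⟩, fun h => hneg h.isPosSemidef⟩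
    have hTcl : IsClosed T := by
      have : IsOpen {s | IsPosDef (y s)} := by
        rw [isOpen_iff_mem_nhds]
        intro s hs
        obtain ⟨δ, hδ, hlow⟩ := IsPosDef.exists_lower hs
        have := hycont.continuousAt (x := s) |>.eventually
          (Metric.closedBall_mem_nhds (y s) (half_pos hδ))
        filter_upwards [this] with r hr
        exact (D.τ.spectrum_ge_of_norm_sub_le (hysa s) hlow hδ (hysa r)
          (by rwa [← dist_eq_norm])).1
      exact isClosed_Icc.inter this.isClosed_compl
    have hTcpt : IsCompact T := isCompact_Icc.of_isClosed_subset hTcl fun s hs => hs.1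
    -- The first exit time from the open cone.
    obtain ⟨r, hr, hmin⟩ := hTcpt.exists_isLeast hTne
    have hbelow : ∀ s, 0 ≤ s → s < r → IsPosDef (y s) := fun s hs0 hsr => by
      by_contra h
      exact absurd (hmin ⟨⟨hs0, hsr.le.trans hr.1.2⟩, h⟩) (not_le.mpr hsr)
    have h0 : IsPosDef (y 0) := by
      refine (IsPosDef.of_trace_ge D.τ (hysa 0) hε fun c => ?_).1
      have := D.τ.nonneg_mul ha c
      simp only [hy, semigroup_zero, mul_one, mul_add, mul_smul_comm, map_add, map_smul,
        smul_eq_mul, Complex.add_re, Complex.re_ofReal_mul]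
      linarith
    have hr0 : 0 < r := hr.1.1.lt_of_ne (fun h => hr.2 (h ▸ h0))
    have hpsd : IsPosSemidef (y r) := by
      refine (isClosed_isPosSemidef D.τ).mem_of_tendsto
        (hycont.continuousAt.tendsto.mono_left (nhdsWithin_le_nhds (s := Iio r))) ?_
      filter_upwards [Ioo_mem_nhdsLT hr0] with s hs
      exact (hbelow s hs.1.le hs.2).isPosSemidef
    obtain ⟨x, hx, hx0⟩ : ∃ x ∈ spectrum ℝ (y r), x ≤ 0 := by
      by_contra h
      push Not at h
      exact hr.2 ⟨hysa r, h⟩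
    have hxz : x = 0 := le_antisymm hx0 (hpsd.2 x hx)
    subst hxz
    -- With `p` the projection onto the kernel of `y r`, the function `τ[p y s]` is nonnegative
    -- before `r` and vanishes at `r`, although its derivative at `r` is positive.
    set p := spectralProj (y r) 0 with hp
    have hps : star p = p := star_spectralProj _ _
    have hpp : star p * p = p := by rw [hps, hp, spectralProj_mul, if_pos rfl]
    have hyp : y r * p = 0 := by rw [hp, mul_spectralProj (hysa r), zero_smul]
    have hd : HasDerivAt (fun s => (D.τ (p * y s)).re)
        ((D.τ (p * (D.generator (y r) + (ε : ℂ) • (1 : A)))).re) r := by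
      have := D.hasDerivAt_trace ((hyc r).const_mul p)
      exact (Complex.reCLM.hasFDerivAt.comp_hasDerivAt r this)
    have hpos : 0 < (D.τ (p * (D.generator (y r) + (ε : ℂ) • (1 : A)))).re := by
      rw [mul_add, map_add, Complex.add_re, mul_smul_comm, mul_one, map_smul, smul_eq_mul,
        Complex.re_ofReal_mul]
      have h1 := D.trace_proj_mul_generator_nonneg hpsd hpp hps hyp
      have h2 := D.τ.inner_self_pos (spectralProj_ne_zero (hysa r) hx)
      rw [← hp, hpp] at h2
      have := mul_pos hε h2
      linarith
    have hle : ∀ᶠ s in 𝓝[<] r, slope (fun s => (D.τ (p * y s)).re) r s ≤ 0 := by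
      filter_upwards [Ioo_mem_nhdsLT hr0] with s hs
      rw [slope_def_field]
      have h1 : (D.τ (p * y r)).re = 0 := by
        rw [D.τ.tracial, hyp, map_zero, Complex.zero_re]
      have h2 := D.τ.nonneg_mul (hbelow s hs.1.le hs.2).isPosSemidef p
      rw [hpp] at h2
      simp only [h1, sub_zero]
      exact div_nonpos_of_nonneg_of_nonpos h2 (by linarith [hs.2])
    have hlim := (hasDerivAt_iff_tendsto_slope.mp hd).mono_left
      (nhdsWithin_mono r (fun s (hs : s ∈ Iio r) => ne_of_lt hs))
    exact absurd (le_of_tendsto hlim hle) (not_le.mpr hpos)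
  have hlim : Tendsto (fun ε : ℝ => D.semigroup t a + ((ε * (1 + t) : ℝ) : ℂ) • (1 : A))
      (𝓝[>] 0) (𝓝 (D.semigroup t a)) := by
    have : Continuous fun ε : ℝ => D.semigroup t a + ((ε * (1 + t) : ℝ) : ℂ) • (1 : A) := by
      fun_prop
    have h := this.tendsto 0
    simp only [zero_mul, Complex.ofReal_zero, zero_smul, add_zero] at h
    exact h.mono_left nhdsWithin_le_nhds
  exact (isClosed_isPosSemidef D.τ).mem_of_tendsto hlim
    (eventually_nhdsWithin_of_forall fun ε hε => key ε hε)

theorem isPosSemidef_semigroupAdj {a : A} (ha : IsPosSemidef a) {t : ℝ} (ht : 0 ≤ t) :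
    IsPosSemidef (D.semigroupAdj t a) := by
  rw [isPosSemidef_iff D.τ]
  refine ⟨by rw [IsSelfAdjoint, star_semigroupAdj, ha.1.star_eq], fun c => ?_⟩
  rw [trace_mul_semigroupAdj]
  obtain ⟨z, hz, h⟩ := (isPosSemidef_semigroup D (isPosSemidef_star_mul_self c) ht).exists_sqrt
  have := D.τ.nonneg_mul ha z
  rwa [hz.star_eq, ← h] at this

/-- The Schwarz inequality `P_t(x) P_t(x)^* ≤ P_t(x x^*)`, in weak form. -/
theorem semigroup_schwarz (x : A) {R : A} (hR : IsPosSemidef R) {t : ℝ} (ht : 0 ≤ t) :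
    (D.τ (D.semigroup t x * star (D.semigroup t x) * R)).re ≤
      (D.τ (D.semigroup t (x * star x) * R)).re := by
  -- The interpolation `τ[P_s(x) P_s(x)^* P_{t-s}† R]` between the two sides decreases in `s` by the
  -- dissipation inequality.
  set f : ℝ → ℝ := fun s => (D.τ (D.semigroup s x * star (D.semigroup s x) *
    D.semigroupAdj (t - s) R)).re with hf
  have hd : ∀ s, HasDerivAt f (-(D.τ ((D.generator (D.semigroup s x * star (D.semigroup s x)) -
      D.generator (D.semigroup s x) * star (D.semigroup s x) - D.semigroup s x *
      star (D.generator (D.semigroup s x))) * D.semigroupAdj (t - s) R)).re) s := fun s => by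
    have h1 := (D.hasDerivAt_semigroup x s).mul (D.hasDerivAt_semigroup x s).star
    have h2 : HasDerivAt (fun s => D.semigroupAdj (t - s) R)
        (-D.generatorAdj (D.semigroupAdj (t - s) R)) s := by
      exact (D.hasDerivAt_semigroupAdj R (t - s)).comp_const_sub t s
    have h3 := Complex.reCLM.hasFDerivAt.comp_hasDerivAt s (D.hasDerivAt_trace (h1.mul h2))
    refine h3.congr_deriv ?_
    rw [Complex.reCLM_apply, ← Complex.neg_re]
    congr 1
    rw [map_add, mul_neg, map_neg, trace_mul_generatorAdj, ← map_neg, ← map_neg, ← map_add]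
    congr 1
    noncomm_ring
  have hanti : AntitoneOn f (Icc 0 t) := by
    refine antitoneOn_of_deriv_nonpos (convex_Icc 0 t)
      (fun s _ => (hd s).continuousAt.continuousWithinAt)
      (fun s _ => (hd s).differentiableAt.differentiableWithinAt) fun s hs => ?_
    rw [interior_Icc] at hs
    rw [(hd s).deriv]
    exact neg_nonpos.mpr (D.dissipation_nonneg _
      (isPosSemidef_semigroupAdj D hR (sub_nonneg.mpr hs.2.le)))
  have := hanti (left_mem_Icc.mpr ht) (right_mem_Icc.mpr ht) ht
  simp only [hf, sub_self, sub_zero, semigroup_zero, semigroupAdj_zero] at this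
  rwa [trace_mul_semigroupAdj] at this

/-- The generator annihilates `σ` in the dual sense: the modular relation moves `σ` through the
correlation forms, after which the involution of the index set cancels the terms. -/
theorem trace_generatorAdj_σ (a : A) : D.τ (a * D.generatorAdj D.σ) = 0 := by
  have hσ : D.σpow 1 = D.σ := by
    unfold σpow
    simp only [Real.rpow_one]
    exact cfc_id' ℝ D.σ D.σ_posDef.1
  rw [trace_mul_generatorAdj, D.τ.tracial, trace_mul_generator]
  have e : ∀ j, ((Real.exp (-D.ω j / 2) : ℝ) : ℂ) *
      (2 * D.corr j a D.σ - D.corr j 1 (a * D.σ) - D.corr j 1 (D.σ * a)) =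
      2 * (((Real.exp (-D.ω j / 2) : ℝ) : ℂ) * D.corr j a D.σ) -
      (((Real.exp (D.ω j / 2) : ℝ) : ℂ) * D.corr j D.σ a) -
      (((Real.exp (D.ω j / 2) : ℝ) : ℂ) * D.corr j D.σ a) := fun j => by
    have h1 := D.corr_mul_σpow_left j 1 1 a
    have h2 := D.corr_σpow_mul_left j 1 1 a
    rw [hσ, one_mul] at h1
    rw [hσ, mul_one] at h2
    have h3 : ((Real.exp (D.ω j / 2) : ℝ) : ℂ) * ((Real.exp (-D.ω j * 1) : ℝ) : ℂ) =
        ((Real.exp (-D.ω j / 2) : ℝ) : ℂ) := by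
      rw [← Complex.ofReal_mul, ← Real.exp_add]
      congr 2; ring
    have h4 : ((Real.exp (D.ω j / 2) : ℝ) : ℂ) * D.corr j D.σ a =
        ((Real.exp (-D.ω j / 2) : ℝ) : ℂ) * D.corr j 1 (D.σ * a) := by
      rw [h1, ← mul_assoc, h3]
    have h5 : ((Real.exp (D.ω j / 2) : ℝ) : ℂ) * D.corr j D.σ a =
        ((Real.exp (-D.ω j / 2) : ℝ) : ℂ) * D.corr j 1 (a * D.σ) := by
      rw [h2, ← mul_assoc, h3]
    conv_rhs => rw [h4]
    rw [h4] at h5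
    linear_combination h5
  rw [Finset.sum_congr rfl fun j _ => e j, Finset.sum_sub_distrib, Finset.sum_sub_distrib,
    ← Finset.mul_sum, ← D.sum_conj fun j => ((Real.exp (D.ω j / 2) : ℝ) : ℂ) * D.corr j D.σ a]
  have e2 : ∀ j, ((Real.exp (D.ω (D.conj j) / 2) : ℝ) : ℂ) * D.corr (D.conj j) D.σ a =
      ((Real.exp (-D.ω j / 2) : ℝ) : ℂ) * D.corr j a D.σ := fun j => by
    rw [← corr_swap, ω_conj]
  rw [Finset.sum_congr rfl fun j _ => e2 j]
  ring

theorem semigroupAdj_σ (t : ℝ) : D.semigroupAdj t D.σ = D.σ := by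
  rw [semigroupAdj_apply]
  refine (eq_flow_of_hasDerivAt D.generatorAdj (y := fun _ => D.σ) (fun t => ?_) t).symm
  have : D.generatorAdj D.σ = 0 := D.τ.ext_mul fun c => by
    rw [trace_generatorAdj_σ, mul_zero, map_zero]
  rw [this]
  exact hasDerivAt_const _ _

theorem semigroupAdj_mem_density {ρ : A} (hρ : ρ ∈ D.density) {t : ℝ} (ht : 0 ≤ t) :
    D.semigroupAdj t ρ ∈ D.density :=
  ⟨isPosSemidef_semigroupAdj D hρ.1 ht, by rw [trace_semigroupAdj]; exact hρ.2⟩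

/-- The dual semigroup preserves positive definiteness: it fixes `σ`, so a lower bound by a multiple
of `σ` persists. -/
theorem semigroupAdj_mem_densityPos {ρ : A} (hρ : ρ ∈ D.densityPos) {t : ℝ} (ht : 0 ≤ t) :
    D.semigroupAdj t ρ ∈ D.densityPos := by
  refine ⟨?_, by rw [trace_semigroupAdj]; exact hρ.2⟩
  obtain ⟨ε, hε, hlow⟩ := hρ.1.exists_lower
  obtain ⟨ε', hε', hlow'⟩ := D.σ_posDef.exists_lower
  have hN : 0 < ‖D.σ‖ + 1 := by positivity
  set k := ε / (‖D.σ‖ + 1) with hk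
  have hk0 : 0 < k := div_pos hε hN
  have hsub : IsPosSemidef (ρ - (k : ℂ) • D.σ) := by
    have hsa : IsSelfAdjoint ((k : ℂ) • D.σ) := by
      rw [IsSelfAdjoint, star_smul, D.σ_posDef.1.star_eq, RCLike.star_def, Complex.conj_ofReal]
    refine (isPosSemidef_iff D.τ).mpr ⟨hρ.1.1.sub hsa, fun c => ?_⟩
    have h1 := D.τ.ge_of_spectrum_ge hρ.1.1 hlow c
    have h2 := (abs_le.mp (D.τ.abs_le_norm_mul D.σ_posDef.1 c)).2
    rw [mul_sub, mul_smul_comm, map_sub, map_smul, smul_eq_mul, Complex.sub_re,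
      Complex.re_ofReal_mul]
    have hc := (D.τ.nonneg c).1
    have h3 : k * (‖D.σ‖ * (D.τ (star c * c)).re) ≤ ε * (D.τ (star c * c)).re := by
      rw [← mul_assoc]
      refine mul_le_mul_of_nonneg_right ?_ hc
      rw [hk, div_mul_eq_mul_div, div_le_iff₀ hN]
      exact mul_le_mul_of_nonneg_left (by linarith) hε.le
    have := mul_le_mul_of_nonneg_left h2 hk0.le
    linarith
  have h1 := isPosSemidef_semigroupAdj D hsub ht
  rw [map_sub, map_smul, semigroupAdj_σ] at h1
  refine (IsPosDef.of_trace_ge D.τ ?_ (mul_pos hk0 hε') fun c => ?_).1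
  · rw [IsSelfAdjoint, star_semigroupAdj, hρ.1.1.star_eq]
  · have h2 := D.τ.nonneg_mul h1 c
    rw [mul_sub, mul_smul_comm, map_sub, map_smul, smul_eq_mul, Complex.sub_re,
      Complex.re_ofReal_mul] at h2
    have h3 := mul_le_mul_of_nonneg_left (D.τ.ge_of_spectrum_ge D.σ_posDef.1 hlow' c) hk0.le
    linarith

end Semigroup

end DifferentialStructure

/-! ### The logarithmic mean -/

section LogMean

theorem logMean_comm (x y : ℝ) : logMean x y = logMean y x := by
  unfold logMean
  by_cases h : x = y
  · subst h; rfl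
  · rw [if_neg h, if_neg (Ne.symm h)]
    by_cases h0 : x = 0 ∨ y = 0
    · rw [if_pos h0, if_pos h0.symm]
    · rw [if_neg h0, if_neg (fun h => h0 h.symm), ← neg_sub y x, ← neg_sub (Real.log y), neg_div_neg_eq]

theorem mul_log_sub_log {x y : ℝ} (hx : 0 < x) (hy : 0 < y) :
    logMean x y * (Real.log x - Real.log y) = x - y := by
  unfold logMean
  by_cases h : x = y
  · subst h; simp
  · rw [if_neg h, if_neg (by simp [hx.ne', hy.ne'])]
    refine div_mul_cancel₀ _ (sub_ne_zero.mpr fun h' => h ?_)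
    exact Real.log_injOn_pos hx hy h'

theorem min_le_logMean {x y : ℝ} (hx : 0 < x) (hy : 0 < y) : min x y ≤ logMean x y := by
  wlog hxy : x ≤ y generalizing x y
  · rw [min_comm, logMean_comm]; exact this hy hx (le_of_not_ge hxy)
  rw [min_eq_left hxy]
  rcases hxy.eq_or_lt with h | h
  · subst h; simp [logMean]
  · have h1 := mul_log_sub_log hx hy
    have h2 : 0 < Real.log y - Real.log x := sub_pos.mpr (Real.log_lt_log hx h)
    have h3 : Real.log y - Real.log x ≤ y / x - 1 := by
      rw [← Real.log_div hy.ne' hx.ne']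
      exact Real.log_le_sub_one_of_pos (div_pos hy hx)
    have h4 : x * (Real.log y - Real.log x) ≤ y - x := by
      have := mul_le_mul_of_nonneg_left h3 hx.le
      have e : x * (y / x - 1) = y - x := by field_simp
      linarith
    have h5 : logMean x y * (Real.log y - Real.log x) = y - x := by linarith
    rw [← h5] at h4
    exact le_of_mul_le_mul_right h4 h2

theorem logMean_pos {x y : ℝ} (hx : 0 < x) (hy : 0 < y) : 0 < logMean x y :=
  (lt_min hx hy).trans_le (min_le_logMean hx hy)

/-- The density of a smooth probability measure on `[0, 1]`, with distribution function
`Real.smoothTransition`. Its compact support makes averages over `[0, 1]` convolutions on the line,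
so that their smooth dependence on parameters is available. -/
noncomputable def transitionDensity (u : ℝ) : ℝ := deriv Real.smoothTransition u

theorem contDiff_transitionDensity : ContDiff ℝ ((⊤ : ℕ∞) : WithTop ℕ∞) transitionDensity :=
  (contDiff_infty_iff_deriv.mp Real.smoothTransition.contDiff).2

theorem hasDerivAt_smoothTransition (u : ℝ) :
    HasDerivAt Real.smoothTransition (transitionDensity u) u :=
  (Real.smoothTransition.contDiff (n := 1)).differentiable one_ne_zero u |>.hasDerivAt

theorem monotone_smoothTransition : Monotone Real.smoothTransition := by
  intro x y hxy
  unfold Real.smoothTransition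
  have hm := expNegInvGlue.monotone
  have hp := Real.smoothTransition.pos_denom x
  have hp' := Real.smoothTransition.pos_denom y
  rw [div_le_div_iff₀ hp hp']
  have h1 := hm hxy
  have h2 := hm (sub_le_sub_left hxy 1)
  have h3 := mul_le_mul h1 h2 (expNegInvGlue.nonneg _) (expNegInvGlue.nonneg _)
  nlinarith

theorem transitionDensity_nonneg (u : ℝ) : 0 ≤ transitionDensity u :=
  monotone_smoothTransition.deriv_nonneg

theorem support_transitionDensity : Function.support transitionDensity ⊆ Ioc 0 1 := by
  intro u hu
  by_contra h
  refine hu ?_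
  rcases le_or_gt u 0 with h0 | h0
  · -- Left of zero the transition function vanishes, so its derivative from the left is zero.
    have h1 : HasDerivWithinAt Real.smoothTransition 0 (Iic u) u :=
      (hasDerivWithinAt_const u (Iic u) (0 : ℝ)).congr
        (fun v hv => Real.smoothTransition.zero_of_nonpos (le_trans hv h0))
        (Real.smoothTransition.zero_of_nonpos h0)
    exact (uniqueDiffWithinAt_Iic u).eq_deriv _ (hasDerivAt_smoothTransition u).hasDerivWithinAt h1
  · have h1' : 1 < u := by
      by_contra h'
      exact h ⟨h0, not_lt.mp h'⟩
    have h1 : HasDerivWithinAt Real.smoothTransition 0 (Ici u) u :=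
      (hasDerivWithinAt_const u (Ici u) (1 : ℝ)).congr
        (fun v hv => Real.smoothTransition.one_of_one_le (h1'.le.trans hv))
        (Real.smoothTransition.one_of_one_le h1'.le)
    exact (uniqueDiffWithinAt_Ici u).eq_deriv _ (hasDerivAt_smoothTransition u).hasDerivWithinAt h1

/-- The weighted arithmetic mean `χ(u) x + (1 - χ(u)) y` with `χ = Real.smoothTransition`. -/
noncomputable def meanAt (u x y : ℝ) : ℝ :=
  Real.smoothTransition u * x + (1 - Real.smoothTransition u) * y

theorem meanAt_pos (u : ℝ) {x y : ℝ} (hx : 0 < x) (hy : 0 < y) : 0 < meanAt u x y := by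
  have h0 := Real.smoothTransition.nonneg u
  have h1 := Real.smoothTransition.le_one u
  unfold meanAt
  rcases h0.eq_or_lt with h | h
  · rw [← h]; linarith
  · have := mul_pos h hx
    have := mul_nonneg (sub_nonneg.mpr h1) hy.le
    linarith

theorem continuous_inv_meanAt {x y : ℝ} (hx : 0 < x) (hy : 0 < y) :
    Continuous fun u => transitionDensity u * (meanAt u x y)⁻¹ := by
  have h1 : Continuous fun u => meanAt u x y := by
    unfold meanAt
    have := Real.smoothTransition.continuous
    fun_prop
  exact contDiff_transitionDensity.continuous.mul (h1.inv₀ fun u => (meanAt_pos u hx hy).ne')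

/-- The reciprocal of the logarithmic mean is an average of reciprocals of arithmetic means. -/
theorem integral_inv_meanAt {x y : ℝ} (hx : 0 < x) (hy : 0 < y) :
    ∫ u in (0 : ℝ)..1, transitionDensity u * (meanAt u x y)⁻¹ = (logMean x y)⁻¹ := by
  have hint := (continuous_inv_meanAt hx hy).intervalIntegrable (μ := MeasureTheory.volume) 0 1
  have hd : ∀ u, HasDerivAt (fun u => meanAt u x y) (transitionDensity u * (x - y)) u := fun u => by
    have h := hasDerivAt_smoothTransition u
    exact ((h.mul_const x).add ((h.const_sub 1).mul_const y)).congr_deriv (by ring)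
  have m0 : meanAt 0 x y = y := by simp [meanAt]
  have m1 : meanAt 1 x y = x := by simp [meanAt]
  by_cases hxy : x = y
  · subst hxy
    have e : ∀ u, meanAt u x x = x := fun u => by unfold meanAt; ring
    simp only [e]
    rw [intervalIntegral.integral_mul_const,
      intervalIntegral.integral_eq_sub_of_hasDerivAt (fun u _ => hasDerivAt_smoothTransition u)
        (contDiff_transitionDensity.continuous.intervalIntegrable _ _)]
    simp [logMean]
  · have hl : ∀ u, HasDerivAt (fun u => Real.log (meanAt u x y) / (x - y))
        (transitionDensity u * (meanAt u x y)⁻¹) u := fun u => by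
      have h := ((hd u).log (meanAt_pos u hx hy).ne').div_const (x - y)
      refine h.congr_deriv ?_
      have : x - y ≠ 0 := sub_ne_zero.mpr hxy
      have := (meanAt_pos u hx hy).ne'
      field_simp
    rw [intervalIntegral.integral_eq_sub_of_hasDerivAt (fun u _ => hl u) hint, m0, m1,
      ← sub_div]
    unfold logMean
    rw [if_neg hxy, if_neg (by simp [hx.ne', hy.ne']), inv_div]

end LogMean

/-! ### Monotonicity of the action under completely positive maps -/

section Monotonicity

variable {A : Type*} [CStarAlgebra A] [FiniteDimensional ℂ A]

/-- The Schwarz inequality `d d^* ≤ Q†(c c^*)`, `d^* d ≤ Q†(c^* c)` with `d = Q† c`, tested against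
positive elements. -/
def IsSchwarz (τ : FaithfulTrace A) (Q : A →ₗ[ℂ] A) : Prop :=
  ∀ (R : A), IsPosSemidef R → ∀ c : A,
    (τ (traceAdjoint τ τ Q c * star (traceAdjoint τ τ Q c) * R)).re ≤ (τ (c * star c * Q R)).re ∧
    (τ (star (traceAdjoint τ τ Q c) * traceAdjoint τ τ Q c * R)).re ≤ (τ (star c * c * Q R)).re

theorem doubleSum_linear {R S : A} (hR : IsSelfAdjoint R) (hS : IsSelfAdjoint S) (a b : ℝ) (c : A) :
    doubleSum (fun x y => a * x + b * y) R S c = a • (R * c) + b • (c * S) := by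
  have h : ∀ {R : A} (_ : IsSelfAdjoint R) (a : ℝ), cfc (fun x => a * x) R = a • R := fun hR a => by
    rw [cfc_const_mul a _ _ (continuousOn_spectrum _ _), cfc_id' ℝ _ hR]
  rw [doubleSum_add_eq hR hS (fun x => a * x) (fun y => b * y), h hR, h hS, smul_mul_assoc,
    mul_smul_comm]

theorem IsPosDef.mul_pos_of_mem {R : A} (hR : IsPosDef R) {x α : ℝ} (hα : 0 < α)
    (hx : x ∈ spectrum ℝ R) : 0 < α * x := mul_pos hα (hR.2 x hx)

theorem trace_doubleSum_linear (τ : FaithfulTrace A) {R S : A} (hR : IsSelfAdjoint R)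
    (hS : IsSelfAdjoint S) (a b : ℝ) (c : A) :
    (τ (star c * doubleSum (fun x y => a * x + b * y) R S c)).re =
      a * (τ (c * star c * R)).re + b * (τ (star c * c * S)).re := by
  rw [doubleSum_linear hR hS, mul_add, map_add, Complex.add_re, mul_smul_comm, mul_smul_comm,
    ← Complex.coe_smul, ← Complex.coe_smul, map_smul, map_smul, smul_eq_mul, smul_eq_mul,
    Complex.re_ofReal_mul, Complex.re_ofReal_mul, ← mul_assoc, ← mul_assoc, mul_assoc c,
    τ.tracial c]

/-- Monotonicity of `(R, S, b) ↦ τ[b^* (a L_R + a' R_S)^{-1} b]`, by duality. -/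
theorem IsSchwarz.trace_inv_mono {τ : FaithfulTrace A} {Q : A →ₗ[ℂ] A} (hQ : IsSchwarz τ Q)
    {R S : A} (hR : IsPosDef R) (hS : IsPosDef S) (hR' : IsPosDef (Q R)) (hS' : IsPosDef (Q S))
    {a a' : ℝ} (ha : 0 ≤ a) (ha' : 0 ≤ a') (hpos : 0 < a + a') (b : A) :
    (τ (star (Q b) * doubleSum (fun x y => (a * x + a' * y)⁻¹) (Q R) (Q S) (Q b))).re ≤
      (τ (star b * doubleSum (fun x y => (a * x + a' * y)⁻¹) R S b)).re := by
  have hp : ∀ x y : ℝ, 0 < x → 0 < y → 0 < a * x + a' * y := fun x y hx hy => by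
    rcases ha.eq_or_lt with h | h
    · subst h
      have : 0 < a' := by linarith
      simpa using mul_pos this hy
    · exact add_pos_of_pos_of_nonneg (mul_pos h hx) (mul_nonneg ha' hy.le)
  -- The left side is the supremum of `2 τ[c^* Q b] - τ[c^* (a Q(R) c + a' c Q(S))]`; `c` is the
  -- maximiser, and `d = Q† c` is a competitor in the corresponding supremum for `b`.
  set c := doubleSum (fun x y => (a * x + a' * y)⁻¹) (Q R) (Q S) (Q b) with hc
  set d := traceAdjoint τ τ Q c with hd
  have hX : doubleSum (fun x y => a * x + a' * y) (Q R) (Q S) c = Q b := by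
    rw [hc, doubleSum_doubleSum]
    rw [doubleSum_congr (η := fun _ _ => 1), doubleSum_const hR'.1 hS'.1, one_smul]
    intro x hx y hy
    exact mul_inv_cancel₀ (hp x y (hR'.2 x hx) (hS'.2 y hy)).ne'
  have h1 := trace_doubleSum_linear τ hR'.1 hS'.1 a a' c
  rw [hX, τ.re_inner_comm] at h1
  have h2 : (τ (star b * d)).re = (τ (star (Q b) * c)).re := by rw [hd, traceAdjoint_spec]
  have h3 := two_inner_le_doubleSum τ (θ := fun x y => a * x + a' * y) hR.1 hS.1
    (fun x hx y hy => hp x y (hR.2 x hx) (hS.2 y hy)) d b one_pos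
  rw [trace_doubleSum_linear τ hR.1 hS.1, τ.re_inner_comm d b, h2, one_mul, inv_one, one_mul] at h3
  have h4 := mul_le_mul_of_nonneg_left (hQ R hR.isPosSemidef c).1 ha
  have h5 := mul_le_mul_of_nonneg_left (hQ S hS.isPosSemidef c).2 ha'
  rw [← hd] at h4 h5
  linarith

/-- The reciprocal of the logarithmic mean is an average of reciprocals of weighted arithmetic
means. -/
theorem trace_doubleSum_integral (τ : FaithfulTrace A) {R S : A} (hR : IsPosDef R)
    (hS : IsPosDef S) {α β : ℝ} (hα : 0 < α) (hβ : 0 < β) (b : A) :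
    (τ (star b * doubleSum (fun x y => (logMean (α * x) (β * y))⁻¹) R S b)).re =
      ∫ u in (0 : ℝ)..1, transitionDensity u *
        (τ (star b * doubleSum (fun x y => (meanAt u (α * x) (β * y))⁻¹) R S b)).re := by
  simp only [trace_star_mul_doubleSum, Finset.mul_sum]
  have hc : ∀ x ∈ spec R, ∀ y ∈ spec S, Continuous fun u => transitionDensity u *
      ((meanAt u (α * x) (β * y))⁻¹ * (τ (star (spectralProj R x * b * spectralProj S y) *
        (spectralProj R x * b * spectralProj S y))).re) := fun x hx y hy => by
    simp only [← mul_assoc]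
    exact (continuous_inv_meanAt (hR.mul_pos_of_mem hα (mem_spec.mp hx))
      (hS.mul_pos_of_mem hβ (mem_spec.mp hy))).mul continuous_const
  rw [intervalIntegral.integral_finsetSum fun x hx =>
    (continuous_finsetSum _ fun y hy => hc x hx y hy).intervalIntegrable _ _]
  refine Finset.sum_congr rfl fun x hx => ?_
  rw [intervalIntegral.integral_finsetSum fun y hy => (hc x hx y hy).intervalIntegrable _ _]
  refine Finset.sum_congr rfl fun y hy => ?_
  simp only [← mul_assoc]
  rw [intervalIntegral.integral_mul_const, integral_inv_meanAt
    (hR.mul_pos_of_mem hα (mem_spec.mp hx)) (hS.mul_pos_of_mem hβ (mem_spec.mp hy))]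

theorem continuous_trace_doubleSum_inv (τ : FaithfulTrace A) {R S : A} (hR : IsPosDef R)
    (hS : IsPosDef S) {α β : ℝ} (hα : 0 < α) (hβ : 0 < β) (b : A) :
    Continuous fun u => transitionDensity u *
      (τ (star b * doubleSum (fun x y => (meanAt u (α * x) (β * y))⁻¹) R S b)).re := by
  simp only [trace_star_mul_doubleSum, Finset.mul_sum]
  refine continuous_finsetSum _ fun x hx => continuous_finsetSum _ fun y hy => ?_
  simp only [← mul_assoc]
  exact (continuous_inv_meanAt (hR.mul_pos_of_mem hα (mem_spec.mp hx))
    (hS.mul_pos_of_mem hβ (mem_spec.mp hy))).mul continuous_const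

/-- Monotonicity of the action density of the tilted logarithmic mean under Schwarz maps. -/
theorem IsSchwarz.trace_logMean_mono {τ : FaithfulTrace A} {Q : A →ₗ[ℂ] A} (hQ : IsSchwarz τ Q)
    {R S : A} (hR : IsPosDef R) (hS : IsPosDef S) (hR' : IsPosDef (Q R)) (hS' : IsPosDef (Q S))
    {α β : ℝ} (hα : 0 < α) (hβ : 0 < β) (b : A) :
    (τ (star (Q b) * doubleSum (fun x y => (logMean (α * x) (β * y))⁻¹) (Q R) (Q S) (Q b))).re ≤
      (τ (star b * doubleSum (fun x y => (logMean (α * x) (β * y))⁻¹) R S b)).re := by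
  rw [trace_doubleSum_integral τ hR hS hα hβ, trace_doubleSum_integral τ hR' hS' hα hβ]
  refine intervalIntegral.integral_mono_on zero_le_one
    ((continuous_trace_doubleSum_inv τ hR' hS' hα hβ _).intervalIntegrable _ _)
    ((continuous_trace_doubleSum_inv τ hR hS hα hβ _).intervalIntegrable _ _) fun u _ => ?_
  refine mul_le_mul_of_nonneg_left ?_ (transitionDensity_nonneg u)
  have h0 := Real.smoothTransition.nonneg u
  have h1 := Real.smoothTransition.le_one u
  simp only [meanAt, ← mul_assoc]
  refine hQ.trace_inv_mono hR hS hR' hS' (mul_nonneg h0 hα.le)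
    (mul_nonneg (sub_nonneg.mpr h1) hβ.le) ?_ b
  rcases h0.eq_or_lt with h | h
  · rw [← h]; simpa using hβ
  · exact add_pos_of_pos_of_nonneg (mul_pos h hα) (mul_nonneg (sub_nonneg.mpr h1) hβ.le)

/-- Positivity of the amplification to `2 × 2` matrices. -/
theorem IsCompletelyPositive.trace_nonneg {τ : FaithfulTrace A} {Q : A →ₗ[ℂ] A}
    (hQ : IsCompletelyPositive Q) (z₀ z₁ w₀ w₁ : A) :
    star (Q (star z₀ * z₁)) = Q (star z₁ * z₀) ∧
    0 ≤ (τ (star w₀ * Q (star z₀ * z₀) * w₀)).re + (τ (star w₀ * Q (star z₀ * z₁) * w₁)).re +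
      (τ (star w₁ * Q (star z₁ * z₀) * w₀)).re + (τ (star w₁ * Q (star z₁ * z₁) * w₁)).re := by
  obtain ⟨N, hN⟩ := hQ 2 !![z₀, z₁; 0, 0]
  have h00 := congrFun (congrFun hN 0) 0
  have h01 := congrFun (congrFun hN 0) 1
  have h10 := congrFun (congrFun hN 1) 0
  have h11 := congrFun (congrFun hN 1) 1
  simp [Matrix.mul_apply, Fin.sum_univ_two] at h00 h01 h10 h11
  refine ⟨?_, ?_⟩
  · rw [h01, h10]
    simp [star_add, star_mul]
  · have key : ∀ k : Fin 2, 0 ≤ (τ (star (N k 0 * w₀ + N k 1 * w₁) *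
        (N k 0 * w₀ + N k 1 * w₁))).re := fun k => (τ.nonneg _).1
    have e : τ (star w₀ * Q (star z₀ * z₀) * w₀) + τ (star w₀ * Q (star z₀ * z₁) * w₁) +
        τ (star w₁ * Q (star z₁ * z₀) * w₀) + τ (star w₁ * Q (star z₁ * z₁) * w₁) =
        τ (star (N 0 0 * w₀ + N 0 1 * w₁) * (N 0 0 * w₀ + N 0 1 * w₁)) +
        τ (star (N 1 0 * w₀ + N 1 1 * w₁) * (N 1 0 * w₀ + N 1 1 * w₁)) := by
      rw [h00, h01, h10, h11]
      simp only [← map_add, star_add, star_mul]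
      congr 1
      noncomm_ring
    have h := congrArg Complex.re e
    simp only [Complex.add_re] at h
    rw [h]
    exact add_nonneg (key 0) (key 1)

/-- The adjoint of a completely positive trace preserving map is unital and `2`-positive. With
`R = y²` and `d = Q† c`, the first inequality is the positivity of the `2 × 2` amplification of `Q` on
the row `(y, -y d)`, tested at `(c, 1)`; the second is the same for `c^*` and `d^*`. -/
theorem IsCompletelyPositive.isSchwarz {τ : FaithfulTrace A} {Q : A →ₗ[ℂ] A}
    (hQ : IsCompletelyPositive Q) (htr : ∀ b, τ (Q b) = τ b) : IsSchwarz τ Q := by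
  intro R hR c
  obtain ⟨y, hy, rfl⟩ := hR.exists_sqrt
  set d := traceAdjoint τ τ Q c with hd
  have hspec : ∀ x, τ (star (Q x) * c) = τ (star x * d) := fun x =>
    (traceAdjoint_spec τ τ Q x c).symm
  constructor
  · obtain ⟨h1, h2⟩ := hQ.trace_nonneg (τ := τ) y (-(y * d)) c 1
    have e0 : (τ (star c * Q (star y * y) * c)).re = (τ (c * star c * Q (y * y))).re := by
      rw [hy.star_eq, τ.tracial, ← mul_assoc]
    have e1 : τ (Q (star (-(y * d)) * y) * c) = -τ (d * star d * (y * y)) := by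
      have : star (star y * -(y * d)) * d = -((star d * (y * y)) * d) := by
        rw [star_mul, star_star, star_neg, star_mul, hy.star_eq]; noncomm_ring
      rw [← h1, hspec, this, map_neg, τ.tracial, ← mul_assoc]
    have e2 : (τ (star c * Q (star y * -(y * d)))).re = (τ (Q (star (-(y * d)) * y) * c)).re := by
      rw [← τ.re_star (star c * _), star_mul, star_star, h1]
    have e3 : τ (star (-(y * d)) * -(y * d)) = τ (d * star d * (y * y)) := by
      have : star (-(y * d)) * -(y * d) = (star d * (y * y)) * d := by
        rw [star_neg, star_mul, hy.star_eq]; noncomm_ring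
      rw [this, τ.tracial, ← mul_assoc]
    rw [star_one, one_mul, one_mul, mul_one, mul_one, htr, e0, e2, e1, e3, Complex.neg_re] at h2
    linarith
  · obtain ⟨h1, h2⟩ := hQ.trace_nonneg (τ := τ) y (-(y * star d)) (star c) 1
    have e0 : (τ (star (star c) * Q (star y * y) * star c)).re =
        (τ (star c * c * Q (y * y))).re := by
      rw [hy.star_eq, τ.tracial, ← mul_assoc, star_star]
    have e1 : τ (star (star c) * Q (star y * -(y * star d))) = -τ (star d * d * (y * y)) := by
      have : star (star (-(y * star d)) * y) * d = -((y * y) * (star d * d)) := by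
        rw [star_mul, star_star, hy.star_eq]; noncomm_ring
      rw [star_star, τ.tracial, ← star_star (Q (star y * -(y * star d))), h1, hspec, this, map_neg,
        τ.tracial]
    have e2 : (τ (Q (star (-(y * star d)) * y) * star c)).re =
        (τ (star (star c) * Q (star y * -(y * star d)))).re := by
      rw [← τ.re_star (star (star c) * _), star_mul, star_star, h1]
    have e3 : τ (star (-(y * star d)) * -(y * star d)) = τ (star d * d * (y * y)) := by
      have : star (-(y * star d)) * -(y * star d) = d * ((y * y) * star d) := by
        rw [star_neg, star_mul, hy.star_eq, star_star]; noncomm_ring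
      rw [this, τ.tracial, mul_assoc, τ.tracial]
    rw [star_one, one_mul, one_mul, mul_one, mul_one, htr, e0, e2, e1, e3, Complex.neg_re] at h2
    linarith

end Monotonicity

namespace DifferentialStructure

variable {A : Type*} [CStarAlgebra A] [FiniteDimensional ℂ A] {J : Type*} [Fintype J] {ι : Type*}
  {B : ι → Type*} [∀ k, CStarAlgebra (B k)] [∀ k, FiniteDimensional ℂ (B k)]
  (D : DifferentialStructure A J B)

/-! ### The operators `K_ρ` -/

section KOperator

theorem trace_one_ne_zero : D.τ 1 ≠ 0 := by
  intro h
  have h1 : (1 : A) = 0 := D.τ.faithful 1 (by rwa [star_one, one_mul])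
  have h2 := D.trace_σ
  rw [← mul_one D.σ, h1, mul_zero, map_zero] at h2
  exact zero_ne_one h2

theorem trace_one_re_pos : 0 < (D.τ 1).re := by
  have := D.τ.inner_self_pos (a := 1) (fun h => D.trace_one_ne_zero (by rw [h, map_zero]))
  rwa [star_one, one_mul] at this

theorem trace_one_im : (D.τ 1).im = 0 := by
  have := (D.τ.nonneg 1).2
  rwa [star_one, one_mul] at this

theorem isPosDef_l {ρ : A} (hρ : IsPosDef ρ) (j : J) : IsPosDef (D.l j ρ) :=
  ⟨hρ.1.map _, fun x hx => hρ.2 x (spectrum_map_subset _ _ hx)⟩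

theorem isPosDef_r {ρ : A} (hρ : IsPosDef ρ) (j : J) : IsPosDef (D.r j ρ) :=
  ⟨hρ.1.map _, fun x hx => hρ.2 x (spectrum_map_subset _ _ hx)⟩

theorem θ_pos (j : J) {x y : ℝ} (hx : 0 < x) (hy : 0 < y) : 0 < D.θ j x y :=
  logMean_pos (mul_pos (Real.exp_pos _) hx) (mul_pos (Real.exp_pos _) hy)

theorem θ_pos_of_mem {ρ : A} (hρ : IsPosDef ρ) (j : J) :
    ∀ x ∈ spectrum ℝ (D.l j ρ), ∀ y ∈ spectrum ℝ (D.r j ρ), 0 < D.θ j x y := fun x hx y hy =>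
  D.θ_pos j ((D.isPosDef_l hρ j).2 x hx) ((D.isPosDef_r hρ j).2 y hy)

theorem θ_conj (j : J) (x y : ℝ) : D.θ (D.conj j) x y = D.θ j y x := by
  unfold θ
  rw [ω_conj, logMean_comm]
  congr 3
  ring

theorem trace_Kop (c ρ a : A) :
    D.τ (star c * D.Kop ρ a) = ∑ j, D.τB (D.κ j) (star (D.partialD j c) *
      doubleSum (D.θ j) (D.l j ρ) (D.r j ρ) (D.partialD j a)) := by
  unfold Kop
  rw [Finset.mul_sum, map_sum]
  refine Finset.sum_congr rfl fun j _ => ?_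
  rw [partialAdj, traceAdjoint_spec]

theorem Kop_add (ρ a b : A) : D.Kop ρ (a + b) = D.Kop ρ a + D.Kop ρ b := by
  simp only [Kop, map_add, doubleSum_add, Finset.sum_add_distrib]

theorem Kop_smul (ρ : A) (c : ℂ) (a : A) : D.Kop ρ (c • a) = c • D.Kop ρ a := by
  simp only [Kop, map_smul, doubleSum_smul, Finset.smul_sum]

theorem Kop_neg (ρ a : A) : D.Kop ρ (-a) = -D.Kop ρ a := by
  rw [← neg_one_smul ℂ a, Kop_smul, neg_one_smul]

theorem Kop_sub (ρ a b : A) : D.Kop ρ (a - b) = D.Kop ρ a - D.Kop ρ b := by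
  rw [sub_eq_add_neg, Kop_add, Kop_neg, ← sub_eq_add_neg]

theorem energy_eq_trace (ρ a : A) : D.energy ρ a = (D.τ (star a * D.Kop ρ a)).re := by
  unfold energy
  rw [D.τ.re_inner_comm]

theorem energy_eq (ρ a : A) : D.energy ρ a = ∑ j, (D.τB (D.κ j) (star (D.partialD j a) *
      doubleSum (D.θ j) (D.l j ρ) (D.r j ρ) (D.partialD j a))).re := by
  rw [energy_eq_trace, trace_Kop, Complex.re_sum]

theorem energy_nonneg {ρ : A} (hρ : IsPosDef ρ) (a : A) : 0 ≤ D.energy ρ a := by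
  rw [energy_eq]
  exact Finset.sum_nonneg fun j _ => trace_doubleSum_nonneg _
    (fun x hx y hy => (D.θ_pos_of_mem hρ j x hx y hy).le) _

/-- The operators `K_ρ` are symmetric for the trace inner product. -/
theorem trace_Kop_comm (ρ a b : A) :
    (D.τ (star a * D.Kop ρ b)).re = (D.τ (star b * D.Kop ρ a)).re := by
  rw [trace_Kop, trace_Kop, Complex.re_sum, Complex.re_sum]
  exact Finset.sum_congr rfl fun j _ => trace_doubleSum_symm _ _ _ _ _ _

theorem energy_smul (ρ : A) (c : ℝ) (a : A) : D.energy ρ ((c : ℂ) • a) = c ^ 2 * D.energy ρ a := by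
  rw [energy_eq_trace, energy_eq_trace, Kop_smul, star_smul, RCLike.star_def, Complex.conj_ofReal,
    smul_mul_assoc, mul_smul_comm, map_smul, map_smul, smul_eq_mul, smul_eq_mul,
    Complex.re_ofReal_mul, Complex.re_ofReal_mul]
  ring

/-- Young's inequality for the quadratic form of `K_ρ`. -/
theorem two_trace_Kop_le {ρ : A} (hρ : IsPosDef ρ) (a b : A) {k : ℝ} (hk : 0 < k) :
    2 * (D.τ (star a * D.Kop ρ b)).re ≤ k * D.energy ρ a + k⁻¹ * D.energy ρ b := by
  have h := D.energy_nonneg hρ ((k : ℂ) • a - b)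
  have e : D.energy ρ ((k : ℂ) • a - b) =
      k ^ 2 * D.energy ρ a - 2 * k * (D.τ (star a * D.Kop ρ b)).re + D.energy ρ b := by
    have h1 := D.energy_smul ρ k a
    rw [energy_eq_trace] at h1 ⊢
    rw [Kop_sub, star_sub, sub_mul, mul_sub, mul_sub, map_sub, map_sub, map_sub, Complex.sub_re,
      Complex.sub_re, Complex.sub_re, h1, ← energy_eq_trace, D.trace_Kop_comm ρ b, star_smul,
      RCLike.star_def, Complex.conj_ofReal, smul_mul_assoc, map_smul, smul_eq_mul,
      Complex.re_ofReal_mul]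
    ring
  rw [e] at h
  have h2 := mul_le_mul_of_nonneg_left h (inv_nonneg.mpr hk.le)
  have e2 : k⁻¹ * (k ^ 2 * D.energy ρ a - 2 * k * (D.τ (star a * D.Kop ρ b)).re + D.energy ρ b) =
      k * D.energy ρ a - 2 * (D.τ (star a * D.Kop ρ b)).re + k⁻¹ * D.energy ρ b := by
    field_simp
  linarith

theorem partialD_one (j : J) : D.partialD j 1 = 0 := by simp [partialD]

theorem trace_Kop_eq_zero (ρ a : A) : D.τ (D.Kop ρ a) = 0 := by
  have := D.trace_Kop 1 ρ a
  simpa [partialD_one] using this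

/-- Both sums may run over the spectrum of `ρ`, which contains the spectra of its images: the
additional projections vanish. -/
theorem doubleSum_map_eq_sum {ρ : A} (hρ : IsSelfAdjoint ρ) (θ : ℝ → ℝ → ℝ) (j : J)
    (C : B (D.κ j)) : doubleSum θ (D.l j ρ) (D.r j ρ) C = ∑ x ∈ spec ρ, ∑ y ∈ spec ρ,
      θ x y • (D.l j (spectralProj ρ x) * C * D.r j (spectralProj ρ y)) := by
  have hl : spec (D.l j ρ) ⊆ spec ρ := fun x hx =>
    mem_spec.mpr (spectrum_map_subset _ _ (mem_spec.mp hx))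
  have hr : spec (D.r j ρ) ⊆ spec ρ := fun x hx =>
    mem_spec.mpr (spectrum_map_subset _ _ (mem_spec.mp hx))
  rw [doubleSum_eq_sum]
  simp only [map_spectralProj _ hρ]
  have h1 : ∀ x, ∑ y ∈ spec (D.r j ρ), θ x y • (spectralProj (D.l j ρ) x * C *
      spectralProj (D.r j ρ) y) = ∑ y ∈ spec ρ, θ x y • (spectralProj (D.l j ρ) x * C *
      spectralProj (D.r j ρ) y) := fun x =>
    Finset.sum_subset hr fun y _ hy => by
      rw [spectralProj_eq_zero (fun h => hy (mem_spec.mpr h)), mul_zero, smul_zero]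
  simp only [h1]
  refine Finset.sum_subset hl fun x _ hx => Finset.sum_eq_zero fun y _ => ?_
  rw [spectralProj_eq_zero (fun h => hx (mem_spec.mpr h)), zero_mul, zero_mul, smul_zero]

/-- The block `(x, y)` of the sesquilinear form of `K_ρ` in terms of the correlation form. -/
noncomputable def corrBlock (j : J) (p q u a : A) : ℂ :=
  D.corr j p (a * q * u) - D.corr j (p * a) (q * u) - D.corr j (u * p) (a * q) +
    D.corr j (u * p * a) q

theorem trace_mul_Kop {ρ : A} (hρ : IsSelfAdjoint ρ) (u a : A) :
    D.τ (u * D.Kop ρ a) = ∑ j, ∑ x ∈ spec ρ, ∑ y ∈ spec ρ,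
      (D.θ j x y : ℂ) * D.corrBlock j (spectralProj ρ x) (spectralProj ρ y) u a := by
  have := D.trace_Kop (star u) ρ a
  rw [star_star] at this
  rw [this]
  refine Finset.sum_congr rfl fun j _ => ?_
  rw [D.doubleSum_map_eq_sum hρ, Finset.mul_sum, map_sum]
  refine Finset.sum_congr rfl fun x _ => ?_
  rw [Finset.mul_sum, map_sum]
  refine Finset.sum_congr rfl fun y _ => ?_
  rw [mul_smul_comm, ← Complex.coe_smul, map_smul, smul_eq_mul, corrBlock,
    ← trace_partialD_partialD]
  congr 2
  noncomm_ring

theorem star_corrBlock (j : J) {p q : A} (hp : star p = p) (hq : star q = q) (u a : A) :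
    star (D.corrBlock j p q (star u) a) = D.corrBlock (D.conj j) q p u (star a) := by
  simp only [corrBlock, star_add, star_sub, star_corr, star_mul, star_star, hp, hq,
    D.corr_swap j, mul_assoc]
  ring

/-- The operators `K_ρ` commute with the involution: the blocks for `j` and `j*` are exchanged. -/
theorem star_Kop {ρ : A} (hρ : IsSelfAdjoint ρ) (a : A) :
    star (D.Kop ρ a) = D.Kop ρ (star a) := by
  refine D.τ.ext_mul fun u => ?_
  have h1 : D.τ (u * star (D.Kop ρ a)) = star (D.τ (star u * D.Kop ρ a)) := by
    rw [← D.τ.map_star, star_mul, star_star, D.τ.tracial]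
  rw [h1, D.trace_mul_Kop hρ, D.trace_mul_Kop hρ, star_sum,
    ← D.sum_conj fun j => ∑ x ∈ spec ρ, ∑ y ∈ spec ρ,
      (D.θ j x y : ℂ) * D.corrBlock j (spectralProj ρ x) (spectralProj ρ y) u (star a)]
  refine Finset.sum_congr rfl fun j _ => ?_
  rw [star_sum]
  simp only [star_sum]
  conv_rhs => rw [Finset.sum_comm]
  refine Finset.sum_congr rfl fun x _ => Finset.sum_congr rfl fun y _ => ?_
  rw [star_mul', RCLike.star_def, Complex.conj_ofReal, θ_conj, ← RCLike.star_def,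
    D.star_corrBlock j (star_spectralProj _ _) (star_spectralProj _ _)]

/-- The logarithmic form of the modular relation between `σ` and `V_j`. -/
theorem partialD_cfc_log_σ (j : J) :
    D.partialD j (cfc Real.log D.σ) = D.ω j • D.V j := by
  have h := D.l_cfc_mul_V j (f := Real.log) (g := fun y => -D.ω j + Real.log y) (fun y hy => by
    rw [Real.log_mul (Real.exp_pos _).ne' (D.σ_posDef.2 y hy).ne', Real.log_exp])
  have e : cfc (fun y : ℝ => -D.ω j + Real.log y) D.σ =
      (-D.ω j) • (1 : A) + cfc Real.log D.σ := by
    rw [cfc_const_add _ _ _ (continuousOn_spectrum _ _) D.σ_posDef.1,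
      Algebra.algebraMap_eq_smul_one]
  rw [e, ← Complex.coe_smul, map_add, map_smul, map_one, mul_add, mul_smul_comm, mul_one,
    Complex.coe_smul] at h
  change D.V j * D.r j _ - D.l j _ * D.V j = _
  rw [h, neg_smul]
  abel

/-- The chain rule: the tilted logarithmic mean transforms the gradient of `log ρ - log σ` into
an expression that is linear in `ρ`. -/
theorem doubleSum_partialD_log {ρ : A} (hρ : IsPosDef ρ) (j : J) :
    doubleSum (D.θ j) (D.l j ρ) (D.r j ρ) (D.partialD j (cfc Real.log ρ - cfc Real.log D.σ)) =
      (-Real.exp (D.ω j / 2)) • (D.l j ρ * D.V j) +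
        Real.exp (-D.ω j / 2) • (D.V j * D.r j ρ) := by
  have hl := D.isPosDef_l hρ j
  have hr := D.isPosDef_r hρ j
  have e : D.partialD j (cfc Real.log ρ - cfc Real.log D.σ) =
      doubleSum (fun x y => -Real.log x + (Real.log y + -D.ω j)) (D.l j ρ) (D.r j ρ) (D.V j) := by
    rw [doubleSum_add_eq hl.1 hr.1 (fun x => -Real.log x) (fun y => Real.log y + -D.ω j), map_sub,
      partialD_cfc_log_σ]
    change D.V j * D.r j _ - D.l j _ * D.V j - _ = _
    rw [map_cfc _ _ hρ.1, map_cfc _ _ hρ.1, cfc_neg, cfc_add_const _ _ _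
      (continuousOn_spectrum _ _) hr.1, Algebra.algebraMap_eq_smul_one, mul_add, mul_smul_comm,
      mul_one, neg_smul]
    noncomm_ring
  rw [e, doubleSum_doubleSum, ← doubleSum_linear hl.1 hr.1]
  refine doubleSum_congr (fun x hx y hy => ?_) _
  have hx0 := hl.2 x hx
  have hy0 := hr.2 y hy
  have h := mul_log_sub_log (mul_pos (Real.exp_pos (D.ω j / 2)) hx0)
    (mul_pos (Real.exp_pos (-D.ω j / 2)) hy0)
  rw [Real.log_mul (Real.exp_pos _).ne' hx0.ne', Real.log_mul (Real.exp_pos _).ne' hy0.ne',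
    Real.log_exp, Real.log_exp] at h
  unfold θ
  linear_combination -h

/-- The gradient flow structure: `L† ρ = -K_ρ (log ρ - log σ)`. -/
theorem Kop_log {ρ : A} (hρ : IsPosDef ρ) :
    D.Kop ρ (cfc Real.log ρ - cfc Real.log D.σ) = -D.generatorAdj ρ := by
  refine D.τ.ext_mul fun u => ?_
  have h1 := D.trace_Kop (star u) ρ (cfc Real.log ρ - cfc Real.log D.σ)
  rw [star_star] at h1
  have e : ∀ j, D.τB (D.κ j) (star (D.partialD j (star u)) *
      doubleSum (D.θ j) (D.l j ρ) (D.r j ρ) (D.partialD j (cfc Real.log ρ - cfc Real.log D.σ))) =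
      ((Real.exp (-D.ω j / 2) : ℝ) : ℂ) * (D.corr j 1 (ρ * u) - D.corr j u ρ) -
      ((Real.exp (-D.ω (D.conj j) / 2) : ℝ) : ℂ) *
        (D.corr (D.conj j) u ρ - D.corr (D.conj j) 1 (u * ρ)) := fun j => by
    rw [doubleSum_partialD_log D hρ, ← Complex.coe_smul, ← Complex.coe_smul, mul_add,
      mul_smul_comm, mul_smul_comm, map_add, map_smul, map_smul, smul_eq_mul, smul_eq_mul,
      ← corr_swap, ← corr_swap, ω_conj, neg_neg, star_partialD, star_star, sub_mul, sub_mul,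
      map_sub, map_sub]
    have c1 : D.τB (D.κ j) (D.r j u * star (D.V j) * (D.l j ρ * D.V j)) = D.corr j ρ u := by
      rw [mul_assoc, (D.τB _).tracial]; simp only [corr, mul_assoc]
    have c2 : D.τB (D.κ j) (star (D.V j) * D.l j u * (D.l j ρ * D.V j)) =
        D.corr j (u * ρ) 1 := by
      simp only [corr, mul_assoc, map_mul, map_one, mul_one]
    have c3 : D.τB (D.κ j) (D.r j u * star (D.V j) * (D.V j * D.r j ρ)) =
        D.corr j 1 (ρ * u) := by
      rw [mul_assoc, (D.τB _).tracial]; simp only [corr, mul_assoc, map_mul, map_one, one_mul]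
    have c4 : D.τB (D.κ j) (star (D.V j) * D.l j u * (D.V j * D.r j ρ)) = D.corr j u ρ := by
      simp only [corr, mul_assoc]
    rw [c1, c2, c3, c4]
    push_cast
    ring
  rw [h1, Finset.sum_congr rfl fun j _ => e j, Finset.sum_sub_distrib,
    D.sum_conj fun j => ((Real.exp (-D.ω j / 2) : ℝ) : ℂ) * (D.corr j u ρ - D.corr j 1 (u * ρ)),
    ← Finset.sum_sub_distrib, mul_neg, map_neg, trace_mul_generatorAdj, D.τ.tracial,
    trace_mul_generator, ← Finset.sum_neg_distrib]
  exact Finset.sum_congr rfl fun j _ => by ring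

end KOperator

/-! ### Intertwining and the gradient estimate -/

section GradientEstimate

/-- The maps `Q t j` satisfy the Schwarz inequality and extend `P_t†` along `l_j` and `r_j`. -/
def Acts (Q : ℝ → ∀ j, B (D.κ j) →ₗ[ℂ] B (D.κ j)) : Prop :=
  ∀ t : ℝ, 0 ≤ t → ∀ j, IsSchwarz (D.τB (D.κ j)) (Q t j) ∧
    (∀ a, Q t j (D.l j a) = D.l j (D.semigroupAdj t a)) ∧
    (∀ a, Q t j (D.r j a) = D.r j (D.semigroupAdj t a))

theorem IsExtension.acts {Q : ℝ → ∀ j, B (D.κ j) →ₗ[ℂ] B (D.κ j)} (hQ : D.IsExtension Q) :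
    D.Acts Q := fun t ht j =>
  ⟨(hQ t ht j).1.isSchwarz (hQ t ht j).2.1, (hQ t ht j).2.2.1, (hQ t ht j).2.2.2⟩

/-- A trace preserving `*`-endomorphism that commutes with `P_t` also commutes with `P_t†`, because
its adjoint is its inverse. -/
theorem semigroupAdj_comm (m : A →⋆ₐ[ℂ] A) (hm : ∀ a, D.τ (m a) = D.τ a) {t : ℝ}
    (hc : ∀ a, D.semigroup t (m a) = m (D.semigroup t a)) (a : A) :
    D.semigroupAdj t (m a) = m (D.semigroupAdj t a) := by
  have hinj : Function.Injective m := by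
    refine (injective_iff_map_eq_zero m).mpr fun x hx => D.τ.faithful x ?_
    rw [← hm, map_mul, hx, mul_zero, map_zero]
  have hsurj : Function.Surjective m :=
    LinearMap.injective_iff_surjective (f := m.toAlgHom.toLinearMap).mp hinj
  refine D.τ.ext_mul fun c => ?_
  obtain ⟨c, rfl⟩ := hsurj c
  rw [trace_mul_semigroupAdj, hc, ← map_mul, ← map_mul, hm, hm, trace_mul_semigroupAdj]

/-- The adjoint of the transported `P_t†` is the transported `P_t`, whose Schwarz inequality is
`semigroup_schwarz`. -/
theorem isSchwarz_transported {φ : ∀ j, A ≃⋆ₐ[ℂ] B (D.κ j)}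
    (hφ : ∀ j a, D.τB (D.κ j) (φ j a) = D.τ a) {t : ℝ} (ht : 0 ≤ t) (j : J) :
    IsSchwarz (D.τB (D.κ j)) (D.transported φ t j) := by
  have hφ' : ∀ b, D.τ ((φ j).symm b) = D.τB (D.κ j) b := fun b => by
    rw [← hφ, StarAlgEquiv.apply_symm_apply]
  have hT : ∀ b, D.transported φ t j b = φ j (D.semigroupAdj t ((φ j).symm b)) := fun b => rfl
  have hadj : ∀ c, traceAdjoint (D.τB (D.κ j)) (D.τB (D.κ j)) (D.transported φ t j) c =
      φ j (D.semigroup t ((φ j).symm c)) := fun c => by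
    refine (D.τB _).ext_inner fun b => ?_
    rw [traceAdjoint_spec, hT, ← hφ', ← hφ', map_mul (φ j).symm, map_mul (φ j).symm,
      map_star (φ j).symm, map_star (φ j).symm,
      StarAlgEquiv.symm_apply_apply, StarAlgEquiv.symm_apply_apply, star_semigroupAdj,
      D.τ.tracial, trace_mul_semigroupAdj, D.τ.tracial]
  intro R hR c
  have hR' : IsPosSemidef ((φ j).symm R) := by
    obtain ⟨y, hy, rfl⟩ := hR.exists_sqrt
    have := isPosSemidef_star_mul_self ((φ j).symm y)
    rwa [← map_star, ← map_mul, hy.star_eq] at this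
  have key : ∀ x, (D.τ (D.semigroup t x * star (D.semigroup t x) * (φ j).symm R)).re ≤
      (D.τ (x * star x * D.semigroupAdj t ((φ j).symm R))).re := fun x => by
    rw [trace_mul_semigroupAdj]
    exact D.semigroup_schwarz x hR' ht
  constructor
  · have := key ((φ j).symm c)
    rw [hadj, hT, ← hφ', ← hφ']
    simpa only [map_mul, map_star, StarAlgEquiv.symm_apply_apply] using this
  · have := key (star ((φ j).symm c))
    rw [hadj, hT, ← hφ', ← hφ']
    simpa only [map_mul, map_star, StarAlgEquiv.symm_apply_apply, star_semigroup, star_star]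
      using this

theorem IsIdentification.acts {φ : ∀ j, A ≃⋆ₐ[ℂ] B (D.κ j)} (hφ : D.IsIdentification φ) :
    D.Acts (D.transported φ) := by
  intro t ht j
  have hφ' : ∀ b, D.τ ((φ j).symm b) = D.τB (D.κ j) b := fun b => by
    rw [← (hφ j).1, StarAlgEquiv.apply_symm_apply]
  refine ⟨D.isSchwarz_transported (fun j => (hφ j).1) ht j, fun a => ?_, fun a => ?_⟩
  · have := D.semigroupAdj_comm (((φ j).symm : B (D.κ j) →⋆ₐ[ℂ] A).comp (D.l j))
      (fun a => (hφ' _).trans (D.trace_l j a)) (fun a => ((hφ j).2 t ht a).1) a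
    have h2 := congrArg (φ j) this
    change φ j (D.semigroupAdj t ((φ j).symm (D.l j a))) = _
    refine h2.trans ?_
    exact StarAlgEquiv.apply_symm_apply _ _
  · have := D.semigroupAdj_comm (((φ j).symm : B (D.κ j) →⋆ₐ[ℂ] A).comp (D.r j))
      (fun a => (hφ' _).trans (D.trace_r j a)) (fun a => ((hφ j).2 t ht a).2) a
    have h2 := congrArg (φ j) this
    change φ j (D.semigroupAdj t ((φ j).symm (D.r j a))) = _
    refine h2.trans ?_
    exact StarAlgEquiv.apply_symm_apply _ _

/-- The action decreases along the dual semigroup. -/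
theorem Acts.action_le {Q : ℝ → ∀ j, B (D.κ j) →ₗ[ℂ] B (D.κ j)} (hQ : D.Acts Q) {ρ : A}
    (hρ : ρ ∈ D.densityPos) {t : ℝ} (ht : 0 ≤ t) (b : ∀ j, B (D.κ j)) :
    D.action (D.semigroupAdj t ρ) (fun j => Q t j (b j)) ≤ D.action ρ b := by
  refine Finset.sum_le_sum fun j _ => ?_
  obtain ⟨h1, h2, h3⟩ := hQ t ht j
  have hP := (D.semigroupAdj_mem_densityPos hρ ht).1
  have := h1.trace_logMean_mono (D.isPosDef_l hρ.1 j) (D.isPosDef_r hρ.1 j)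
    (by rw [h2]; exact D.isPosDef_l hP j) (by rw [h3]; exact D.isPosDef_r hP j)
    (Real.exp_pos (D.ω j / 2)) (Real.exp_pos (-D.ω j / 2)) (b j)
  rw [h2, h3] at this
  exact this

theorem trace_prod_re (b c : ∀ j, B (D.κ j)) :
    (D.τProd (star b * c)).re = ∑ j, (D.τB (D.κ j) (star (b j) * c j)).re := by
  simp [τProd, FaithfulTrace.pi]

/-- The gradient estimate `‖∇ P_t a‖²_ρ ≤ e^{-2 lam t} ‖∇ a‖²_{P_t† ρ}` with constant `lam`. -/
def GradientEstimate (lam : ℝ) : Prop :=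
  ∀ ρ ∈ D.densityPos, ∀ t : ℝ, 0 ≤ t → ∀ a : A,
    D.energy ρ (D.semigroup t a) ≤ Real.exp (-2 * lam * t) * D.energy (D.semigroupAdj t ρ) a

/-- An intertwining family gives the gradient estimate, by duality between `θ` and `1/θ`. -/
theorem IsIntertwining.gradientEstimate {Q : ℝ → ∀ j, B (D.κ j) →ₗ[ℂ] B (D.κ j)}
    (hQ : D.Acts Q) {lam : ℝ} {Pv : ℝ → (∀ j, B (D.κ j)) →ₗ[ℂ] (∀ j, B (D.κ j))}
    (hP : D.IsIntertwining lam Q Pv) : D.GradientEstimate lam := by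
  intro ρ hρ t ht a
  set ρ' := D.semigroupAdj t ρ with hρ'
  have hρ'm := D.semigroupAdj_mem_densityPos hρ ht
  -- The momentum `θ # ∇ P_t a`, whose action is the energy of `P_t a`. Moving the intertwiner to
  -- the other side of the pairing of `b` with `∇ P_t a` leaves `∇ a` paired with a vector of
  -- controlled action.
  set b : ∀ j, B (D.κ j) := fun j => doubleSum (D.θ j) (D.l j ρ) (D.r j ρ)
    (D.partialD j (D.semigroup t a)) with hb
  set N := D.energy ρ (D.semigroup t a) with hN
  have hact : D.action ρ b = N := by
    rw [hN, energy_eq]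
    refine Finset.sum_congr rfl fun j _ => ?_
    rw [hb, doubleSum_doubleSum, doubleSum_congr (η := fun _ _ => 1),
      doubleSum_const (D.isPosDef_l hρ.1 j).1 (D.isPosDef_r hρ.1 j).1, one_smul,
      (D.τB _).re_inner_comm]
    exact fun x hx y hy => inv_mul_cancel₀ (D.θ_pos_of_mem hρ.1 j x hx y hy).ne'
  have hpair : N = (D.τProd (star (D.grad a) * traceAdjoint D.τProd D.τProd (Pv t) b)).re := by
    rw [traceAdjoint_spec, ← hP.1 a t ht, trace_prod_re, hN, energy_eq]
    rfl
  have h1 : D.action ρ' (traceAdjoint D.τProd D.τProd (Pv t) b) ≤ Real.exp (-2 * lam * t) * N := by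
    refine (hP.2 ρ' hρ'm b t ht).trans ?_
    rw [← hact]
    exact mul_le_mul_of_nonneg_left (Acts.action_le D hQ hρ ht b) (Real.exp_pos _).le
  set c := traceAdjoint D.τProd D.τProd (Pv t) b with hc
  set k := Real.exp (-2 * lam * t) with hk
  have hk0 : 0 < k := Real.exp_pos _
  -- Young's inequality with weight `e^{-2 lam t}`, chosen to absorb half of the left side.
  have h2 : 2 * N ≤ k * D.energy ρ' a + k⁻¹ * D.action ρ' c := by
    rw [hpair, trace_prod_re, energy_eq, action, Finset.mul_sum, Finset.mul_sum, Finset.mul_sum,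
      ← Finset.sum_add_distrib]
    refine Finset.sum_le_sum fun j _ => ?_
    exact two_inner_le_doubleSum _ (D.isPosDef_l hρ'm.1 j).1 (D.isPosDef_r hρ'm.1 j).1
      (D.θ_pos_of_mem hρ'm.1 j) _ _ hk0
  have h3 := mul_le_mul_of_nonneg_left h1 (inv_nonneg.mpr hk0.le)
  rw [← mul_assoc, inv_mul_cancel₀ hk0.ne', one_mul] at h3
  linarith

end GradientEstimate

/-! ### Ergodicity and the tangent space -/

section Ergodic

variable {D}

theorem IsErgodic.eq_smul_one (hD : D.IsErgodic) {a : A} (h : ∀ j, D.partialD j a = 0) :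
    ∃ c : ℂ, a = c • 1 := by
  have hk : a ∈ LinearMap.ker D.generator := by
    rw [LinearMap.mem_ker]
    simp [generator, h]
  rw [hD] at hk
  obtain ⟨c, hc⟩ := Submodule.mem_span_singleton.mp hk
  exact ⟨c, hc.symm⟩

theorem eq_zero_of_smul_one {a : A} (h : ∃ c : ℂ, a = c • 1) (h0 : D.τ a = 0) : a = 0 := by
  obtain ⟨c, rfl⟩ := h
  rw [map_smul, smul_eq_mul] at h0
  rcases mul_eq_zero.mp h0 with h | h
  · rw [h, zero_smul]
  · exact absurd h D.trace_one_ne_zero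

variable (D) in
/-- The rank-one operator `a ↦ τ[a] 1`. -/
noncomputable def traceOne : A →ₗ[ℂ] A := D.τ.toLin.smulRight (1 : A)

theorem traceOne_apply (a : A) : D.traceOne a = D.τ a • (1 : A) := rfl

/-- In the ergodic case the tangent space consists of the self-adjoint elements of trace zero. -/
theorem IsErgodic.mem_tangent_iff (hD : D.IsErgodic) {v : A} :
    v ∈ D.tangent ↔ IsSelfAdjoint v ∧ D.τ v = 0 := by
  constructor
  · rintro ⟨h1, x, rfl⟩
    refine ⟨h1, ?_⟩
    have := D.trace_mul_generatorAdj 1 x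
    rwa [one_mul, generator_one, zero_mul, map_zero] at this
  · rintro ⟨h1, h2⟩
    refine ⟨h1, ?_⟩
    -- `L + τ[·] 1` is injective, hence bijective, and so is its adjoint `L† + τ[·] 1`; on elements
    -- of trace zero the latter inverts `L†`.
    have hMinj : Function.Injective (D.generator + D.traceOne) := by
      refine (injective_iff_map_eq_zero _).mpr fun x hx => ?_
      rw [LinearMap.add_apply, traceOne_apply] at hx
      have ht : D.τ x = 0 := by
        have h3 := congrArg (fun y => D.τ (y * D.σ)) hx
        simp only [add_mul, zero_mul, map_add, map_zero, smul_mul_assoc, one_mul, map_smul,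
          smul_eq_mul, D.trace_σ, mul_one] at h3
        rwa [← trace_mul_generatorAdj, trace_generatorAdj_σ, zero_add] at h3
      rw [ht, zero_smul, add_zero] at hx
      have hk : x ∈ LinearMap.ker D.generator := hx
      rw [hD] at hk
      obtain ⟨c, hc⟩ := Submodule.mem_span_singleton.mp hk
      exact eq_zero_of_smul_one ⟨c, hc.symm⟩ ht
    have hMsurj := LinearMap.injective_iff_surjective.mp hMinj
    have hadj : ∀ a b, D.τ (a * (D.generatorAdj + D.traceOne) b) =
        D.τ ((D.generator + D.traceOne) a * b) := fun a b => by
      simp only [LinearMap.add_apply, traceOne_apply, mul_add, add_mul, map_add, mul_smul_comm,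
        smul_mul_assoc, mul_one, one_mul, map_smul, smul_eq_mul, trace_mul_generatorAdj]
      ring
    have hinj : Function.Injective (D.generatorAdj + D.traceOne) := by
      refine (injective_iff_map_eq_zero _).mpr fun x hx => D.τ.ext_mul fun c => ?_
      obtain ⟨c, rfl⟩ := hMsurj c
      rw [← hadj, hx, mul_zero, mul_zero]
    obtain ⟨x, hx⟩ := LinearMap.injective_iff_surjective.mp hinj v
    have ht : D.τ x = 0 := by
      have h3 := hadj 1 x
      rw [hx, one_mul, h2, LinearMap.add_apply, generator_one, zero_add, traceOne_apply,
        smul_mul_assoc, one_mul, map_smul, smul_eq_mul] at h3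
      exact (mul_eq_zero.mp h3.symm).resolve_left D.trace_one_ne_zero
    rw [LinearMap.add_apply, traceOne_apply, ht, zero_smul, add_zero] at hx
    exact ⟨x, hx⟩

theorem IsErgodic.Kop_injective (hD : D.IsErgodic) {ρ : A} (hρ : IsPosDef ρ) {a : A}
    (h : D.Kop ρ a = 0) (ht : D.τ a = 0) : a = 0 := by
  refine eq_zero_of_smul_one (hD.eq_smul_one fun j => ?_) ht
  have he : D.energy ρ a = 0 := by rw [energy_eq_trace, h, mul_zero, map_zero, Complex.zero_re]
  rw [energy_eq, Finset.sum_eq_zero_iff_of_nonneg fun j _ => trace_doubleSum_nonneg _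
    (fun x hx y hy => (D.θ_pos_of_mem hρ j x hx y hy).le) _] at he
  have h1 := he j (Finset.mem_univ j)
  by_contra hne
  have h2 := fun (k : ℝ) (hk : 0 < k) => two_inner_le_doubleSum (D.τB (D.κ j))
    (D.isPosDef_l hρ j).1 (D.isPosDef_r hρ j).1 (D.θ_pos_of_mem hρ j) (D.partialD j a)
    (D.partialD j a) hk
  have h3 := (D.τB (D.κ j)).inner_self_pos hne
  set X := (D.τB (D.κ j) (star (D.partialD j a) *
    doubleSum (fun x y => (D.θ j x y)⁻¹) (D.l j ρ) (D.r j ρ) (D.partialD j a))).re with hX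
  set Y := (D.τB (D.κ j) (star (D.partialD j a) * D.partialD j a)).re with hY
  have hX0 : 0 ≤ X := trace_doubleSum_nonneg _
    (fun x hx y hy => (inv_pos.mpr (D.θ_pos_of_mem hρ j x hx y hy)).le) _
  -- Since the first term of Young's inequality vanishes, every weight above `X / Y` contradicts it.
  have h4 := h2 ((X + 1) / Y) (div_pos (by linarith) h3)
  rw [h1, mul_zero, zero_add, inv_div, div_mul_eq_mul_div, le_div_iff₀ (by linarith)] at h4
  nlinarith

end Ergodic
end DifferentialStructure

/-! ### Smooth dependence of `K_ρ` and its inverse on `ρ` -/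

section Smooth

/-- Averages of inverses of convex combinations depend smoothly on parameters. -/
theorem contDiffAt_integral_inverse {P 𝔸 : Type*} [NormedAddCommGroup P] [NormedSpace ℝ P]
    [NormedRing 𝔸] [NormedAlgebra ℝ 𝔸] [CompleteSpace 𝔸] {X Y : P → 𝔸}
    (hX : ContDiff ℝ ((⊤ : ℕ∞) : WithTop ℕ∞) X) (hY : ContDiff ℝ ((⊤ : ℕ∞) : WithTop ℕ∞) Y) {p₀ : P}
    (h : ∀ c ∈ Icc (0 : ℝ) 1, IsUnit (c • X p₀ + (1 - c) • Y p₀)) :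
    ContDiffAt ℝ ((⊤ : ℕ∞) : WithTop ℕ∞) (fun p => ∫ u in (0 : ℝ)..1, transitionDensity u •
      Ring.inverse (Real.smoothTransition u • X p + (1 - Real.smoothTransition u) • Y p)) p₀ := by
  set s : Set P := {p | ∀ c ∈ Icc (0 : ℝ) 1, IsUnit (c • X p + (1 - c) • Y p)} with hs
  have hso : IsOpen s := by
    rw [isOpen_iff_mem_nhds]
    intro p hp
    refine isCompact_Icc.eventually_forall_of_forall_eventually
      (P := fun p c => IsUnit (c • X p + (1 - c) • Y p)) fun c hc => ?_
    have hcont : Continuous fun z : P × ℝ => z.2 • X z.1 + (1 - z.2) • Y z.1 := by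
      have := hX.continuous
      have := hY.continuous
      fun_prop
    exact hcont.continuousAt.eventually (Units.isOpen.mem_nhds (hp c hc))
  set g : P → ℝ → 𝔸 := fun p u => transitionDensity u •
      Ring.inverse (Real.smoothTransition u • X p + (1 - Real.smoothTransition u) • Y p) with hg
  have hχ := Real.smoothTransition.contDiff (n := (⊤ : ℕ∞))
  have hgs : ContDiffOn ℝ ((⊤ : ℕ∞) : WithTop ℕ∞) (Function.uncurry g) (s ×ˢ univ) := by
    rintro ⟨p, u⟩ ⟨hp, -⟩
    refine ContDiffAt.contDiffWithinAt ?_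
    have h1 : ContDiffAt ℝ ((⊤ : ℕ∞) : WithTop ℕ∞) (fun q : P × ℝ =>
        Real.smoothTransition q.2 • X q.1 + (1 - Real.smoothTransition q.2) • Y q.1) (p, u) := by
      have a1 : ContDiff ℝ ((⊤ : ℕ∞) : WithTop ℕ∞) fun q : P × ℝ => Real.smoothTransition q.2 :=
        hχ.comp contDiff_snd
      exact ((a1.smul (hX.comp contDiff_fst)).add
        ((contDiff_const.sub a1).smul (hY.comp contDiff_fst))).contDiffAt
    have hu := hp (Real.smoothTransition u)
      ⟨Real.smoothTransition.nonneg u, Real.smoothTransition.le_one u⟩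
    obtain ⟨w, hw⟩ := hu
    have h2 : ContDiffAt ℝ ((⊤ : ℕ∞) : WithTop ℕ∞) Ring.inverse
        (Real.smoothTransition u • X p + (1 - Real.smoothTransition u) • Y p) := by
      rw [← hw]; exact contDiffAt_ringInverse ℝ w
    exact ((contDiff_transitionDensity.comp contDiff_snd).contDiffAt).smul
      (ContDiffAt.comp (g := Ring.inverse) (f := fun q : P × ℝ =>
        Real.smoothTransition q.2 • X q.1 + (1 - Real.smoothTransition q.2) • Y q.1) (p, u) h2 h1)
  -- The integral is the convolution of the constant function `1` with `g p`, evaluated at `0`.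
  have hconv := MeasureTheory.contDiffOn_convolution_right_with_param_comp (n := ⊤)
    (μ := MeasureTheory.volume) (ContinuousLinearMap.lsmul ℝ ℝ : ℝ →L[ℝ] 𝔸 →L[ℝ] 𝔸)
    (v := fun _ : P => (0 : ℝ)) (f := fun _ : ℝ => (1 : ℝ)) (g := g) (k := Icc 0 1)
    contDiffOn_const hso isCompact_Icc (fun p u _ hu => by
      have : transitionDensity u = 0 := by
        by_contra hne
        exact hu (Ioc_subset_Icc_self (support_transitionDensity hne))
      simp [hg, this])
    (MeasureTheory.locallyIntegrable_const 1) hgs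
  have hat := hconv.contDiffAt (hso.mem_nhds h)
  refine hat.congr_of_eventuallyEq (Eventually.of_forall fun p => ?_)
  simp only [MeasureTheory.convolution, ContinuousLinearMap.lsmul_apply, one_smul, zero_sub]
  rw [MeasureTheory.integral_neg_eq_self (fun u => g p u),
    intervalIntegral.integral_eq_integral_of_support_subset]
  intro u hu
  refine support_transitionDensity fun h0 => hu ?_
  simp [h0]

variable {A : Type*} [CStarAlgebra A] [FiniteDimensional ℂ A]

/-- The contraction with `θ(R, S)` as a continuous linear map. -/
noncomputable def doubleSumCLM (θ : ℝ → ℝ → ℝ) (R S : A) : A →L[ℂ] A :=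
  LinearMap.toContinuousLinearMap (doubleSumL θ R S)

theorem doubleSumCLM_apply (θ : ℝ → ℝ → ℝ) (R S C : A) :
    doubleSumCLM θ R S C = doubleSum θ R S C := rfl

theorem doubleSumCLM_mul_eq_one {θ η : ℝ → ℝ → ℝ} {R S : A} (hR : IsSelfAdjoint R)
    (hS : IsSelfAdjoint S) (h : ∀ x ∈ spectrum ℝ R, ∀ y ∈ spectrum ℝ S, θ x y * η x y = 1) :
    doubleSumCLM θ R S * doubleSumCLM η R S = 1 := by
  ext C
  change doubleSum θ R S (doubleSum η R S C) = C
  rw [doubleSum_doubleSum, doubleSum_congr (η := fun _ _ => 1) h, doubleSum_const hR hS, one_smul]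

theorem inverse_eq_of_mul_eq_one {M : Type*} [MonoidWithZero M] {a b : M} (h1 : a * b = 1)
    (h2 : b * a = 1) : Ring.inverse a = b :=
  Ring.inverse_unit (⟨a, b, h1, h2⟩ : Mˣ)

theorem inverse_doubleSumCLM {θ : ℝ → ℝ → ℝ} {R S : A} (hR : IsSelfAdjoint R)
    (hS : IsSelfAdjoint S) (h : ∀ x ∈ spectrum ℝ R, ∀ y ∈ spectrum ℝ S, θ x y ≠ 0) :
    Ring.inverse (doubleSumCLM θ R S) = doubleSumCLM (fun x y => (θ x y)⁻¹) R S :=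
  inverse_eq_of_mul_eq_one
    (doubleSumCLM_mul_eq_one hR hS fun x hx y hy => mul_inv_cancel₀ (h x hx y hy))
    (doubleSumCLM_mul_eq_one hR hS fun x hx y hy => inv_mul_cancel₀ (h x hx y hy))

theorem isUnit_doubleSumCLM {θ : ℝ → ℝ → ℝ} {R S : A} (hR : IsSelfAdjoint R)
    (hS : IsSelfAdjoint S) (h : ∀ x ∈ spectrum ℝ R, ∀ y ∈ spectrum ℝ S, θ x y ≠ 0) :
    IsUnit (doubleSumCLM θ R S) :=
  ⟨⟨_, doubleSumCLM (fun x y => (θ x y)⁻¹) R S,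
    doubleSumCLM_mul_eq_one hR hS fun x hx y hy => mul_inv_cancel₀ (h x hx y hy),
    doubleSumCLM_mul_eq_one hR hS fun x hx y hy => inv_mul_cancel₀ (h x hx y hy)⟩, rfl⟩

/-- Left multiplication as an element of the Banach algebra of operators. -/
noncomputable def mulLeftCLM : A →L[ℂ] (A →L[ℂ] A) := ContinuousLinearMap.mul ℂ A

/-- Right multiplication as an element of the Banach algebra of operators. -/
noncomputable def mulRightCLM : A →L[ℂ] (A →L[ℂ] A) := (ContinuousLinearMap.mul ℂ A).flip

/-- The operator `∫ (χ α L_R + (1 - χ) β R_S)^{-1}`, defined for all `R` and `S`; for positive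
definite ones it is the contraction with the reciprocal of the tilted logarithmic mean. -/
noncomputable def invMeanOp (α β : ℝ) (R S : A) : A →L[ℂ] A :=
  ∫ u in (0 : ℝ)..1, transitionDensity u • Ring.inverse (Real.smoothTransition u •
    (α • mulLeftCLM R) + (1 - Real.smoothTransition u) • (β • mulRightCLM S))

theorem meanOp_eq_doubleSumCLM {R S : A} (hR : IsSelfAdjoint R) (hS : IsSelfAdjoint S)
    (α β c : ℝ) : c • (α • mulLeftCLM R) + (1 - c) • (β • mulRightCLM S) =
      doubleSumCLM (fun x y => c * (α * x) + (1 - c) * (β * y)) R S := by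
  ext C
  rw [doubleSumCLM_apply]
  simp only [← mul_assoc]
  rw [doubleSum_linear hR hS]
  simp [mulLeftCLM, mulRightCLM, smul_smul]

theorem convexCombo_pos {x y c : ℝ} (hx : 0 < x) (hy : 0 < y) (hc : c ∈ Icc (0 : ℝ) 1) :
    0 < c * x + (1 - c) * y := by
  rcases hc.1.eq_or_lt with h | h
  · rw [← h]; linarith
  · have := mul_pos h hx
    have := mul_nonneg (sub_nonneg.mpr hc.2) hy.le
    linarith

theorem isUnit_meanOp {R S : A} (hR : IsPosDef R) (hS : IsPosDef S) {α β : ℝ} (hα : 0 < α)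
    (hβ : 0 < β) {c : ℝ} (hc : c ∈ Icc (0 : ℝ) 1) :
    IsUnit (c • (α • mulLeftCLM R) + (1 - c) • (β • mulRightCLM S)) := by
  rw [meanOp_eq_doubleSumCLM hR.1 hS.1]
  exact isUnit_doubleSumCLM hR.1 hS.1 fun x hx y hy =>
    (convexCombo_pos (hR.mul_pos_of_mem hα hx) (hS.mul_pos_of_mem hβ hy) hc).ne'

/-- Both operators are diagonal in the blocks `E^R_x A E^S_y`, where the integral reduces to the
scalar one for the logarithmic mean. -/
theorem invMeanOp_eq {R S : A} (hR : IsPosDef R) (hS : IsPosDef S) {α β : ℝ} (hα : 0 < α)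
    (hβ : 0 < β) :
    invMeanOp α β R S = doubleSumCLM (fun x y => (logMean (α * x) (β * y))⁻¹) R S := by
  have hchi : ∀ u, Real.smoothTransition u ∈ Icc (0 : ℝ) 1 := fun u =>
    ⟨Real.smoothTransition.nonneg u, Real.smoothTransition.le_one u⟩
  have e : ∀ u : ℝ, transitionDensity u • Ring.inverse (Real.smoothTransition u •
      (α • mulLeftCLM R) + (1 - Real.smoothTransition u) • (β • mulRightCLM S)) =
      transitionDensity u • doubleSumCLM (fun x y => (meanAt u (α * x) (β * y))⁻¹) R S := by
    intro u
    rw [meanOp_eq_doubleSumCLM hR.1 hS.1, inverse_doubleSumCLM hR.1 hS.1 fun x hx y hy =>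
      (convexCombo_pos (hR.mul_pos_of_mem hα hx) (hS.mul_pos_of_mem hβ hy) (hchi u)).ne']
    rfl
  have hcont : Continuous fun u : ℝ => transitionDensity u • Ring.inverse (Real.smoothTransition u •
      (α • mulLeftCLM R) + (1 - Real.smoothTransition u) • (β • mulRightCLM S)) := by
    refine contDiff_transitionDensity.continuous.smul (continuous_iff_continuousAt.mpr fun u => ?_)
    obtain ⟨w, hw⟩ := isUnit_meanOp hR hS hα hβ (hchi u)
    have h1 : ContinuousAt Ring.inverse (Real.smoothTransition u •
      (α • mulLeftCLM R) + (1 - Real.smoothTransition u) • (β • mulRightCLM S)) := by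
      rw [← hw]; exact NormedRing.inverse_continuousAt w
    have h2 : Continuous fun u : ℝ => Real.smoothTransition u •
      (α • mulLeftCLM R) + (1 - Real.smoothTransition u) • (β • mulRightCLM S) := by
      have := Real.smoothTransition.continuous
      fun_prop
    exact ContinuousAt.comp (f := fun u : ℝ => Real.smoothTransition u •
      (α • mulLeftCLM R) + (1 - Real.smoothTransition u) • (β • mulRightCLM S)) h1 h2.continuousAt
  ext C
  unfold invMeanOp
  have h3 := (ContinuousLinearMap.apply ℂ A C).restrictScalars ℝ |>.intervalIntegral_comp_comm
    (hcont.intervalIntegrable (μ := MeasureTheory.volume) 0 1)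
  refine h3.symm.trans ?_
  simp only [e]
  change ∫ u in (0 : ℝ)..1, transitionDensity u •
    doubleSum (fun x y => (meanAt u (α * x) (β * y))⁻¹) R S C = doubleSum _ R S C
  simp only [doubleSum_eq_sum, Finset.smul_sum, smul_smul]
  have hc : ∀ x ∈ spec R, ∀ y ∈ spec S, Continuous fun u => (transitionDensity u *
      (meanAt u (α * x) (β * y))⁻¹) • (spectralProj R x * C * spectralProj S y) :=
    fun x hx y hy => (continuous_inv_meanAt (hR.mul_pos_of_mem hα (mem_spec.mp hx))
      (hS.mul_pos_of_mem hβ (mem_spec.mp hy))).smul continuous_const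
  rw [intervalIntegral.integral_finsetSum fun x hx =>
    (continuous_finsetSum _ fun y hy => hc x hx y hy).intervalIntegrable _ _]
  refine Finset.sum_congr rfl fun x hx => ?_
  rw [intervalIntegral.integral_finsetSum fun y hy => (hc x hx y hy).intervalIntegrable _ _]
  refine Finset.sum_congr rfl fun y hy => ?_
  rw [intervalIntegral.integral_smul_const, integral_inv_meanAt
    (hR.mul_pos_of_mem hα (mem_spec.mp hx)) (hS.mul_pos_of_mem hβ (mem_spec.mp hy))]

end Smooth

namespace DifferentialStructure

variable {A : Type*} [CStarAlgebra A] [FiniteDimensional ℂ A] {J : Type*} [Fintype J] {ι : Type*}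
  {B : ι → Type*} [∀ k, CStarAlgebra (B k)] [∀ k, FiniteDimensional ℂ (B k)]
  (D : DifferentialStructure A J B)

section SmoothK

/-- The contraction with `θ_j(l_j(ρ), r_j(ρ))`, written as the inverse of an operator that depends
smoothly on `ρ`. -/
noncomputable def meanOp (j : J) (ρ : A) : B (D.κ j) →L[ℂ] B (D.κ j) :=
  Ring.inverse (invMeanOp (Real.exp (D.ω j / 2)) (Real.exp (-D.ω j / 2)) (D.l j ρ) (D.r j ρ))

theorem invMeanOp_eq_doubleSumCLM {ρ : A} (hρ : IsPosDef ρ) (j : J) :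
    invMeanOp (Real.exp (D.ω j / 2)) (Real.exp (-D.ω j / 2)) (D.l j ρ) (D.r j ρ) =
      doubleSumCLM (fun x y => (D.θ j x y)⁻¹) (D.l j ρ) (D.r j ρ) :=
  invMeanOp_eq (D.isPosDef_l hρ j) (D.isPosDef_r hρ j) (Real.exp_pos _) (Real.exp_pos _)

theorem meanOp_eq {ρ : A} (hρ : IsPosDef ρ) (j : J) :
    D.meanOp j ρ = doubleSumCLM (D.θ j) (D.l j ρ) (D.r j ρ) := by
  unfold meanOp
  rw [D.invMeanOp_eq_doubleSumCLM hρ, inverse_doubleSumCLM (D.isPosDef_l hρ j).1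
    (D.isPosDef_r hρ j).1 fun x hx y hy => inv_ne_zero (D.θ_pos_of_mem hρ j x hx y hy).ne']
  simp only [inv_inv]

theorem contDiffAt_meanOp {ρ : A} (hρ : IsPosDef ρ) (j : J) :
    ContDiffAt ℝ ((⊤ : ℕ∞) : WithTop ℕ∞) (D.meanOp j) ρ := by
  have hl : ContDiff ℝ ((⊤ : ℕ∞) : WithTop ℕ∞) fun ρ : A =>
      Real.exp (D.ω j / 2) • (mulLeftCLM (D.l j ρ) : B (D.κ j) →L[ℂ] B (D.κ j)) := by
    have h0 := (((mulLeftCLM (A := B (D.κ j))).comp (LinearMap.toContinuousLinearMap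
      (D.l j).toAlgHom.toLinearMap)).restrictScalars ℝ).contDiff (n := ((⊤ : ℕ∞) : WithTop ℕ∞))
    exact h0.const_smul (Real.exp (D.ω j / 2))
  have hr : ContDiff ℝ ((⊤ : ℕ∞) : WithTop ℕ∞) fun ρ : A =>
      Real.exp (-D.ω j / 2) • (mulRightCLM (D.r j ρ) : B (D.κ j) →L[ℂ] B (D.κ j)) := by
    have h0 := (((mulRightCLM (A := B (D.κ j))).comp (LinearMap.toContinuousLinearMap
      (D.r j).toAlgHom.toLinearMap)).restrictScalars ℝ).contDiff (n := ((⊤ : ℕ∞) : WithTop ℕ∞))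
    exact h0.const_smul (Real.exp (-D.ω j / 2))
  have h1 := contDiffAt_integral_inverse hl hr (p₀ := ρ) fun c hc =>
    isUnit_meanOp (D.isPosDef_l hρ j) (D.isPosDef_r hρ j) (Real.exp_pos _) (Real.exp_pos _) hc
  have hu : IsUnit (invMeanOp (Real.exp (D.ω j / 2)) (Real.exp (-D.ω j / 2)) (D.l j ρ)
      (D.r j ρ)) := by
    rw [D.invMeanOp_eq_doubleSumCLM hρ]
    exact isUnit_doubleSumCLM (D.isPosDef_l hρ j).1 (D.isPosDef_r hρ j).1 fun x hx y hy =>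
      inv_ne_zero (D.θ_pos_of_mem hρ j x hx y hy).ne'
  obtain ⟨w, hw⟩ := hu
  have h2 : ContDiffAt ℝ ((⊤ : ℕ∞) : WithTop ℕ∞) Ring.inverse (invMeanOp (Real.exp (D.ω j / 2))
      (Real.exp (-D.ω j / 2)) (D.l j ρ) (D.r j ρ)) := by
    rw [← hw]; exact contDiffAt_ringInverse ℝ w
  exact ContDiffAt.comp ρ h2 h1

/-- The operator `K_ρ` extended to a smooth function of all `ρ` near the positive definite ones. -/
noncomputable def KCLM (ρ : A) : A →L[ℂ] A :=
  ∑ j, (LinearMap.toContinuousLinearMap (D.partialAdj j)).comp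
    ((D.meanOp j ρ).comp (LinearMap.toContinuousLinearMap (D.partialD j)))

theorem KCLM_apply {ρ : A} (hρ : IsPosDef ρ) (a : A) : D.KCLM ρ a = D.Kop ρ a := by
  unfold KCLM Kop
  rw [_root_.sum_apply]
  refine Finset.sum_congr rfl fun j _ => ?_
  rw [D.meanOp_eq hρ]
  rfl

theorem contDiffAt_KCLM {ρ : A} (hρ : IsPosDef ρ) :
    ContDiffAt ℝ ((⊤ : ℕ∞) : WithTop ℕ∞) D.KCLM ρ := by
  refine ContDiffAt.sum (f := fun j ρ => (LinearMap.toContinuousLinearMap (D.partialAdj j)).comp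
    ((D.meanOp j ρ).comp (LinearMap.toContinuousLinearMap (D.partialD j)))) fun j _ => ?_
  have h := D.contDiffAt_meanOp hρ j
  have hb : ContDiff ℝ ((⊤ : ℕ∞) : WithTop ℕ∞) fun T : B (D.κ j) →L[ℂ] B (D.κ j) =>
      (LinearMap.toContinuousLinearMap (D.partialAdj j)).comp
        (T.comp (LinearMap.toContinuousLinearMap (D.partialD j))) :=
    ((((ContinuousLinearMap.compL ℂ A (B (D.κ j)) A)
      (LinearMap.toContinuousLinearMap (D.partialAdj j))).comp
      ((ContinuousLinearMap.compL ℂ A (B (D.κ j)) (B (D.κ j))).flip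
        (LinearMap.toContinuousLinearMap (D.partialD j)))).restrictScalars ℝ).contDiff
  exact ContDiffAt.comp ρ hb.contDiffAt h

/-- The inverse of `K_ρ` on elements of trace zero, extended to all of `A`. -/
noncomputable def Ksol (ρ : A) : A →L[ℂ] A :=
  Ring.inverse (D.KCLM ρ + LinearMap.toContinuousLinearMap D.traceOne)

variable {D}

/-- `K_ρ + τ[·] 1` is invertible because `K_ρ` takes values of trace zero and its kernel is spanned
by `1`. -/
theorem IsErgodic.isUnit_KCLM_add (hD : D.IsErgodic) {ρ : A} (hρ : IsPosDef ρ) :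
    IsUnit (D.KCLM ρ + LinearMap.toContinuousLinearMap D.traceOne) := by
  have hinj : Function.Injective (D.KCLM ρ + LinearMap.toContinuousLinearMap D.traceOne) := by
    refine (injective_iff_map_eq_zero _).mpr fun x hx => ?_
    have hx' : D.Kop ρ x + D.τ x • (1 : A) = 0 := by
      rw [← D.KCLM_apply hρ]; exact hx
    have ht : D.τ x = 0 := by
      have h := congrArg D.τ.toLin hx'
      rw [map_add, trace_Kop_eq_zero, zero_add, map_smul, map_zero, smul_eq_mul] at h
      exact (mul_eq_zero.mp h).resolve_right D.trace_one_ne_zero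
    rw [ht, zero_smul, add_zero] at hx'
    exact hD.Kop_injective hρ hx' ht
  exact ContinuousLinearMap.isUnit_iff_bijective.mpr
    ⟨hinj, LinearMap.injective_iff_surjective
      (f := ((D.KCLM ρ + LinearMap.toContinuousLinearMap D.traceOne : A →L[ℂ] A) :
        A →ₗ[ℂ] A)).mp hinj⟩

theorem IsErgodic.contDiffAt_Ksol (hD : D.IsErgodic) {ρ : A} (hρ : IsPosDef ρ) :
    ContDiffAt ℝ ((⊤ : ℕ∞) : WithTop ℕ∞) D.Ksol ρ := by
  obtain ⟨w, hw⟩ := hD.isUnit_KCLM_add hρ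
  have h2 : ContDiffAt ℝ ((⊤ : ℕ∞) : WithTop ℕ∞) Ring.inverse
      (D.KCLM ρ + LinearMap.toContinuousLinearMap D.traceOne) := by
    rw [← hw]; exact contDiffAt_ringInverse ℝ w
  exact ContDiffAt.comp ρ h2 ((D.contDiffAt_KCLM hρ).add contDiffAt_const)

/-- On self-adjoint elements of trace zero, `Ksol ρ` is the inverse of `K_ρ` as a map into the
tangent space. -/
theorem IsErgodic.Ksol_spec (hD : D.IsErgodic) {ρ : A} (hρ : IsPosDef ρ) {v : A}
    (hv : IsSelfAdjoint v) (hv0 : D.τ v = 0) :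
    D.Ksol ρ v ∈ D.tangent ∧ D.Kop ρ (D.Ksol ρ v) = v := by
  have h := congrArg (fun T : A →L[ℂ] A => T v)
    (Ring.mul_inverse_cancel _ (hD.isUnit_KCLM_add hρ))
  have h' : D.Kop ρ (D.Ksol ρ v) + D.τ (D.Ksol ρ v) • (1 : A) = v := by
    rw [← D.KCLM_apply hρ]; exact h
  have ht : D.τ (D.Ksol ρ v) = 0 := by
    have h := congrArg D.τ.toLin h'
    rw [map_add, trace_Kop_eq_zero, zero_add, map_smul, hv0, smul_eq_mul] at h
    exact (mul_eq_zero.mp h).resolve_right D.trace_one_ne_zero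
  rw [ht, zero_smul, add_zero] at h'
  refine ⟨hD.mem_tangent_iff.mpr ⟨?_, ht⟩, h'⟩
  have h1 : D.Kop ρ (star (D.Ksol ρ v) - D.Ksol ρ v) = 0 := by
    rw [Kop_sub, ← D.star_Kop hρ.1, h', hv.star_eq, sub_self]
  have h2 := hD.Kop_injective hρ h1 (by
    rw [map_sub, D.τ.map_star, ht, star_zero, sub_zero])
  exact sub_eq_zero.mp h2

/-- Every smooth curve of positive definite density matrices is admissible. -/
theorem IsErgodic.isAdmissible (hD : D.IsErgodic) {ρ v : ℝ → A}
    (hρ : ContDiffOn ℝ ((⊤ : ℕ∞) : WithTop ℕ∞) ρ (Icc 0 1))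
    (hpos : ∀ t ∈ Icc (0 : ℝ) 1, ρ t ∈ D.densityPos)
    (hv : ∀ t ∈ Icc (0 : ℝ) 1, HasDerivWithinAt ρ (v t) (Icc 0 1) t) :
    D.IsAdmissible (ρ 0) (ρ 1) ρ (fun t => D.Ksol (ρ t) (v t)) ∧
      ∀ t ∈ Icc (0 : ℝ) 1, IsSelfAdjoint (v t) ∧ D.τ (v t) = 0 ∧
        D.Kop (ρ t) (D.Ksol (ρ t) (v t)) = v t := by
  have hu : UniqueDiffOn ℝ (Icc (0 : ℝ) 1) := uniqueDiffOn_Icc_zero_one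
  have hvt : ∀ t ∈ Icc (0 : ℝ) 1, IsSelfAdjoint (v t) ∧ D.τ (v t) = 0 := fun t ht => by
    constructor
    · have h1 := (hv t ht).star
      have h2 : HasDerivWithinAt ρ (star (v t)) (Icc 0 1) t :=
        h1.congr (fun s hs => (hpos s hs).1.1.star_eq.symm) (hpos t ht).1.1.star_eq.symm
      exact (hu t ht).eq_deriv _ h2 (hv t ht)
    · have h1 := ((LinearMap.toContinuousLinearMap D.τ.toLin).restrictScalars ℝ).hasFDerivAt
        (x := ρ t) |>.comp_hasDerivWithinAt t (hv t ht)
      have h2 : HasDerivWithinAt (fun _ : ℝ => (1 : ℂ)) (D.τ (v t)) (Icc 0 1) t :=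
        h1.congr (fun s hs => (hpos s hs).2.symm) (hpos t ht).2.symm
      exact (hu t ht).eq_deriv _ h2 (hasDerivWithinAt_const _ _ _)
  have hvs : ContDiffOn ℝ ((⊤ : ℕ∞) : WithTop ℕ∞) v (Icc 0 1) := by
    refine (hρ.derivWithin hu (m := ((⊤ : ℕ∞) : WithTop ℕ∞)) le_rfl).congr fun t ht => ?_
    exact ((hv t ht).derivWithin (hu t ht)).symm
  have hsol : ContDiffOn ℝ ((⊤ : ℕ∞) : WithTop ℕ∞) (fun t => D.Ksol (ρ t)) (Icc 0 1) :=
    fun t ht => ContDiffAt.comp_contDiffWithinAt (g := D.Ksol) t (hD.contDiffAt_Ksol (hpos t ht).1) (hρ t ht)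
  have hb : IsBoundedBilinearMap ℝ (fun p : (A →L[ℂ] A) × A => p.1 p.2) :=
    ⟨fun _ _ _ => rfl, fun _ _ _ => rfl, fun _ _ _ => map_add _ _ _,
      fun c x y => by simp,
      ⟨1, one_pos, fun x y => by simpa using x.le_opNorm y⟩⟩
  have hspec := fun t ht => hD.Ksol_spec (hpos t ht).1 (hvt t ht).1 (hvt t ht).2
  refine ⟨⟨hρ, ?_, rfl, rfl, fun t ht => ⟨hpos t ht, (hspec t ht).1, ?_⟩⟩,
    fun t ht => ⟨(hvt t ht).1, (hvt t ht).2, (hspec t ht).2⟩⟩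
  · exact hb.contDiff.comp_contDiffOn (hsol.prodMk hvs)
  · rw [(hspec t ht).2]; exact hv t ht

theorem IsAdmissible.continuousOn_energy {ρ₀ ρ₁ : A} {ρ a : ℝ → A}
    (h : D.IsAdmissible ρ₀ ρ₁ ρ a) :
    ContinuousOn (fun t => D.energy (ρ t) (a t)) (Icc 0 1) := by
  have h1 : ContinuousOn (fun t => (D.τ (star (a t) * D.KCLM (ρ t) (a t))).re) (Icc 0 1) := by
    have hK : ContinuousOn (fun t => D.KCLM (ρ t)) (Icc 0 1) := fun t ht =>
      ContinuousAt.comp_continuousWithinAt (g := D.KCLM)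
        (D.contDiffAt_KCLM (h.2.2.2.2 t ht).1.1).continuousAt (h.1.continuousOn t ht)
    have ha := h.2.1.continuousOn
    have h2 : ContinuousOn (fun t => star (a t) * D.KCLM (ρ t) (a t)) (Icc 0 1) :=
      ha.star.mul (hK.clm_apply ha)
    exact Complex.continuous_re.comp_continuousOn (D.continuous_trace.comp_continuousOn h2)
  refine h1.congr fun t ht => ?_
  simp only
  rw [energy_eq_trace, D.KCLM_apply (h.2.2.2.2 t ht).1.1]

variable (D) in
theorem differentiableAt_energy {ρ : A} (hρ : IsPosDef ρ) (a : A) :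
    DifferentiableAt ℝ (fun ρ => (D.τ (star a * D.KCLM ρ a)).re) ρ := by
  have h := (D.contDiffAt_KCLM hρ).differentiableAt (by simp)
  have h1 : DifferentiableAt ℝ (fun ρ => D.KCLM ρ a) ρ :=
    ((ContinuousLinearMap.apply ℂ A a).restrictScalars ℝ).differentiableAt.comp ρ h
  exact (D.reτ.differentiableAt).comp ρ ((differentiableAt_const _).mul h1)

end SmoothK
end DifferentialStructure

/-! ### The relative entropy: Klein's inequality, continuity and derivative -/

section Klein

variable {A : Type*} [CStarAlgebra A] [FiniteDimensional ℂ A]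

theorem trace_cfc_mul_cfc (τ : FaithfulTrace A) (a b : A) (f g : ℝ → ℝ) :
    (τ (cfc f a * cfc g b)).re = ∑ x ∈ spec a, ∑ y ∈ spec b,
      f x * g y * (τ (spectralProj a x * spectralProj b y)).re := by
  rw [← sum_smul_spectralProj f, ← sum_smul_spectralProj g, Finset.sum_mul_sum, map_sum,
    Complex.re_sum]
  refine Finset.sum_congr rfl fun x _ => ?_
  rw [map_sum, Complex.re_sum]
  refine Finset.sum_congr rfl fun y _ => ?_
  rw [smul_mul_smul_comm, ← Complex.coe_smul, map_smul, smul_eq_mul, Complex.re_ofReal_mul]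

theorem FaithfulTrace.spectralProj_mul_nonneg (τ : FaithfulTrace A) (a b : A)
    (x y : ℝ) : 0 ≤ (τ (spectralProj a x * spectralProj b y)).re := by
  have h1 : IsPosSemidef (spectralProj b y) := by
    have := isPosSemidef_star_mul_self (spectralProj b y)
    rwa [star_spectralProj, spectralProj_mul, if_pos rfl] at this
  have h2 := τ.nonneg_mul h1 (spectralProj a x)
  rwa [star_spectralProj, spectralProj_mul, if_pos rfl] at h2

/-- Klein's inequality: a scalar inequality `f x + g x (y - x) ≤ f y` passes to traces, because
`τ[E_x^a E_y^b] ≥ 0`. -/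
theorem FaithfulTrace.klein (τ : FaithfulTrace A) {a b : A} (ha : IsSelfAdjoint a)
    (hb : IsSelfAdjoint b) {f g : ℝ → ℝ}
    (h : ∀ x ∈ spectrum ℝ a, ∀ y ∈ spectrum ℝ b, f x + g x * (y - x) ≤ f y) :
    (τ (cfc f a)).re + (τ (cfc g a * (b - a))).re ≤ (τ (cfc f b)).re := by
  have e1 : (τ (cfc f a)).re = (τ (cfc f a * cfc (fun _ => (1 : ℝ)) b)).re := by
    rw [cfc_const_one ℝ b, mul_one]
  have e2 : (τ (cfc f b)).re = (τ (cfc (fun _ => (1 : ℝ)) a * cfc f b)).re := by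
    rw [cfc_const_one ℝ a, one_mul]
  have e3 : (τ (cfc g a * (b - a))).re = (τ (cfc g a * cfc (fun y : ℝ => y) b)).re -
      (τ (cfc (fun x => g x * x) a * cfc (fun _ => (1 : ℝ)) b)).re := by
    rw [cfc_const_one ℝ b, mul_one, cfc_id' ℝ b, cfc_mul _ _ _ (continuousOn_spectrum _ _)
      (continuousOn_spectrum _ _), cfc_id' ℝ a, mul_sub, map_sub, Complex.sub_re]
  rw [e1, e2, e3]
  simp only [trace_cfc_mul_cfc, ← Finset.sum_sub_distrib, ← Finset.sum_add_distrib]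
  refine Finset.sum_le_sum fun x hx => Finset.sum_le_sum fun y hy => ?_
  have h1 := mul_le_mul_of_nonneg_right (h x (mem_spec.mp hx) y (mem_spec.mp hy))
    (τ.spectralProj_mul_nonneg a b x y)
  linarith

theorem continuousOn_cfc_of_isOpen {f : ℝ → ℝ} {s : Set ℝ} (hs : IsOpen s)
    (hf : ContinuousOn f s) :
    ContinuousOn (cfc f : A → A) {a | IsSelfAdjoint a ∧ spectrum ℝ a ⊆ s} := by
  refine ContinuousOn.cfc_of_mem_nhdsSet f (s := s) (a := fun a : A => a) ?_ continuousOn_id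
    (fun a ha => ha.1) hf
  exact hs.mem_nhdsSet.mpr (iUnion₂_subset fun a ha => ha.2)

theorem continuousOn_cfc_log : ContinuousOn (cfc Real.log : A → A) {a | IsPosDef a} :=
  (continuousOn_cfc_of_isOpen isOpen_Ioi
    (Real.continuousOn_log.mono fun _ hx => (mem_Ioi.mp hx).ne')).mono
    fun _ ha => ⟨ha.1, ha.2⟩

theorem mul_log_klein {x y : ℝ} (hx : 0 < x) (hy : 0 ≤ y) :
    x * Real.log x + (Real.log x + 1) * (y - x) ≤ y * Real.log y := by
  rcases hy.eq_or_lt with rfl | hy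
  · simp; nlinarith
  · have h := Real.log_le_sub_one_of_pos (div_pos hx hy)
    rw [Real.log_div hx.ne' hy.ne'] at h
    have h2 := mul_le_mul_of_nonneg_left h hy.le
    have h3 : y * (x / y - 1) = x - y := by field_simp
    rw [h3] at h2
    nlinarith

end Klein

namespace DifferentialStructure

variable {A : Type*} [CStarAlgebra A] [FiniteDimensional ℂ A] {J : Type*} [Fintype J] {ι : Type*}
  {B : ι → Type*} [∀ k, CStarAlgebra (B k)] [∀ k, FiniteDimensional ℂ (B k)]
  (D : DifferentialStructure A J B)

theorem densityPos_subset_density : D.densityPos ⊆ D.density := fun _ h =>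
  ⟨h.1.isPosSemidef, h.2⟩

/-- `log ρ - log σ`, the gradient of the relative entropy at `ρ`. -/
noncomputable def logRatio (ρ : A) : A := cfc Real.log ρ - cfc Real.log D.σ

theorem isSelfAdjoint_logRatio (ρ : A) : IsSelfAdjoint (D.logRatio ρ) :=
  (cfc_predicate (R := ℝ) (p := IsSelfAdjoint) _ ρ).sub
    (cfc_predicate (R := ℝ) (p := IsSelfAdjoint) _ D.σ)

theorem continuousOn_logRatio : ContinuousOn D.logRatio D.densityPos :=
  (continuousOn_cfc_log.mono fun _ h => h.1).sub continuousOn_const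

theorem continuousOn_entropy : ContinuousOn D.entropy D.density := by
  have h1 : ContinuousOn (cfc (fun x : ℝ => x * Real.log x) : A → A) D.density :=
    (continuousOn_cfc_of_isOpen isOpen_univ Real.continuous_mul_log.continuousOn).mono
      fun _ ha => ⟨ha.1.1, subset_univ _⟩
  exact D.reτ.continuous.comp_continuousOn
    (h1.sub (continuousOn_id.mul continuousOn_const))

/-- The entropy lies above its tangent planes. -/
theorem entropy_add_le {ρ ν : A} (hρ : ρ ∈ D.densityPos) (hν : ν ∈ D.density) :
    D.entropy ρ + (D.τ (D.logRatio ρ * (ν - ρ))).re ≤ D.entropy ν := by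
  have h := D.τ.klein hρ.1.1 hν.1.1 (f := fun x => x * Real.log x)
    (g := fun x => Real.log x + 1)
    (fun x hx y hy => mul_log_klein (hρ.1.2 x hx) (hν.1.2 y hy))
  have hρ1 := hρ.1.1
  rw [cfc_add _ _ _ (continuousOn_spectrum _ _) (continuousOn_spectrum _ _), cfc_const_one ℝ ρ,
    add_mul, one_mul, map_add, map_sub D.τ.toLin ν ρ, hρ.2, hν.2, sub_self, add_zero] at h
  have e : (D.τ (D.logRatio ρ * (ν - ρ))).re = (D.τ (cfc Real.log ρ * (ν - ρ))).re -
      ((D.τ (ν * cfc Real.log D.σ)).re - (D.τ (ρ * cfc Real.log D.σ)).re) := by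
    unfold logRatio
    rw [sub_mul, map_sub, Complex.sub_re, D.τ.tracial (cfc Real.log D.σ), sub_mul, map_sub,
      Complex.sub_re]
  unfold entropy
  rw [map_sub, map_sub, Complex.sub_re, Complex.sub_re, e]
  linarith

/-- The derivative of the entropy at a positive definite density matrix. -/
noncomputable def entropyDeriv (ρ : A) : A →L[ℝ] ℝ :=
  D.reτ.comp (ContinuousLinearMap.mul ℝ A (D.logRatio ρ))

theorem entropyDeriv_apply (ρ v : A) : D.entropyDeriv ρ v = (D.τ (D.logRatio ρ * v)).re := rfl

/-- Klein's inequality at both points brackets the entropy difference between two linear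
expressions, whose gap is of lower order by the continuity of the logarithm. -/
theorem hasFDerivWithinAt_entropy {ρ : A} (hρ : ρ ∈ D.densityPos) :
    HasFDerivWithinAt D.entropy (D.entropyDeriv ρ) D.densityPos ρ := by
  rw [hasFDerivWithinAt_iff_isLittleO, Asymptotics.isLittleO_iff]
  intro c hc
  have hc' : 0 < c / (‖D.reτ‖ + 1) := by positivity
  have hlim' : Tendsto (fun x => D.logRatio x - D.logRatio ρ) (𝓝[D.densityPos] ρ) (𝓝 0) := by
    have : Tendsto D.logRatio (𝓝[D.densityPos] ρ) (𝓝 (D.logRatio ρ)) := D.continuousOn_logRatio ρ hρ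
    simpa using this.sub_const (D.logRatio ρ)
  have hev := hlim'.norm.eventually (gt_mem_nhds (by rwa [norm_zero]))
  filter_upwards [hev, self_mem_nhdsWithin] with x hx hxp
  have h1 := D.entropy_add_le hρ (D.densityPos_subset_density hxp)
  have h2 := D.entropy_add_le hxp (D.densityPos_subset_density hρ)
  have h3 : (D.τ (D.logRatio x * (ρ - x))).re = -(D.τ (D.logRatio x * (x - ρ))).re := by
    rw [← neg_sub x ρ, mul_neg, map_neg, Complex.neg_re]
  have h4 : ‖D.reτ ((D.logRatio x - D.logRatio ρ) * (x - ρ))‖ ≤ c * ‖x - ρ‖ := by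
    refine (D.reτ.le_opNorm _).trans ?_
    have h5 : ‖D.reτ‖ * (c / (‖D.reτ‖ + 1)) ≤ c := by
      rw [mul_div_assoc', div_le_iff₀ (by positivity)]
      nlinarith [norm_nonneg D.reτ]
    calc ‖D.reτ‖ * ‖(D.logRatio x - D.logRatio ρ) * (x - ρ)‖
        ≤ ‖D.reτ‖ * (c / (‖D.reτ‖ + 1) * ‖x - ρ‖) := by
          gcongr
          exact (norm_mul_le _ _).trans (by gcongr)
      _ = ‖D.reτ‖ * (c / (‖D.reτ‖ + 1)) * ‖x - ρ‖ := by ring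
      _ ≤ c * ‖x - ρ‖ := by gcongr
  rw [reτ_apply, sub_mul, map_sub, Complex.sub_re, Real.norm_eq_abs] at h4
  have h6 := (abs_le.mp h4).2
  rw [entropyDeriv_apply, Real.norm_eq_abs, abs_le]
  rw [h3] at h2
  have := norm_nonneg (x - ρ)
  constructor
  · have := mul_nonneg hc.le this; linarith
  · linarith

theorem hasDerivWithinAt_entropy {ρ : ℝ → A} {v : A} {s : Set ℝ} {t : ℝ}
    (hρ : ∀ u ∈ s, ρ u ∈ D.densityPos) (ht : t ∈ s) (hv : HasDerivWithinAt ρ v s t) :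
    HasDerivWithinAt (fun u => D.entropy (ρ u)) (D.τ (D.logRatio (ρ t) * v)).re s t :=
  (D.hasFDerivWithinAt_entropy (hρ t ht)).comp_hasDerivWithinAt t hv hρ

end DifferentialStructure

/-! ### The Hessian of the entropy -/

theorem nonneg_of_hasDerivAt {f : ℝ → ℝ} {f' : ℝ} (hf : HasDerivAt f f' 0) (h0 : f 0 = 0)
    (h : ∀ t, 0 ≤ t → 0 ≤ f t) : 0 ≤ f' := by
  have h1 := (hasDerivWithinAt_iff_tendsto_slope' (s := Ioi 0) (by simp)).mp hf.hasDerivWithinAt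
  refine ge_of_tendsto h1 (eventually_mem_nhdsWithin.mono fun t ht => ?_)
  rw [slope_def_field, h0, sub_zero, sub_zero]
  exact div_nonneg (h t (mem_Ioi.mp ht).le) (mem_Ioi.mp ht).le

/-- The positive definite elements form an open subset of the self-adjoint ones. -/
theorem IsPosDef.eventually_add_smul {A : Type*} [CStarAlgebra A] [FiniteDimensional ℂ A]
    (τ : FaithfulTrace A) {ρ b : A} (hρ : IsPosDef ρ) (hb : IsSelfAdjoint b) :
    ∀ᶠ ε : ℝ in 𝓝 0, IsPosDef (ρ + ε • b) := by
  obtain ⟨c, hc, hlow⟩ := hρ.exists_lower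
  have hlim : Tendsto (fun ε : ℝ => ‖ε • b‖) (𝓝 0) (𝓝 0) := by
    have : Continuous fun ε : ℝ => ‖ε • b‖ := by fun_prop
    simpa using this.tendsto 0
  filter_upwards [hlim.eventually (ge_mem_nhds (half_pos hc))] with ε hε
  refine (τ.spectrum_ge_of_norm_sub_le hρ.1 hlow hc
    (hρ.1.add (IsSelfAdjoint.smul (star_trivial ε) hb)) ?_).1
  rwa [add_sub_cancel_left]

namespace DifferentialStructure

variable {A : Type*} [CStarAlgebra A] [FiniteDimensional ℂ A] {J : Type*} [Fintype J] {ι : Type*}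
  {B : ι → Type*} [∀ k, CStarAlgebra (B k)] [∀ k, FiniteDimensional ℂ (B k)]
  (D : DifferentialStructure A J B)

theorem trace_logRatio_mul_Kop {ρ a : A} (hρ : IsPosDef ρ) (ha : IsSelfAdjoint a) :
    (D.τ (D.logRatio ρ * D.Kop ρ a)).re = -(D.τ (a * D.generatorAdj ρ)).re := by
  have h := D.trace_Kop_comm ρ (D.logRatio ρ) a
  rw [(D.isSelfAdjoint_logRatio ρ).star_eq, ha.star_eq] at h
  rw [h, logRatio, D.Kop_log hρ, mul_neg, map_neg, Complex.neg_re]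

theorem deriv_energy_add_smul {ρ b : A} (hρ : IsPosDef ρ) (hb : IsSelfAdjoint b) (a : A) :
    deriv (fun ε : ℝ => D.energy (ρ + ε • b) a) 0 =
      fderiv ℝ (fun ρ => (D.τ (star a * D.KCLM ρ a)).re) ρ b := by
  have h1 : (fun ε : ℝ => D.energy (ρ + ε • b) a) =ᶠ[𝓝 0]
      fun ε : ℝ => (D.τ (star a * D.KCLM (ρ + ε • b) a)).re := by
    filter_upwards [hρ.eventually_add_smul D.τ hb] with ε hε
    rw [energy_eq_trace, D.KCLM_apply hε]
  rw [h1.deriv_eq]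
  have h2 : HasDerivAt (fun ε : ℝ => ρ + ε • b) b 0 := by
    simpa using ((hasDerivAt_id (0 : ℝ)).smul_const b).const_add ρ
  have h3 : HasFDerivAt (fun ρ => (D.τ (star a * D.KCLM ρ a)).re)
      (fderiv ℝ (fun ρ => (D.τ (star a * D.KCLM ρ a)).re) ρ) (ρ + (0 : ℝ) • b) := by
    rw [zero_smul, add_zero]
    exact (D.differentiableAt_energy hρ a).hasFDerivAt
  exact (h3.comp_hasDerivAt 0 h2).deriv

variable {D}

/-- The derivative at `t = 0` of the gradient estimate. -/
theorem GradientEstimate.deriv_energy_ge {lam : ℝ} (hG : D.GradientEstimate lam) {ρ : A}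
    (hρ : ρ ∈ D.densityPos) {a : A} (ha : IsSelfAdjoint a) :
    2 * lam * D.energy ρ a + 2 * (D.τ (D.generator a * D.Kop ρ a)).re ≤
      fderiv ℝ (fun ρ => (D.τ (star a * D.KCLM ρ a)).re) ρ (D.generatorAdj ρ) := by
  set E : A → ℝ := fun ρ => (D.τ (star a * D.KCLM ρ a)).re with hE
  set d := fderiv ℝ E ρ (D.generatorAdj ρ) with hd
  have h1 : HasDerivAt (fun t : ℝ => Real.exp (-2 * lam * t) * E (D.semigroupAdj t ρ))
      (-2 * lam * E ρ + d) 0 := by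
    have e1 : HasDerivAt (fun t : ℝ => Real.exp (-2 * lam * t)) (-2 * lam) 0 := by
      simpa using ((hasDerivAt_id (0 : ℝ)).const_mul (-2 * lam)).exp
    have e2 : HasDerivAt (fun t : ℝ => D.semigroupAdj t ρ) (D.generatorAdj ρ) 0 := by
      have := D.hasDerivAt_semigroupAdj ρ 0
      rwa [semigroupAdj_zero] at this
    have e3 : HasFDerivAt E (fderiv ℝ E ρ) (D.semigroupAdj 0 ρ) := by
      rw [semigroupAdj_zero]
      exact (D.differentiableAt_energy hρ.1 a).hasFDerivAt
    have e4 := e1.mul (e3.comp_hasDerivAt 0 e2)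
    exact e4.congr_deriv (by simp [semigroupAdj_zero, hd])
  have h2 : HasDerivAt (fun t : ℝ => (D.τ (star (D.semigroup t a) *
      D.KCLM ρ (D.semigroup t a))).re) (2 * (D.τ (D.generator a * D.Kop ρ a)).re) 0 := by
    have e2 : HasDerivAt (fun t : ℝ => D.semigroup t a) (D.generator a) 0 := by
      have := D.hasDerivAt_semigroup a 0
      rwa [semigroup_zero] at this
    have e3 : HasDerivAt (fun t : ℝ => D.KCLM ρ (D.semigroup t a)) (D.KCLM ρ (D.generator a)) 0 :=
      ((D.KCLM ρ).restrictScalars ℝ).hasFDerivAt.comp_hasDerivAt 0 e2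
    have e4 := D.hasDerivAt_trace (e2.star.mul e3)
    have e5 := (Complex.reCLM.hasFDerivAt.comp_hasDerivAt 0 e4)
    refine e5.congr_deriv ?_
    simp only [semigroup_zero, Complex.reCLM_apply, map_add, D.KCLM_apply hρ.1, star_generator,
      ha.star_eq]
    have := D.trace_Kop_comm ρ a (D.generator a)
    rw [ha.star_eq, star_generator, ha.star_eq] at this
    linarith
  have h3 := nonneg_of_hasDerivAt (h1.sub h2)
    (by simp [semigroupAdj_zero, semigroup_zero, hE]) (fun t ht => by
      have := hG ρ hρ t ht a
      rw [energy_eq_trace, energy_eq_trace] at this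
      simp only [Pi.sub_apply, hE]
      rw [D.KCLM_apply hρ.1, D.KCLM_apply (D.semigroupAdj_mem_densityPos hρ ht).1]
      linarith)
  have h4 : E ρ = D.energy ρ a := by
    rw [energy_eq_trace, hE]; simp only [D.KCLM_apply hρ.1]
  rw [h4] at h3
  linarith

/-- The gradient estimate bounds the Hessian of the entropy: along a geodesic the second derivative
of the entropy is half the `t`-derivative at `0` of `‖∇a‖²_{P_t†ρ} - ‖∇P_t a‖²_ρ`. -/
theorem GradientEstimate.hessianBound {lam : ℝ} (hG : D.GradientEstimate lam) :
    D.HessianBound lam := by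
  rintro ρ a ⟨δ, hδ, h⟩
  have h0 : (0 : ℝ) ∈ Ioo (-δ) δ := ⟨by linarith, hδ⟩
  have hf : ∀ s ∈ Ioo (-δ) δ, HasDerivAt (fun s => D.entropy (ρ s))
      (-(D.τ (a s * D.generatorAdj (ρ s))).re) s := fun s hs => by
    obtain ⟨h1, h2, h3, -⟩ := h s hs
    have := D.hasDerivWithinAt_entropy (fun u hu => (h u hu).1) hs h3.hasDerivWithinAt
    rw [D.trace_logRatio_mul_Kop h1.1 h2.1] at this
    exact this.hasDerivAt (isOpen_Ioo.mem_nhds hs)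
  have hd : deriv (fun s => D.entropy (ρ s)) =ᶠ[𝓝 0]
      fun s => -(D.τ (a s * D.generatorAdj (ρ s))).re := by
    filter_upwards [isOpen_Ioo.mem_nhds h0] with s hs using (hf s hs).deriv
  rw [hd.deriv_eq]
  obtain ⟨h1, h2, h3, a', ha', hb⟩ := h 0 h0
  have hL : HasDerivAt (fun s => D.generatorAdj (ρ s)) (D.generatorAdj (D.Kop (ρ 0) (a 0))) 0 :=
    ((LinearMap.toContinuousLinearMap D.generatorAdj).restrictScalars
      ℝ).hasFDerivAt.comp_hasDerivAt 0 h3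
  have hg := (Complex.reCLM.hasFDerivAt.comp_hasDerivAt 0 (D.hasDerivAt_trace (ha'.mul hL))).neg
  have hg' : deriv (fun s => -(D.τ (a s * D.generatorAdj (ρ s))).re) 0 = _ := hg.deriv
  rw [hg']
  have hbs : D.generatorAdj (ρ 0) ∈ D.tangent :=
    ⟨by rw [IsSelfAdjoint, star_generatorAdj, h1.1.1.star_eq], ⟨_, rfl⟩⟩
  -- The second geodesic equation, tested in the direction of the tangent vector `L† ρ`.
  have e1 := hb _ hbs
  rw [D.deriv_energy_add_smul h1.1 hbs.1] at e1
  have e2 := hG.deriv_energy_ge h1 h2.1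
  rw [Complex.reCLM_apply, map_add, Complex.add_re, e1, trace_mul_generatorAdj]
  linarith

end DifferentialStructure

/-! ### Smooth time changes with vanishing end velocities -/

section Flatten

/-- A smooth bump function, equal to `1` on `[η, 1 - η]` and to `0` outside `(0, 1)`. -/
noncomputable def flatBump (η x : ℝ) : ℝ :=
  Real.smoothTransition (x / η) * Real.smoothTransition ((1 - x) / η)

theorem contDiff_flatBump (η : ℝ) : ContDiff ℝ ((⊤ : ℕ∞) : WithTop ℕ∞) (flatBump η) :=
  (Real.smoothTransition.contDiff.comp (contDiff_id.div_const η)).mul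
    (Real.smoothTransition.contDiff.comp ((contDiff_const.sub contDiff_id).div_const η))

theorem flatBump_nonneg (η x : ℝ) : 0 ≤ flatBump η x :=
  mul_nonneg (Real.smoothTransition.nonneg _) (Real.smoothTransition.nonneg _)

theorem flatBump_le_one (η x : ℝ) : flatBump η x ≤ 1 :=
  mul_le_one₀ (Real.smoothTransition.le_one _) (Real.smoothTransition.nonneg _)
    (Real.smoothTransition.le_one _)

theorem flatBump_of_nonpos {η x : ℝ} (hη : 0 < η) (hx : x ≤ 0) : flatBump η x = 0 := by
  rw [flatBump, Real.smoothTransition.zero_of_nonpos (div_nonpos_of_nonpos_of_nonneg hx hη.le),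
    zero_mul]

theorem flatBump_of_one_le {η x : ℝ} (hη : 0 < η) (hx : 1 ≤ x) : flatBump η x = 0 := by
  rw [flatBump, Real.smoothTransition.zero_of_nonpos (x := (1 - x) / η)
    (div_nonpos_of_nonpos_of_nonneg (by linarith) hη.le), mul_zero]

theorem flatBump_eq_one {η x : ℝ} (hη : 0 < η) (h1 : η ≤ x) (h2 : x ≤ 1 - η) :
    flatBump η x = 1 := by
  rw [flatBump, Real.smoothTransition.one_of_one_le ((one_le_div hη).mpr h1),
    Real.smoothTransition.one_of_one_le ((one_le_div hη).mpr (by linarith)), mul_one]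

/-- There are smooth monotone maps onto `[0, 1]`, constant outside `[0, 1]`, whose derivative
exceeds `1` by as little as desired. -/
theorem exists_flatten {δ : ℝ} (hδ : 0 < δ) : ∃ χ χ' : ℝ → ℝ,
    ContDiff ℝ ((⊤ : ℕ∞) : WithTop ℕ∞) χ ∧ Continuous χ' ∧ (∀ x, HasDerivAt χ (χ' x) x) ∧
    (∀ x, 0 ≤ χ' x ∧ χ' x ≤ 1 + δ) ∧ (∀ x ≤ 0, χ x = 0 ∧ χ' x = 0) ∧
    (∀ x, 1 ≤ x → χ x = 1 ∧ χ' x = 0) ∧ ∀ x, χ x ∈ Icc (0 : ℝ) 1 := by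
  obtain ⟨η, hη, hη2, hη3⟩ : ∃ η : ℝ, 0 < η ∧ 2 * η < 1 ∧ 1 ≤ (1 + δ) * (1 - 2 * η) := by
    -- This `η` gives `(1 + δ) (1 - 2 η) = 1 + δ / 2`.
    refine ⟨δ / (4 * (1 + δ)), by positivity, ?_, ?_⟩
    · rw [mul_div_assoc', div_lt_one (by positivity)]; linarith
    · have : (1 + δ) * (1 - 2 * (δ / (4 * (1 + δ)))) = 1 + δ / 2 := by field_simp; ring
      linarith
  have hc : Continuous (flatBump η) := (contDiff_flatBump η).continuous
  have hi : ∀ a b, IntervalIntegrable (flatBump η) MeasureTheory.volume a b :=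
    fun a b => hc.intervalIntegrable a b
  set I := ∫ x in (0 : ℝ)..1, flatBump η x with hI
  have hIge : 1 - 2 * η ≤ I := by
    have h1 := intervalIntegral.integral_mono_interval (c := 0) (d := 1) hη.le
      (show η ≤ 1 - η by linarith) (by linarith)
      (Eventually.of_forall (flatBump_nonneg η)) (hi 0 1)
    have h2 : ∫ x in η..(1 - η), flatBump η x = ∫ _ in η..(1 - η), (1 : ℝ) := by
      refine intervalIntegral.integral_congr fun x hx => ?_
      rw [uIcc_of_le (by linarith)] at hx
      exact flatBump_eq_one hη hx.1 hx.2
    rw [h2, intervalIntegral.integral_const, smul_eq_mul, mul_one] at h1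
    linarith
  have hI0 : 0 < I := by linarith
  have hder : ∀ x, HasDerivAt (fun x => (∫ u in (0 : ℝ)..x, flatBump η u) / I)
      (flatBump η x / I) x := fun x => (hc.integral_hasStrictDerivAt 0 x).hasDerivAt.div_const I
  have hz : ∀ x ≤ 0, (∫ u in (0 : ℝ)..x, flatBump η u) = 0 := fun x hx => by
    refine (intervalIntegral.integral_congr (g := fun _ => 0) fun u hu => ?_).trans (by simp)
    rw [uIcc_of_ge hx] at hu
    exact flatBump_of_nonpos hη hu.2
  have ho : ∀ x, 1 ≤ x → (∫ u in (0 : ℝ)..x, flatBump η u) = I := fun x hx => by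
    rw [← intervalIntegral.integral_add_adjacent_intervals (hi 0 1) (hi 1 x)]
    have : (∫ u in (1 : ℝ)..x, flatBump η u) = 0 := by
      refine (intervalIntegral.integral_congr (g := fun _ => 0) fun u hu => ?_).trans (by simp)
      rw [uIcc_of_le hx] at hu
      exact flatBump_of_one_le hη hu.1
    rw [this, add_zero]
  have hmono : Monotone fun x => (∫ u in (0 : ℝ)..x, flatBump η u) / I :=
    monotone_of_hasDerivAt_nonneg hder fun x => div_nonneg (flatBump_nonneg η x) hI0.le
  refine ⟨_, _, ?_, hc.div_const I, hder, fun x => ⟨div_nonneg (flatBump_nonneg η x) hI0.le, ?_⟩,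
    fun x hx => ⟨?_, ?_⟩, fun x hx => ⟨?_, ?_⟩, fun x => ⟨?_, ?_⟩⟩
  · refine contDiff_infty_iff_deriv.mpr ⟨fun x => (hder x).differentiableAt, ?_⟩
    rw [funext fun x => (hder x).deriv]
    exact (contDiff_flatBump η).div_const I
  · rw [div_le_iff₀ hI0]
    have h1 := flatBump_le_one η x
    have h2 : (1 + δ) * (1 - 2 * η) ≤ (1 + δ) * I := by gcongr
    linarith
  · simp only [hz x hx, zero_div]
  · simp only [flatBump_of_nonpos hη hx, zero_div]
  · simp only [ho x hx, div_self hI0.ne']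
  · simp only [flatBump_of_one_le hη hx, zero_div]
  · rcases le_total x 0 with h | h
    · simp only [hz x h, zero_div, le_refl]
    · have := hmono h; simpa using this
  · rcases le_total 1 x with h | h
    · simp only [ho x h, div_self hI0.ne', le_refl]
    · have := hmono h
      simp only [ho 1 le_rfl, div_self hI0.ne'] at this
      exact this

end Flatten

namespace DifferentialStructure

variable {A : Type*} [CStarAlgebra A] [FiniteDimensional ℂ A] {J : Type*} [Fintype J] {ι : Type*}
  {B : ι → Type*} [∀ k, CStarAlgebra (B k)] [∀ k, FiniteDimensional ℂ (B k)]
  (D : DifferentialStructure A J B)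

/-! ### The kinetic energy of smooth curves -/

/-- The squared length of the tangent vector `v` at `ρ` in the transport metric. -/
noncomputable def normSq (ρ v : A) : ℝ := (D.τ (v * D.Ksol ρ v)).re

/-- `ρ` is a smooth curve of positive definite density matrices on `[0, 1]` with velocity `v`. -/
def IsCurve (ρ v : ℝ → A) : Prop :=
  ContDiffOn ℝ ((⊤ : ℕ∞) : WithTop ℕ∞) ρ (Icc 0 1) ∧
  ∀ t ∈ Icc (0 : ℝ) 1, ρ t ∈ D.densityPos ∧ HasDerivWithinAt ρ (v t) (Icc 0 1) t

theorem normSq_smul (ρ v : A) (c : ℝ) : D.normSq ρ (c • v) = c ^ 2 * D.normSq ρ v := by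
  unfold normSq
  rw [← Complex.coe_smul, map_smul, smul_mul_smul_comm, map_smul, smul_eq_mul,
    ← Complex.ofReal_mul, Complex.re_ofReal_mul, sq]

variable {D}

theorem IsErgodic.energy_Ksol (hD : D.IsErgodic) {ρ : A} (hρ : IsPosDef ρ) {v : A}
    (hv : IsSelfAdjoint v) (hv0 : D.τ v = 0) : D.energy ρ (D.Ksol ρ v) = D.normSq ρ v := by
  have h := hD.Ksol_spec hρ hv hv0
  rw [energy_eq_trace, h.2, h.1.1.star_eq, D.τ.tracial]
  rfl

theorem IsErgodic.normSq_nonneg (hD : D.IsErgodic) {ρ : A} (hρ : IsPosDef ρ) {v : A}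
    (hv : IsSelfAdjoint v) (hv0 : D.τ v = 0) : 0 ≤ D.normSq ρ v := by
  rw [← hD.energy_Ksol hρ hv hv0]
  exact D.energy_nonneg hρ _

theorem IsErgodic.Ksol_Kop (hD : D.IsErgodic) {ρ : A} (hρ : IsPosDef ρ) {a : A}
    (ha : a ∈ D.tangent) : D.Ksol ρ (D.Kop ρ a) = a := by
  have ha' := hD.mem_tangent_iff.mp ha
  have hsa : IsSelfAdjoint (D.Kop ρ a) := by
    rw [IsSelfAdjoint, D.star_Kop hρ.1, ha.1.star_eq]
  have h := hD.Ksol_spec hρ hsa (D.trace_Kop_eq_zero ρ a)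
  refine sub_eq_zero.mp (hD.Kop_injective hρ ?_ ?_)
  · rw [Kop_sub, h.2, sub_self]
  · rw [map_sub, (hD.mem_tangent_iff.mp h.1).2, ha'.2, sub_self]

theorem IsErgodic.normSq_Kop (hD : D.IsErgodic) {ρ : A} (hρ : IsPosDef ρ) {a : A}
    (ha : a ∈ D.tangent) : D.normSq ρ (D.Kop ρ a) = D.energy ρ a := by
  unfold normSq
  rw [hD.Ksol_Kop hρ ha, energy_eq_trace, ha.1.star_eq, D.τ.tracial]

/-- The norm of a tangent vector is dual to the norm of a gradient. -/
theorem IsErgodic.two_trace_le (hD : D.IsErgodic) {ρ : A} (hρ : IsPosDef ρ) {v : A}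
    (hv : IsSelfAdjoint v) (hv0 : D.τ v = 0) {a : A} (ha : IsSelfAdjoint a) :
    2 * (D.τ (a * v)).re ≤ D.energy ρ a + D.normSq ρ v := by
  have h := D.two_trace_Kop_le hρ a (D.Ksol ρ v) one_pos
  rw [hD.energy_Ksol hρ hv hv0, (hD.Ksol_spec hρ hv hv0).2, ha.star_eq] at h
  simpa using h

theorem IsErgodic.normSq_le_of_forall (hD : D.IsErgodic) {ρ : A} (hρ : IsPosDef ρ) {v : A}
    (hv : IsSelfAdjoint v) (hv0 : D.τ v = 0) {C : ℝ}
    (h : ∀ a : A, IsSelfAdjoint a → 2 * (D.τ (a * v)).re ≤ D.energy ρ a + C) :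
    D.normSq ρ v ≤ C := by
  have h1 := h _ (hD.Ksol_spec hρ hv hv0).1.1
  rw [hD.energy_Ksol hρ hv hv0, D.τ.tracial] at h1
  change 2 * D.normSq ρ v ≤ _ at h1
  linarith

theorem IsErgodic.isCurve_velocity (hD : D.IsErgodic) {ρ v : ℝ → A} (h : D.IsCurve ρ v) {t : ℝ}
    (ht : t ∈ Icc (0 : ℝ) 1) : IsSelfAdjoint (v t) ∧ D.τ (v t) = 0 :=
  have := (hD.isAdmissible h.1 (fun t ht => (h.2 t ht).1) (fun t ht => (h.2 t ht).2)).2 t ht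
  ⟨this.1, this.2.1⟩

theorem IsErgodic.normSq_nonneg_of_isCurve (hD : D.IsErgodic) {ρ v : ℝ → A} (h : D.IsCurve ρ v)
    {t : ℝ} (ht : t ∈ Icc (0 : ℝ) 1) : 0 ≤ D.normSq (ρ t) (v t) :=
  hD.normSq_nonneg (h.2 t ht).1.1 (hD.isCurve_velocity h ht).1 (hD.isCurve_velocity h ht).2

theorem IsErgodic.energy_isCurve (hD : D.IsErgodic) {ρ v : ℝ → A} (h : D.IsCurve ρ v) {t : ℝ}
    (ht : t ∈ Icc (0 : ℝ) 1) :
    D.energy (ρ t) (D.Ksol (ρ t) (v t)) = D.normSq (ρ t) (v t) :=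
  hD.energy_Ksol (h.2 t ht).1.1 (hD.isCurve_velocity h ht).1 (hD.isCurve_velocity h ht).2

theorem IsErgodic.continuousOn_normSq (hD : D.IsErgodic) {ρ v : ℝ → A} (h : D.IsCurve ρ v) :
    ContinuousOn (fun t => D.normSq (ρ t) (v t)) (Icc 0 1) :=
  ((hD.isAdmissible h.1 (fun t ht => (h.2 t ht).1) fun t ht =>
    (h.2 t ht).2).1.continuousOn_energy).congr fun _ ht => (hD.energy_isCurve h ht).symm

theorem IsAdmissible.isCurve {ρ₀ ρ₁ : A} {ρ a : ℝ → A} (h : D.IsAdmissible ρ₀ ρ₁ ρ a) :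
    D.IsCurve ρ (fun t => D.Kop (ρ t) (a t)) :=
  ⟨h.1, fun t ht => ⟨(h.2.2.2.2 t ht).1, (h.2.2.2.2 t ht).2.2⟩⟩

theorem distPos_nonneg (D : DifferentialStructure A J B) (ρ₀ ρ₁ : A) : 0 ≤ D.distPos ρ₀ ρ₁ :=
  Real.sqrt_nonneg _

theorem integral_energy_nonneg {ρ₀ ρ₁ : A} {ρ a : ℝ → A} (h : D.IsAdmissible ρ₀ ρ₁ ρ a) :
    0 ≤ ∫ t in (0 : ℝ)..1, D.energy (ρ t) (a t) :=
  intervalIntegral.integral_nonneg zero_le_one fun t ht =>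
    D.energy_nonneg (h.2.2.2.2 t ht).1.1 _

theorem distPos_sq (D : DifferentialStructure A J B) (ρ₀ ρ₁ : A) : D.distPos ρ₀ ρ₁ ^ 2 =
    sInf {c : ℝ | ∃ ρ a : ℝ → A, D.IsAdmissible ρ₀ ρ₁ ρ a ∧
      c = ∫ t in (0 : ℝ)..1, D.energy (ρ t) (a t)} := by
  unfold distPos
  refine Real.sq_sqrt (Real.sInf_nonneg ?_)
  rintro c ⟨ρ, a, h, rfl⟩
  exact integral_energy_nonneg h

theorem IsErgodic.distPos_sq_le (hD : D.IsErgodic) {ρ v : ℝ → A} (h : D.IsCurve ρ v) :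
    D.distPos (ρ 0) (ρ 1) ^ 2 ≤ ∫ t in (0 : ℝ)..1, D.normSq (ρ t) (v t) := by
  rw [distPos_sq]
  refine csInf_le ⟨0, ?_⟩ ⟨ρ, _, (hD.isAdmissible h.1 (fun t ht => (h.2 t ht).1)
    (fun t ht => (h.2 t ht).2)).1, ?_⟩
  · rintro c ⟨ρ, a, h, rfl⟩
    exact integral_energy_nonneg h
  · refine intervalIntegral.integral_congr fun t ht => ?_
    rw [uIcc_of_le zero_le_one] at ht
    exact (hD.energy_isCurve h ht).symm

/-- The lower bound `ρ ≥ ε`, tested with the trace. -/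
def GeTrace (D : DifferentialStructure A J B) (ε : ℝ) (ρ : A) : Prop :=
  IsSelfAdjoint ρ ∧ ∀ c : A, ε * (D.τ (star c * c)).re ≤ (D.τ (star c * c * ρ)).re

theorem GeTrace.convexCombo {ε δ s : ℝ} {ρ ν : A} (hρ : D.GeTrace ε ρ) (hν : D.GeTrace δ ν)
    (hs : s ∈ Icc (0 : ℝ) 1) :
    D.GeTrace ((1 - s) * ε + s * δ) ((1 - s) • ρ + s • ν) := by
  refine ⟨(IsSelfAdjoint.smul (star_trivial _) hρ.1).add
    (IsSelfAdjoint.smul (star_trivial _) hν.1), fun c => ?_⟩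
  have h1 := mul_le_mul_of_nonneg_left (hρ.2 c) (sub_nonneg.mpr hs.2)
  have h2 := mul_le_mul_of_nonneg_left (hν.2 c) hs.1
  rw [mul_add, mul_smul_comm, mul_smul_comm, map_add, ← Complex.coe_smul, ← Complex.coe_smul,
    map_smul, map_smul, smul_eq_mul, smul_eq_mul, Complex.add_re, Complex.re_ofReal_mul,
    Complex.re_ofReal_mul]
  linarith

theorem GeTrace.isPosDef {ε : ℝ} {ρ : A} (hρ : D.GeTrace ε ρ) (hε : 0 < ε) : IsPosDef ρ :=
  (IsPosDef.of_trace_ge D.τ hρ.1 hε hρ.2).1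

theorem trace_convexCombo {s : ℝ} {ρ ν : A} (hρ : D.τ ρ = 1) (hν : D.τ ν = 1) :
    D.τ ((1 - s) • ρ + s • ν) = 1 := by
  rw [map_add, ← Complex.coe_smul, ← Complex.coe_smul, map_smul, map_smul, hρ, hν, smul_eq_mul,
    smul_eq_mul]
  push_cast
  ring

theorem exists_geTrace {ρ : A} (hρ : IsPosDef ρ) : ∃ ε > 0, D.GeTrace ε ρ := by
  obtain ⟨ε, hε, h⟩ := hρ.exists_lower
  exact ⟨ε, hε, hρ.1, D.τ.ge_of_spectrum_ge hρ.1 h⟩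

theorem IsPosSemidef.geTrace {ρ : A} (hρ : IsPosSemidef ρ) : D.GeTrace 0 ρ :=
  ⟨hρ.1, fun c => by rw [zero_mul]; exact D.τ.nonneg_mul hρ c⟩

theorem convexCombo_mem_densityPos {ρ ν : A} (hρ : ρ ∈ D.densityPos) (hν : ν ∈ D.densityPos)
    {s : ℝ} (hs : s ∈ Icc (0 : ℝ) 1) : (1 - s) • ρ + s • ν ∈ D.densityPos := by
  obtain ⟨ε, hε, h1⟩ := exists_geTrace (D := D) hρ.1
  obtain ⟨δ, hδ, h2⟩ := exists_geTrace (D := D) hν.1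
  refine ⟨(h1.convexCombo h2 hs).isPosDef ?_, trace_convexCombo hρ.2 hν.2⟩
  rcases hs.1.eq_or_lt with h | h
  · rw [← h]; simpa using hε
  · have := mul_pos h hδ
    have := mul_nonneg (sub_nonneg.mpr hs.2) hε.le
    linarith

theorem isCurve_segment {ρ ν : A} (hρ : ρ ∈ D.densityPos) (hν : ν ∈ D.densityPos) :
    D.IsCurve (fun s => (1 - s) • ρ + s • ν) (fun _ => ν - ρ) := by
  refine ⟨?_, fun t ht => ⟨convexCombo_mem_densityPos hρ hν ht, ?_⟩⟩
  · exact (((contDiff_const.sub contDiff_id).smul contDiff_const).add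
      (contDiff_id.smul contDiff_const)).contDiffOn
  · have h1 : HasDerivAt (fun s : ℝ => (1 - s) • ρ + s • ν) ((-1 : ℝ) • ρ + (1 : ℝ) • ν) t :=
      (((hasDerivAt_id t).const_sub 1).smul_const ρ).add ((hasDerivAt_id t).smul_const ν)
    refine h1.hasDerivWithinAt.congr_deriv ?_
    rw [neg_one_smul, one_smul, neg_add_eq_sub]

theorem IsErgodic.exists_curve_lt (hD : D.IsErgodic) {ρ₀ ρ₁ : A} (h₀ : ρ₀ ∈ D.densityPos)
    (h₁ : ρ₁ ∈ D.densityPos) {c : ℝ} (hc : D.distPos ρ₀ ρ₁ ^ 2 < c) :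
    ∃ ρ v : ℝ → A, D.IsCurve ρ v ∧ ρ 0 = ρ₀ ∧ ρ 1 = ρ₁ ∧
      ∫ t in (0 : ℝ)..1, D.normSq (ρ t) (v t) < c := by
  rw [distPos_sq] at hc
  have hcur := isCurve_segment h₀ h₁
  have hadm := (hD.isAdmissible hcur.1 (fun t ht => (hcur.2 t ht).1)
    (fun t ht => (hcur.2 t ht).2)).1
  simp only [sub_zero, one_smul, zero_smul, add_zero, sub_self, zero_add] at hadm
  have hne : {c : ℝ | ∃ ρ a : ℝ → A, D.IsAdmissible ρ₀ ρ₁ ρ a ∧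
      c = ∫ t in (0 : ℝ)..1, D.energy (ρ t) (a t)}.Nonempty := ⟨_, _, _, hadm, rfl⟩
  obtain ⟨_, ⟨ρ, a, h, rfl⟩, hlt⟩ := exists_lt_of_csInf_lt hne hc
  refine ⟨ρ, _, h.isCurve, h.2.2.1, h.2.2.2.1, lt_of_eq_of_lt ?_ hlt⟩
  refine intervalIntegral.integral_congr fun t ht => ?_
  rw [uIcc_of_le zero_le_one] at ht
  exact hD.normSq_Kop (h.2.2.2.2 t ht).1.1 (h.2.2.2.2 t ht).2.1

/-- A smooth time change of a curve. -/
theorem IsCurve.comp {ρ v : ℝ → A} (h : D.IsCurve ρ v) {φ φ' : ℝ → ℝ}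
    (hφ : ContDiff ℝ ((⊤ : ℕ∞) : WithTop ℕ∞) φ) (hφ' : ∀ t, HasDerivAt φ (φ' t) t)
    (hm : MapsTo φ (Icc 0 1) (Icc 0 1)) :
    D.IsCurve (fun t => ρ (φ t)) (fun t => φ' t • v (φ t)) :=
  ⟨h.1.comp hφ.contDiffOn hm, fun t ht => ⟨(h.2 _ (hm ht)).1,
    (h.2 _ (hm ht)).2.scomp t (hφ' t).hasDerivWithinAt hm⟩⟩

theorem IsErgodic.distPos_sq_le_comp (hD : D.IsErgodic) {ρ v : ℝ → A} (h : D.IsCurve ρ v)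
    {φ φ' : ℝ → ℝ} (hφ : ContDiff ℝ ((⊤ : ℕ∞) : WithTop ℕ∞) φ)
    (hφ' : ∀ t, HasDerivAt φ (φ' t) t) (hm : MapsTo φ (Icc 0 1) (Icc 0 1)) :
    D.distPos (ρ (φ 0)) (ρ (φ 1)) ^ 2 ≤
      ∫ t in (0 : ℝ)..1, φ' t ^ 2 * D.normSq (ρ (φ t)) (v (φ t)) := by
  have := hD.distPos_sq_le (h.comp hφ hφ' hm)
  simpa only [normSq_smul] using this

/-- Restriction of a curve to a subinterval. -/
theorem IsErgodic.distPos_sq_le_sub (hD : D.IsErgodic) {ρ v : ℝ → A} (h : D.IsCurve ρ v)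
    {s t : ℝ} (hs : s ∈ Icc (0 : ℝ) 1) (ht : t ∈ Icc (0 : ℝ) 1) :
    D.distPos (ρ s) (ρ t) ^ 2 ≤ (t - s) * ∫ u in s..t, D.normSq (ρ u) (v u) := by
  have hd : ∀ u, HasDerivAt (fun u : ℝ => (t - s) * u + s) (t - s) u := fun u => by
    simpa using ((hasDerivAt_id u).const_mul (t - s)).add_const s
  have := hD.distPos_sq_le_comp h (φ := fun u => (t - s) * u + s) (φ' := fun _ => t - s)
    ((contDiff_const.mul contDiff_id).add contDiff_const) hd
    (fun u hu => ⟨by nlinarith [hu.1, hu.2, hs.1, ht.1], by nlinarith [hu.1, hu.2, hs.2, ht.2]⟩)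
  simp only [mul_zero, zero_add, mul_one, sub_add_cancel] at this
  refine this.trans_eq ?_
  rw [intervalIntegral.integral_const_mul]
  have h2 := intervalIntegral.smul_integral_comp_mul_add (a := 0) (b := 1)
    (fun u => D.normSq (ρ u) (v u)) (t - s) s
  simp only [mul_zero, zero_add, mul_one, sub_add_cancel, smul_eq_mul] at h2
  rw [← h2]
  ring

theorem IsErgodic.distPos_comm_le (hD : D.IsErgodic) {ρ₀ ρ₁ : A} (h₀ : ρ₀ ∈ D.densityPos)
    (h₁ : ρ₁ ∈ D.densityPos) : D.distPos ρ₁ ρ₀ ≤ D.distPos ρ₀ ρ₁ := by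
  refine (sq_le_sq₀ (D.distPos_nonneg _ _) (D.distPos_nonneg _ _)).mp
    (le_of_forall_gt_imp_ge_of_dense fun c hc => ?_)
  obtain ⟨ρ, v, h, rfl, rfl, hlt⟩ := hD.exists_curve_lt h₀ h₁ hc
  have := hD.distPos_sq_le_sub h (s := 1) (t := 0) (by simp) (by simp)
  rw [intervalIntegral.integral_symm] at this
  linarith

theorem IsErgodic.distPos_comm (hD : D.IsErgodic) {ρ₀ ρ₁ : A} (h₀ : ρ₀ ∈ D.densityPos)
    (h₁ : ρ₁ ∈ D.densityPos) : D.distPos ρ₀ ρ₁ = D.distPos ρ₁ ρ₀ :=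
  le_antisymm (hD.distPos_comm_le h₁ h₀) (hD.distPos_comm_le h₀ h₁)

end DifferentialStructure

/-! ### Triangle inequality and continuity of the distance -/

section Scalar

/-- A time change with derivative at most `1 + δ` increases the kinetic energy by at most this
factor. -/
theorem integral_flatten_le {χ χ' e : ℝ → ℝ} {δ : ℝ} (hχ' : Continuous χ')
    (hd : ∀ x, HasDerivAt χ (χ' x) x) (hb : ∀ x, 0 ≤ χ' x ∧ χ' x ≤ 1 + δ) (h0 : χ 0 = 0)
    (h1 : χ 1 = 1) (hm : ∀ x, χ x ∈ Icc (0 : ℝ) 1) (he : ContinuousOn e (Icc 0 1))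
    (hpos : ∀ t ∈ Icc (0 : ℝ) 1, 0 ≤ e t) :
    ∫ u in (0 : ℝ)..1, χ' u ^ 2 * e (χ u) ≤ (1 + δ) * ∫ u in (0 : ℝ)..1, e u := by
  have hχ : Continuous χ := continuous_iff_continuousAt.mpr fun x => (hd x).continuousAt
  have hec : Continuous fun u => e (χ u) := he.comp_continuous hχ hm
  have e1 : ∫ u in (0 : ℝ)..1, e u = ∫ u in (0 : ℝ)..1, e (χ u) * χ' u := by
    have := intervalIntegral.integral_comp_mul_deriv'' (a := 0) (b := 1) (f := χ) (f' := χ')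
      (g := e) hχ.continuousOn (fun x _ => (hd x).hasDerivWithinAt) hχ'.continuousOn
      (he.mono (by rintro _ ⟨x, -, rfl⟩; exact hm x))
    rw [h0, h1] at this
    exact this.symm
  rw [e1, ← intervalIntegral.integral_const_mul]
  refine intervalIntegral.integral_mono_on zero_le_one
    (((hχ'.pow 2).mul hec).intervalIntegrable _ _)
    ((continuous_const.mul (hec.mul hχ')).intervalIntegrable _ _) fun u _ => ?_
  have h2 := mul_le_mul_of_nonneg_right (hb u).2 (mul_nonneg (hpos _ (hm u)) (hb u).1)
  nlinarith

/-- An affine time change with speed `c` multiplies the kinetic energy by `c`. -/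
theorem integral_comp_affine (f : ℝ → ℝ) {c d a b : ℝ} (ha : c * a + d = 0) (hb : c * b + d = 1) :
    ∫ s in a..b, c ^ 2 * f (c * s + d) = c * ∫ u in (0 : ℝ)..1, f u := by
  have := intervalIntegral.smul_integral_comp_mul_add (a := a) (b := b) f c d
  rw [ha, hb, smul_eq_mul] at this
  rw [intervalIntegral.integral_const_mul, ← this]
  ring

/-- The logarithmic mean is monotone and homogeneous. -/
theorem mul_logMean_le {p q ε x y : ℝ} (hp : 0 < p) (hq : 0 < q) (hε : 0 < ε) (hx : ε ≤ x)
    (hy : ε ≤ y) : ε * logMean p q ≤ logMean (p * x) (q * y) := by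
  have hx0 := hε.trans_le hx
  have hy0 := hε.trans_le hy
  have hL := logMean_pos (mul_pos hp hx0) (mul_pos hq hy0)
  have hL' := logMean_pos hp hq
  have key : (logMean (p * x) (q * y))⁻¹ ≤ ε⁻¹ * (logMean p q)⁻¹ := by
    rw [← integral_inv_meanAt (mul_pos hp hx0) (mul_pos hq hy0), ← integral_inv_meanAt hp hq,
      ← intervalIntegral.integral_const_mul]
    refine intervalIntegral.integral_mono_on zero_le_one
      ((continuous_inv_meanAt (mul_pos hp hx0) (mul_pos hq hy0)).intervalIntegrable _ _)
      ((continuous_const.mul (continuous_inv_meanAt hp hq)).intervalIntegrable _ _) fun u _ => ?_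
    have hc0 := Real.smoothTransition.nonneg u
    have hc1 := sub_nonneg.mpr (Real.smoothTransition.le_one u)
    have hpos : 0 < meanAt u p q := convexCombo_pos hp hq ⟨hc0, Real.smoothTransition.le_one u⟩
    have hle : ε * meanAt u p q ≤ meanAt u (p * x) (q * y) := by
      unfold meanAt
      have h1 := mul_le_mul_of_nonneg_left hx (mul_nonneg hc0 hp.le)
      have h2 := mul_le_mul_of_nonneg_left hy (mul_nonneg hc1 hq.le)
      nlinarith
    calc transitionDensity u * (meanAt u (p * x) (q * y))⁻¹
        ≤ transitionDensity u * (ε * meanAt u p q)⁻¹ := by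
          have := transitionDensity_nonneg u
          gcongr
      _ = ε⁻¹ * (transitionDensity u * (meanAt u p q)⁻¹) := by rw [mul_inv]; ring
  rw [← mul_inv] at key
  exact (inv_le_inv₀ hL (mul_pos hε hL')).mp key

end Scalar

namespace DifferentialStructure

variable {A : Type*} [CStarAlgebra A] [FiniteDimensional ℂ A] {J : Type*} [Fintype J] {ι : Type*}
  {B : ι → Type*} [∀ k, CStarAlgebra (B k)] [∀ k, FiniteDimensional ℂ (B k)]
  {D : DifferentialStructure A J B}

/-- Two curves are joined by adding them, after time changes that are constant near the junction:
at every time one of the two summands is at rest in the junction point. -/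
theorem IsErgodic.distPos_sq_le_concat_aux (hD : D.IsErgodic) {ρ v ν w : ℝ → A}
    (h : D.IsCurve ρ v) (h' : D.IsCurve ν w) (hj : ρ 1 = ν 0) {α : ℝ} (hα : α ∈ Ioo (0 : ℝ) 1)
    {δ : ℝ} (hδ : 0 < δ) : D.distPos (ρ 0) (ν 1) ^ 2 ≤ (1 + δ) *
      (α⁻¹ * (∫ t in (0 : ℝ)..1, D.normSq (ρ t) (v t)) +
        (1 - α)⁻¹ * ∫ t in (0 : ℝ)..1, D.normSq (ν t) (w t)) := by
  obtain ⟨χ, χ', hχs, hχ'c, hd, hb, hz, ho, hm⟩ := exists_flatten hδ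
  have hα0 := hα.1
  have hα1 : 0 < 1 - α := sub_pos.mpr hα.2
  set c := α⁻¹ with hc
  set k := (1 - α)⁻¹ with hk
  have hcα : c * α = 1 := inv_mul_cancel₀ hα0.ne'
  have hkα : k * (1 - α) = 1 := inv_mul_cancel₀ hα1.ne'
  have hcpos : 0 < c := inv_pos.mpr hα0
  have hkpos : 0 < k := inv_pos.mpr hα1
  have hcomp : ∀ c d : ℝ, ContDiff ℝ ((⊤ : ℕ∞) : WithTop ℕ∞) (fun s => χ (c * s + d)) ∧
      ∀ s, HasDerivAt (fun s => χ (c * s + d)) (c * χ' (c * s + d)) s := fun c d => by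
    refine ⟨hχs.comp ((contDiff_const.mul contDiff_id).add contDiff_const), fun s => ?_⟩
    have h1 : HasDerivAt (fun s => c * s + d) c s := by
      simpa using ((hasDerivAt_id s).const_mul c).add_const d
    have := (hd (c * s + d)).comp s h1
    rwa [mul_comm] at this
  have hc1 := h.comp (hcomp c 0).1 (hcomp c 0).2 (fun s _ => hm _)
  have hc2 := h'.comp (hcomp k (-(k * α))).1 (hcomp k (-(k * α))).2 (fun s _ => hm _)
  have hlow : ∀ s ≤ α, k * s + -(k * α) ≤ 0 := fun s hs => by nlinarith
  have hhigh : ∀ s, α ≤ s → 1 ≤ c * s + 0 := fun s hs => by nlinarith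
  -- The first summand has reached the junction point `ν 0` after time `α`, the second has not left
  -- it before that time.
  set γ : ℝ → A := fun s => ρ (χ (c * s + 0)) + ν (χ (k * s + -(k * α))) - ν 0 with hγ
  set z : ℝ → A := fun s => (c * χ' (c * s + 0)) • v (χ (c * s + 0)) +
    (k * χ' (k * s + -(k * α))) • w (χ (k * s + -(k * α))) with hz'
  have hγlow : ∀ s ≤ α, γ s = ρ (χ (c * s + 0)) ∧
      z s = (c * χ' (c * s + 0)) • v (χ (c * s + 0)) := fun s hs => by
    simp [hγ, hz', (hz _ (hlow s hs)).1, (hz _ (hlow s hs)).2]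
  have hγhigh : ∀ s, α ≤ s → γ s = ν (χ (k * s + -(k * α))) ∧
      z s = (k * χ' (k * s + -(k * α))) • w (χ (k * s + -(k * α))) := fun s hs => by
    have h1 := ho _ (hhigh s hs)
    constructor
    · simp only [hγ, h1.1, hj]; abel
    · simp only [hz', h1.2]; simp
  have hcur : D.IsCurve γ z := by
    refine ⟨(hc1.1.add hc2.1).sub contDiffOn_const, fun t ht => ⟨?_, ?_⟩⟩
    · rcases le_total t α with hs | hs
      · rw [(hγlow t hs).1]; exact (hc1.2 t ht).1
      · rw [(hγhigh t hs).1]; exact (hc2.2 t ht).1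
    · exact ((hc1.2 t ht).2.add (hc2.2 t ht).2).sub_const _
  have hmain := hD.distPos_sq_le hcur
  have e0 : γ 0 = ρ 0 := by rw [(hγlow 0 hα0.le).1, (hz _ (by simp)).1]
  have e1 : γ 1 = ν 1 := by
    rw [(hγhigh 1 hα.2.le).1, (ho _ (by nlinarith)).1]
  rw [e0, e1] at hmain
  refine hmain.trans ?_
  have hcont := hD.continuousOn_normSq hcur
  have hαm : α ∈ Icc (0 : ℝ) 1 := ⟨hα0.le, hα.2.le⟩
  rw [← intervalIntegral.integral_add_adjacent_intervals
    ((hcont.mono (Icc_subset_Icc le_rfl hα.2.le)).intervalIntegrable_of_Icc hα0.le)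
    ((hcont.mono (Icc_subset_Icc hα0.le le_rfl)).intervalIntegrable_of_Icc hα.2.le), mul_add]
  refine add_le_add ?_ ?_
  · have e2 : ∫ s in (0 : ℝ)..α, D.normSq (γ s) (z s) = ∫ s in (0 : ℝ)..α,
        c ^ 2 * (fun u => χ' u ^ 2 * D.normSq (ρ (χ u)) (v (χ u))) (c * s + 0) := by
      refine intervalIntegral.integral_congr fun s hs => ?_
      rw [uIcc_of_le hα0.le] at hs
      simp only
      rw [(hγlow s hs.2).1, (hγlow s hs.2).2, normSq_smul]
      ring
    have e3 := integral_comp_affine (fun u => χ' u ^ 2 * D.normSq (ρ (χ u)) (v (χ u)))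
      (c := c) (d := 0) (a := 0) (b := α) (by ring) (by rw [hcα, add_zero])
    rw [e2, e3]
    have h3 := integral_flatten_le hχ'c hd hb (hz 0 le_rfl).1 (ho 1 le_rfl).1 hm
      (hD.continuousOn_normSq h) fun t ht => hD.normSq_nonneg_of_isCurve h ht
    have h4 := mul_le_mul_of_nonneg_left h3 hcpos.le
    linarith
  · have e2 : ∫ s in α..1, D.normSq (γ s) (z s) = ∫ s in α..1,
        k ^ 2 * (fun u => χ' u ^ 2 * D.normSq (ν (χ u)) (w (χ u))) (k * s + -(k * α)) := by
      refine intervalIntegral.integral_congr fun s hs => ?_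
      rw [uIcc_of_le hα.2.le] at hs
      simp only
      rw [(hγhigh s hs.1).1, (hγhigh s hs.1).2, normSq_smul]
      ring
    have e3 := integral_comp_affine (fun u => χ' u ^ 2 * D.normSq (ν (χ u)) (w (χ u)))
      (c := k) (d := -(k * α)) (a := α) (b := 1) (by ring) (by linarith)
    rw [e2, e3]
    have h3 := integral_flatten_le hχ'c hd hb (hz 0 le_rfl).1 (ho 1 le_rfl).1 hm
      (hD.continuousOn_normSq h') fun t ht => hD.normSq_nonneg_of_isCurve h' ht
    have h4 := mul_le_mul_of_nonneg_left h3 hkpos.le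
    linarith

theorem IsErgodic.distPos_sq_le_concat (hD : D.IsErgodic) {ρ v ν w : ℝ → A}
    (h : D.IsCurve ρ v) (h' : D.IsCurve ν w) (hj : ρ 1 = ν 0) {α : ℝ} (hα : α ∈ Ioo (0 : ℝ) 1) :
    D.distPos (ρ 0) (ν 1) ^ 2 ≤ α⁻¹ * (∫ t in (0 : ℝ)..1, D.normSq (ρ t) (v t)) +
        (1 - α)⁻¹ * ∫ t in (0 : ℝ)..1, D.normSq (ν t) (w t) := by
  set Y := α⁻¹ * (∫ t in (0 : ℝ)..1, D.normSq (ρ t) (v t)) +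
        (1 - α)⁻¹ * ∫ t in (0 : ℝ)..1, D.normSq (ν t) (w t) with hY
  have hlim : Tendsto (fun δ : ℝ => (1 + δ) * Y) (𝓝[>] 0) (𝓝 Y) := by
    have : Continuous fun δ : ℝ => (1 + δ) * Y := by fun_prop
    simpa using (this.tendsto 0).mono_left nhdsWithin_le_nhds
  exact ge_of_tendsto hlim (eventually_mem_nhdsWithin.mono fun δ hδ =>
    hD.distPos_sq_le_concat_aux h h' hj hα hδ)

theorem IsErgodic.distPos_triangle (hD : D.IsErgodic) {p q r : A} (hp : p ∈ D.densityPos)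
    (hq : q ∈ D.densityPos) (hr : r ∈ D.densityPos) :
    D.distPos p r ≤ D.distPos p q + D.distPos q r := by
  refine le_of_forall_pos_le_add fun η hη => ?_
  set x := D.distPos p q + η / 2 with hx
  set y := D.distPos q r + η / 2 with hy
  have hd1 := D.distPos_nonneg p q
  have hd2 := D.distPos_nonneg q r
  have hx0 : 0 < x := by positivity
  have hy0 : 0 < y := by positivity
  obtain ⟨ρ, v, h, rfl, h1, hlt⟩ := hD.exists_curve_lt hp hq (c := x ^ 2)
    (by rw [sq_lt_sq₀ hd1 hx0.le]; linarith)
  obtain ⟨ν, w, h', h2, rfl, hlt'⟩ := hD.exists_curve_lt hq hr (c := y ^ 2)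
    (by rw [sq_lt_sq₀ hd2 hy0.le]; linarith)
  -- The time split is proportional to the lengths, which minimises the kinetic energy.
  have hα : x / (x + y) ∈ Ioo (0 : ℝ) 1 :=
    ⟨by positivity, (div_lt_one (by positivity)).mpr (by linarith)⟩
  have hc := hD.distPos_sq_le_concat h h' (h1.trans h2.symm) hα
  have e1 : 1 - x / (x + y) = y / (x + y) := by field_simp; ring
  have h3 : D.distPos (ρ 0) (ν 1) ^ 2 ≤ (x + y) ^ 2 := by
    refine hc.trans ?_
    rw [e1]
    calc (x / (x + y))⁻¹ * (∫ t in (0 : ℝ)..1, D.normSq (ρ t) (v t)) +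
        (y / (x + y))⁻¹ * ∫ t in (0 : ℝ)..1, D.normSq (ν t) (w t)
        ≤ (x / (x + y))⁻¹ * x ^ 2 + (y / (x + y))⁻¹ * y ^ 2 := by gcongr
      _ = (x + y) ^ 2 := by field_simp
  have h4 := (sq_le_sq₀ (D.distPos_nonneg _ _) (by positivity)).mp h3
  linarith

/-! ### Comparison of the distance with the norm -/

theorem isPosDef_one : IsPosDef (1 : A) := by
  refine ⟨IsSelfAdjoint.one _, fun x hx => ?_⟩
  rcases subsingleton_or_nontrivial A with hs | hn
  · rw [spectrum.of_subsingleton] at hx; exact hx.elim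
  · rw [spectrum.one_eq, Set.mem_singleton_iff] at hx
    rw [hx]; exact one_pos

/-- A lower bound on `ρ` bounds the energy at `ρ` from below by the energy at `1`. -/
theorem mul_energy_one_le {ρ : A} {ε : ℝ} (hε : 0 < ε) (hρ : D.GeTrace ε ρ) (a : A) :
    ε * D.energy 1 a ≤ D.energy ρ a := by
  have hsp := (IsPosDef.of_trace_ge D.τ hρ.1 hε hρ.2).2
  have hpd := hρ.isPosDef hε
  rw [energy_eq, energy_eq, Finset.mul_sum]
  refine Finset.sum_le_sum fun j _ => ?_
  have hl1 : IsSelfAdjoint (D.l j (1 : A)) := (IsSelfAdjoint.one A).map _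
  have hr1 : IsSelfAdjoint (D.r j (1 : A)) := (IsSelfAdjoint.one A).map _
  have one_of_mem : ∀ x : ℝ, ∀ φ : A →⋆ₐ[ℂ] B (D.κ j), x ∈ spectrum ℝ (φ 1) → x = 1 :=
    fun x φ hx => by
      rw [map_one] at hx
      rcases subsingleton_or_nontrivial (B (D.κ j)) with hs | hn
      · rw [spectrum.of_subsingleton] at hx; exact hx.elim
      · rwa [spectrum.one_eq, Set.mem_singleton_iff] at hx
  have e1 : doubleSum (D.θ j) (D.l j (1 : A)) (D.r j (1 : A)) (D.partialD j a) =
      D.θ j 1 1 • D.partialD j a := by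
    rw [doubleSum_congr (η := fun _ _ => D.θ j 1 1) (fun x hx y hy => by
      rw [one_of_mem x _ hx, one_of_mem y _ hy]), doubleSum_const hl1 hr1]
  have e2 : D.θ j 1 1 • (ε • D.partialD j a) = ε • D.θ j 1 1 • D.partialD j a := by
    rw [smul_comm]
  have h1 := trace_doubleSum_mono (D.τB (D.κ j)) (R := D.l j ρ) (S := D.r j ρ)
    (θ := fun _ _ => ε * D.θ j 1 1) (η := D.θ j) (fun x hx y hy => by
      have := mul_logMean_le (p := Real.exp (D.ω j / 2)) (q := Real.exp (-D.ω j / 2))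
        (Real.exp_pos _) (Real.exp_pos _) hε (hsp x (spectrum_map_subset _ _ hx))
        (hsp y (spectrum_map_subset _ _ hy))
      simpa [θ] using this) (D.partialD j a)
  rw [doubleSum_const (D.isPosDef_l hpd j).1 (D.isPosDef_r hpd j).1] at h1
  rw [e1]
  refine le_trans (le_of_eq ?_) h1
  rw [mul_smul_comm, mul_smul_comm, ← Complex.coe_smul, ← Complex.coe_smul, map_smul, map_smul,
    smul_eq_mul, smul_eq_mul, Complex.re_ofReal_mul, Complex.re_ofReal_mul, mul_assoc]

/-- A lower bound on `ρ` bounds the metric at `ρ` from above by the metric at `1`. -/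
theorem IsErgodic.normSq_le_of_geTrace (hD : D.IsErgodic) {ρ : A} {ε : ℝ} (hε : 0 < ε)
    (hρ : D.GeTrace ε ρ) {v : A} (hv : IsSelfAdjoint v) (hv0 : D.τ v = 0) :
    D.normSq ρ v ≤ ε⁻¹ * D.normSq 1 v := by
  refine hD.normSq_le_of_forall (hρ.isPosDef hε) hv hv0 fun a ha => ?_
  have h1 := hD.two_trace_le (isPosDef_one (A := A)) hv hv0 (a := ε • a)
    (IsSelfAdjoint.smul (star_trivial _) ha)
  rw [smul_mul_assoc, ← Complex.coe_smul, ← Complex.coe_smul, map_smul, smul_eq_mul,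
    Complex.re_ofReal_mul, energy_smul] at h1
  have h2 := mul_energy_one_le hε hρ a
  have h3 := mul_le_mul_of_nonneg_left h1 (inv_pos.mpr hε).le
  have e1 : ε⁻¹ * (2 * (ε * (D.τ (a * v)).re)) = 2 * (D.τ (a * v)).re := by field_simp
  have e2 : ε⁻¹ * (ε ^ 2 * D.energy 1 a + D.normSq 1 v) =
      ε * D.energy 1 a + ε⁻¹ * D.normSq 1 v := by field_simp
  rw [e1, e2] at h3
  linarith

theorem exists_normSq_one_le (D : DifferentialStructure A J B) :
    ∃ M : ℝ, 0 < M ∧ ∀ v : A, D.normSq 1 v ≤ M * ‖v‖ ^ 2 := by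
  refine ⟨‖D.reτ‖ * ‖D.Ksol 1‖ + 1, by positivity, fun v => ?_⟩
  have h1 := (le_abs_self _).trans (D.reτ.le_opNorm (v * D.Ksol 1 v))
  have h2 := norm_mul_le v (D.Ksol 1 v)
  have h3 := (D.Ksol 1).le_opNorm v
  calc D.normSq 1 v ≤ ‖D.reτ‖ * ‖v * D.Ksol 1 v‖ := h1
    _ ≤ ‖D.reτ‖ * (‖v‖ * (‖D.Ksol 1‖ * ‖v‖)) := by gcongr; exact h2.trans (by gcongr)
    _ ≤ _ := by nlinarith [sq_nonneg ‖v‖]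

/-- The density matrices form a bounded set, as `ρ = b²` with `τ[b²] = 1`. -/
theorem exists_norm_le_of_mem_density (D : DifferentialStructure A J B) :
    ∃ R : ℝ, 0 < R ∧ ∀ ρ ∈ D.density, ‖ρ‖ ≤ R := by
  have hprop : ProperSpace A := FiniteDimensional.proper ℂ A
  have hcont : Continuous fun b : A => (D.τ (star b * b)).re :=
    Complex.continuous_re.comp (D.continuous_trace.comp (continuous_star.mul continuous_id))
  obtain ⟨c, hc, hlow⟩ : ∃ c > 0, ∀ b : A, ‖b‖ = 1 → c ≤ (D.τ (star b * b)).re := by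
    rcases (Metric.sphere (0 : A) 1).eq_empty_or_nonempty with h | h
    · refine ⟨1, one_pos, fun b hb => ?_⟩
      have : b ∈ Metric.sphere (0 : A) 1 := by simpa using hb
      rw [h] at this; exact this.elim
    · obtain ⟨b, hb, hmin⟩ := (isCompact_sphere (0 : A) 1).exists_isMinOn h hcont.continuousOn
      refine ⟨_, D.τ.inner_self_pos (a := b) ?_, fun b' hb' => hmin (by simpa using hb')⟩
      rintro rfl
      simp at hb
  have hall : ∀ b : A, c * ‖b‖ ^ 2 ≤ (D.τ (star b * b)).re := fun b => by
    rcases eq_or_ne b 0 with rfl | hb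
    · simp
    · have hb' : ‖b‖ ≠ 0 := norm_ne_zero_iff.mpr hb
      have h1 := hlow (((‖b‖⁻¹ : ℝ) : ℂ) • b) (by
        rw [norm_smul, Complex.norm_real, norm_inv, norm_norm, inv_mul_cancel₀ hb'])
      rw [star_smul, RCLike.star_def, Complex.conj_ofReal, smul_mul_smul_comm, map_smul,
        smul_eq_mul, ← Complex.ofReal_mul, Complex.re_ofReal_mul] at h1
      have h2 := mul_le_mul_of_nonneg_left h1 (sq_nonneg ‖b‖)
      have h3 : ‖b‖ ^ 2 * (‖b‖⁻¹ * ‖b‖⁻¹ * (D.τ (star b * b)).re) = (D.τ (star b * b)).re := by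
        field_simp
      rw [h3] at h2
      linarith
  refine ⟨c⁻¹, inv_pos.mpr hc, fun ρ hρ => ?_⟩
  obtain ⟨b, hb, rfl⟩ := hρ.1.exists_sqrt
  have h1 := hall b
  rw [hb.star_eq, hρ.2, Complex.one_re] at h1
  calc ‖b * b‖ ≤ ‖b‖ * ‖b‖ := norm_mul_le _ _
    _ = c⁻¹ * (c * ‖b‖ ^ 2) := by field_simp
    _ ≤ c⁻¹ * 1 := by gcongr
    _ = c⁻¹ := mul_one _

/-- The normalised identity, the density matrix of maximal entropy. -/
noncomputable def mixed (D : DifferentialStructure A J B) : A := ((D.τ 1).re)⁻¹ • (1 : A)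

theorem geTrace_mixed (D : DifferentialStructure A J B) :
    D.GeTrace ((D.τ 1).re)⁻¹ D.mixed := by
  refine ⟨IsSelfAdjoint.smul (star_trivial _) (IsSelfAdjoint.one A), fun c => ?_⟩
  rw [mixed, mul_smul_comm, mul_one, ← Complex.coe_smul, map_smul, smul_eq_mul,
    Complex.re_ofReal_mul]

theorem mixed_mem_densityPos (D : DifferentialStructure A J B) : D.mixed ∈ D.densityPos := by
  refine ⟨D.geTrace_mixed.isPosDef (inv_pos.mpr D.trace_one_re_pos), ?_⟩
  have h := D.trace_one_re_pos
  rw [mixed, ← Complex.coe_smul, map_smul, smul_eq_mul]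
  refine Complex.ext ?_ ?_
  · rw [Complex.re_ofReal_mul, inv_mul_cancel₀ h.ne', Complex.one_re]
  · rw [Complex.im_ofReal_mul, D.trace_one_im, mul_zero, Complex.one_im]

theorem geTrace_mix {ρ : A} (hρ : ρ ∈ D.density) {ε : ℝ} (hε : ε ∈ Icc (0 : ℝ) 1) :
    D.GeTrace (ε * ((D.τ 1).re)⁻¹) ((1 - ε) • ρ + ε • D.mixed) := by
  have := (IsPosSemidef.geTrace (D := D) hρ.1).convexCombo D.geTrace_mixed hε
  simpa using this

theorem mix_mem_densityPos {ρ : A} (hρ : ρ ∈ D.density) {ε : ℝ} (hε : ε ∈ Ioc (0 : ℝ) 1) :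
    (1 - ε) • ρ + ε • D.mixed ∈ D.densityPos :=
  ⟨(geTrace_mix hρ ⟨hε.1.le, hε.2⟩).isPosDef (mul_pos hε.1 (inv_pos.mpr D.trace_one_re_pos)),
    trace_convexCombo hρ.2 D.mixed_mem_densityPos.2⟩

theorem sub_isSelfAdjoint_trace {ρ ν : A} (hρ : ρ ∈ D.density) (hν : ν ∈ D.density) :
    IsSelfAdjoint (ν - ρ) ∧ D.τ (ν - ρ) = 0 :=
  ⟨hν.1.1.sub hρ.1.1, by rw [map_sub, hρ.2, hν.2, sub_self]⟩

/-- A density matrix is at distance `O(√ε)` from its mixture with the identity: the time change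
`u ↦ ε u²` keeps the kinetic energy bounded although the metric degenerates. -/
theorem IsErgodic.exists_distPos_mix_sq_le (hD : D.IsErgodic) : ∃ C : ℝ, 0 < C ∧
    ∀ ρ ∈ D.densityPos, ∀ ε ∈ Ioc (0 : ℝ) 1,
      D.distPos ρ ((1 - ε) • ρ + ε • D.mixed) ^ 2 ≤ C * ε := by
  obtain ⟨M, hM, hMv⟩ := D.exists_normSq_one_le
  obtain ⟨R, hR, hRρ⟩ := D.exists_norm_le_of_mem_density
  set κ := (D.τ 1).re with hκ
  have hκ0 : 0 < κ := D.trace_one_re_pos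
  refine ⟨4 * κ * (M * (R + R) ^ 2), by positivity, fun ρ hρ ε hε => ?_⟩
  have hρ' := D.densityPos_subset_density hρ
  have hm' := D.densityPos_subset_density D.mixed_mem_densityPos
  have hseg := isCurve_segment hρ D.mixed_mem_densityPos
  have hφ : ContDiff ℝ ((⊤ : ℕ∞) : WithTop ℕ∞) fun u : ℝ => ε * u ^ 2 :=
    contDiff_const.mul (contDiff_id.pow 2)
  have hφ' : ∀ u : ℝ, HasDerivAt (fun u : ℝ => ε * u ^ 2) (2 * ε * u) u := fun u => by
    refine ((hasDerivAt_pow 2 u).const_mul ε).congr_deriv ?_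
    push_cast
    ring
  have hmaps : MapsTo (fun u : ℝ => ε * u ^ 2) (Icc 0 1) (Icc 0 1) := fun u hu =>
    ⟨by have := hε.1; positivity, mul_le_one₀ hε.2 (sq_nonneg u) (pow_le_one₀ hu.1 hu.2)⟩
  have h := hD.distPos_sq_le_comp hseg hφ hφ' hmaps
  have hci := (hD.continuousOn_normSq (hseg.comp hφ hφ' hmaps))
  simp only [normSq_smul] at hci
  have hv := sub_isSelfAdjoint_trace hρ' hm'
  have hN : D.normSq 1 (D.mixed - ρ) ≤ M * (R + R) ^ 2 := by
    refine (hMv _).trans ?_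
    have : ‖D.mixed - ρ‖ ≤ R + R :=
      (norm_sub_le _ _).trans (add_le_add (hRρ _ hm') (hRρ _ hρ'))
    gcongr
  have hpt : ∀ u ∈ Icc (0 : ℝ) 1, (2 * ε * u) ^ 2 *
      D.normSq ((1 - ε * u ^ 2) • ρ + (ε * u ^ 2) • D.mixed) (D.mixed - ρ) ≤
        4 * κ * (M * (R + R) ^ 2) * ε := fun u hu => by
    rcases hu.1.eq_or_lt with h0 | h0
    · rw [← h0]
      have := hε.1
      simp only [mul_zero, ne_eq, OfNat.ofNat_ne_zero, not_false_eq_true, zero_pow, zero_mul]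
      positivity
    · have hεu : 0 < ε * u ^ 2 := mul_pos hε.1 (by positivity)
      have h1 := hD.normSq_le_of_geTrace (by positivity) (geTrace_mix hρ' (hmaps hu)) hv.1 hv.2
      have h2 := h1.trans (mul_le_mul_of_nonneg_left hN (by positivity))
      have hε0 := hε.1
      calc _ ≤ (2 * ε * u) ^ 2 * ((ε * u ^ 2 * κ⁻¹)⁻¹ * (M * (R + R) ^ 2)) := by gcongr
        _ = 4 * κ * (M * (R + R) ^ 2) * ε := by field_simp; ring
  have h3 := intervalIntegral.integral_mono_on zero_le_one
    (hci.intervalIntegrable_of_Icc zero_le_one)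
    (intervalIntegrable_const (μ := MeasureTheory.volume) (c := 4 * κ * (M * (R + R) ^ 2) * ε)) hpt
  have h4 := h.trans h3
  simpa using h4

/-- Away from the boundary of the density matrices the distance is controlled by the norm, as the
kinetic energy of straight segments shows. -/
theorem IsErgodic.exists_distPos_sq_le_of_geTrace (hD : D.IsErgodic) : ∃ M : ℝ, 0 < M ∧
    ∀ ρ ∈ D.densityPos, ∀ ν ∈ D.densityPos, ∀ ε > 0, D.GeTrace ε ρ → D.GeTrace ε ν →
      D.distPos ρ ν ^ 2 ≤ ε⁻¹ * (M * ‖ν - ρ‖ ^ 2) := by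
  obtain ⟨M, hM, hMv⟩ := D.exists_normSq_one_le
  refine ⟨M, hM, fun ρ hρ ν hν ε hε h1 h2 => ?_⟩
  have hv := sub_isSelfAdjoint_trace (D.densityPos_subset_density hρ)
    (D.densityPos_subset_density hν)
  have hseg := isCurve_segment hρ hν
  have h := hD.distPos_sq_le hseg
  have h3 := intervalIntegral.integral_mono_on zero_le_one
    ((hD.continuousOn_normSq hseg).intervalIntegrable_of_Icc zero_le_one)
    (intervalIntegrable_const (μ := MeasureTheory.volume) (c := ε⁻¹ * (M * ‖ν - ρ‖ ^ 2))) (fun u hu => by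
      have hg := h1.convexCombo h2 hu
      rw [← add_mul, sub_add_cancel, one_mul] at hg
      exact (hD.normSq_le_of_geTrace hε hg hv.1 hv.2).trans
        (mul_le_mul_of_nonneg_left (hMv _) (inv_pos.mpr hε).le))
  have h4 := h.trans h3
  simpa using h4

/-- The distance is uniformly continuous with respect to the norm. -/
theorem IsErgodic.exists_distPos_lt (hD : D.IsErgodic) {η : ℝ} (hη : 0 < η) :
    ∃ δ > 0, ∀ ρ ∈ D.densityPos, ∀ ν ∈ D.densityPos, ‖ν - ρ‖ < δ → D.distPos ρ ν < η := by
  obtain ⟨C, hC, hmix⟩ := hD.exists_distPos_mix_sq_le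
  obtain ⟨M, hM, hseg⟩ := hD.exists_distPos_sq_le_of_geTrace
  set κ := (D.τ 1).re with hκ
  have hκ0 : 0 < κ := D.trace_one_re_pos
  -- The path from `ρ` to `ν` passes through the mixtures of both with the identity. The mixing
  -- parameter `ε` is fixed first, and `δ` is then chosen in terms of it.
  obtain ⟨ε, hε, hε2⟩ : ∃ ε ∈ Ioc (0 : ℝ) 1, C * ε ≤ (η / 4) ^ 2 := by
    refine ⟨min 1 ((η / 4) ^ 2 / C), ⟨by positivity, min_le_left _ _⟩, ?_⟩
    have := mul_le_mul_of_nonneg_left (min_le_right 1 ((η / 4) ^ 2 / C)) hC.le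
    rwa [mul_div_cancel₀ _ hC.ne'] at this
  have hε0 := hε.1
  obtain ⟨δ, hδ, hδ2⟩ : ∃ δ > 0, (ε * κ⁻¹)⁻¹ * (M * δ ^ 2) ≤ (η / 4) ^ 2 := by
    refine ⟨η / 4 * Real.sqrt (ε * κ⁻¹ / M), by positivity, ?_⟩
    rw [mul_pow, Real.sq_sqrt (by positivity)]
    refine le_of_eq ?_
    field_simp
  refine ⟨δ, hδ, fun ρ hρ ν hν hlt => ?_⟩
  have hρ' := D.densityPos_subset_density hρ
  have hν' := D.densityPos_subset_density hν
  have hm1 := mix_mem_densityPos hρ' hε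
  have hm2 := mix_mem_densityPos hν' hε
  have hη4 : 0 ≤ η / 4 := by positivity
  have a1 := (sq_le_sq₀ (D.distPos_nonneg _ _) hη4).mp ((hmix ρ hρ ε hε).trans hε2)
  have a2 := (sq_le_sq₀ (D.distPos_nonneg _ _) hη4).mp ((hmix ν hν ε hε).trans hε2)
  have a3 : D.distPos ((1 - ε) • ρ + ε • D.mixed) ((1 - ε) • ν + ε • D.mixed) ≤ η / 4 := by
    refine (sq_le_sq₀ (D.distPos_nonneg _ _) hη4).mp (le_trans ?_ hδ2)
    refine (hseg _ hm1 _ hm2 _ (by positivity) (geTrace_mix hρ' ⟨hε.1.le, hε.2⟩)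
      (geTrace_mix hν' ⟨hε.1.le, hε.2⟩)).trans ?_
    have : ‖((1 - ε) • ν + ε • D.mixed) - ((1 - ε) • ρ + ε • D.mixed)‖ ≤ δ := by
      rw [add_sub_add_right_eq_sub, ← smul_sub, norm_smul, Real.norm_eq_abs,
        abs_of_nonneg (sub_nonneg.mpr hε.2)]
      have := mul_le_mul_of_nonneg_right (show 1 - ε ≤ 1 by linarith) (norm_nonneg (ν - ρ))
      linarith
    gcongr
  rw [hD.distPos_comm hν hm2] at a2
  have t1 := hD.distPos_triangle hρ hm1 hν
  have t2 := hD.distPos_triangle hm1 hm2 hν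
  linarith

end DifferentialStructure

/-! ### The extended distance -/

namespace DifferentialStructure

variable {A : Type*} [CStarAlgebra A] [FiniteDimensional ℂ A] {J : Type*} [Fintype J] {ι : Type*}
  {B : ι → Type*} [∀ k, CStarAlgebra (B k)] [∀ k, FiniteDimensional ℂ (B k)]
  {D : DifferentialStructure A J B}

/-- A sequence tending to zero through `(0, 1]`. -/
noncomputable def mixRate (n : ℕ) : ℝ := 1 / ((n : ℝ) + 1)

theorem mixRate_mem (n : ℕ) : mixRate n ∈ Ioc (0 : ℝ) 1 :=
  ⟨Nat.one_div_pos_of_nat, by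
    unfold mixRate
    rw [div_le_one (by positivity)]
    have : (0 : ℝ) ≤ n := n.cast_nonneg
    linarith⟩

theorem tendsto_mixRate : Tendsto mixRate atTop (𝓝 0) := tendsto_one_div_add_atTop_nhds_zero_nat

/-- Positive definite approximations of a density matrix. -/
noncomputable def approx (D : DifferentialStructure A J B) (ρ : A) (n : ℕ) : A :=
  (1 - mixRate n) • ρ + mixRate n • D.mixed

theorem approx_mem {ρ : A} (hρ : ρ ∈ D.density) (n : ℕ) : D.approx ρ n ∈ D.densityPos :=
  mix_mem_densityPos hρ (mixRate_mem n)

theorem tendsto_approx (ρ : A) : Tendsto (D.approx ρ) atTop (𝓝 ρ) := by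
  have h : Continuous fun ε : ℝ => (1 - ε) • ρ + ε • D.mixed := by fun_prop
  have h2 := h.tendsto 0
  simp only [sub_zero, one_smul, zero_smul, add_zero] at h2
  exact h2.comp tendsto_mixRate

theorem mem_closure_densityPos {ρ : A} (hρ : ρ ∈ D.density) : ρ ∈ closure D.densityPos :=
  mem_closure_of_tendsto (tendsto_approx ρ) (Eventually.of_forall (approx_mem hρ))

theorem IsErgodic.exists_tendsto_distPos (hD : D.IsErgodic) {p : A × A}
    (hp : p ∈ D.density ×ˢ D.density) :
    ∃ y, Tendsto (fun p : A × A => D.distPos p.1 p.2) (𝓝[D.densityPos ×ˢ D.densityPos] p)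
      (𝓝 y) := by
  have hne : (𝓝[D.densityPos ×ˢ D.densityPos] p).NeBot := by
    rw [← mem_closure_iff_nhdsWithin_neBot, closure_prod_eq]
    exact ⟨mem_closure_densityPos hp.1, mem_closure_densityPos hp.2⟩
  refine cauchy_map_iff_exists_tendsto.mp (Metric.cauchy_iff.mpr ⟨inferInstance, fun η hη => ?_⟩)
  obtain ⟨δ, hδ, h⟩ := hD.exists_distPos_lt (half_pos hη)
  refine ⟨_, image_mem_map (inter_mem_nhdsWithin _ (Metric.ball_mem_nhds p (half_pos hδ))), ?_⟩
  rintro _ ⟨x, ⟨hx, hxb⟩, rfl⟩ _ ⟨y, ⟨hy, hyb⟩, rfl⟩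
  have hxy : dist x y < δ := by
    have := dist_triangle_right x y p
    rw [Metric.mem_ball] at hxb hyb
    linarith
  rw [Prod.dist_eq, max_lt_iff, dist_comm x.1, dist_comm x.2, dist_eq_norm, dist_eq_norm] at hxy
  have h1 := h _ hx.1 _ hy.1 hxy.1
  have h2 := h _ hx.2 _ hy.2 hxy.2
  have c1 := hD.distPos_comm hx.1 hy.1
  have c2 := hD.distPos_comm hx.2 hy.2
  have t1 := hD.distPos_triangle hx.1 hy.1 hx.2
  have t2 := hD.distPos_triangle hy.1 hy.2 hx.2
  have t3 := hD.distPos_triangle hy.1 hx.1 hy.2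
  have t4 := hD.distPos_triangle hx.1 hx.2 hy.2
  rw [Real.dist_eq, abs_lt]
  constructor <;> linarith

theorem IsErgodic.continuousOn_W (hD : D.IsErgodic) :
    ContinuousOn (fun p : A × A => D.W p.1 p.2) (D.density ×ˢ D.density) :=
  continuousOn_extendFrom (f := fun p : A × A => D.distPos p.1 p.2)
    (fun p hp => by
      rw [closure_prod_eq]
      exact ⟨mem_closure_densityPos hp.1, mem_closure_densityPos hp.2⟩)
    fun _ hp => hD.exists_tendsto_distPos hp

theorem IsErgodic.W_eq_distPos (hD : D.IsErgodic) {ρ ν : A} (hρ : ρ ∈ D.densityPos)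
    (hν : ν ∈ D.densityPos) : D.W ρ ν = D.distPos ρ ν := by
  have hmem : (ρ, ν) ∈ D.densityPos ×ˢ D.densityPos := ⟨hρ, hν⟩
  obtain ⟨y, hy⟩ := hD.exists_tendsto_distPos (p := (ρ, ν))
    ⟨D.densityPos_subset_density hρ, D.densityPos_subset_density hν⟩
  have hyv : y = D.distPos ρ ν := by
    have hp : Tendsto (fun p : A × A => D.distPos p.1 p.2) (pure (ρ, ν)) (𝓝 y) :=
      hy.mono_left (pure_le_nhdsWithin hmem)
    exact tendsto_nhds_unique hp (tendsto_pure_nhds _ _)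
  rw [← hyv]
  exact extendFrom_eq (subset_closure hmem) hy

theorem IsErgodic.tendsto_W (hD : D.IsErgodic) {α : Type*} {l : Filter α} {x y : α → A}
    {ρ ν : A} (hx : Tendsto x l (𝓝 ρ)) (hy : Tendsto y l (𝓝 ν)) (hxm : ∀ i, x i ∈ D.density)
    (hym : ∀ i, y i ∈ D.density) (hρ : ρ ∈ D.density) (hν : ν ∈ D.density) :
    Tendsto (fun i => D.W (x i) (y i)) l (𝓝 (D.W ρ ν)) := by
  have h := hD.continuousOn_W (ρ, ν) ⟨hρ, hν⟩
  have h2 : Tendsto (fun i => (x i, y i)) l (𝓝[D.density ×ˢ D.density] (ρ, ν)) :=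
    tendsto_nhdsWithin_iff.mpr ⟨hx.prodMk_nhds hy, Eventually.of_forall fun i => ⟨hxm i, hym i⟩⟩
  exact Tendsto.comp h h2

theorem IsErgodic.tendsto_W_approx (hD : D.IsErgodic) {ρ ν : A} (hρ : ρ ∈ D.density)
    (hν : ν ∈ D.density) :
    Tendsto (fun n => D.distPos (D.approx ρ n) (D.approx ν n)) atTop (𝓝 (D.W ρ ν)) := by
  have := hD.tendsto_W (tendsto_approx (D := D) ρ) (tendsto_approx (D := D) ν)
    (fun n => D.densityPos_subset_density (approx_mem hρ n))
    (fun n => D.densityPos_subset_density (approx_mem hν n)) hρ hν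
  refine this.congr fun n => ?_
  rw [hD.W_eq_distPos (approx_mem hρ n) (approx_mem hν n)]

theorem IsErgodic.W_nonneg (hD : D.IsErgodic) {ρ ν : A} (hρ : ρ ∈ D.density)
    (hν : ν ∈ D.density) : 0 ≤ D.W ρ ν :=
  ge_of_tendsto' (hD.tendsto_W_approx hρ hν) fun _ => D.distPos_nonneg _ _

theorem IsErgodic.W_comm (hD : D.IsErgodic) {ρ ν : A} (hρ : ρ ∈ D.density)
    (hν : ν ∈ D.density) : D.W ρ ν = D.W ν ρ :=
  tendsto_nhds_unique (hD.tendsto_W_approx hρ hν) ((hD.tendsto_W_approx hν hρ).congr fun n =>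
    hD.distPos_comm (approx_mem hν n) (approx_mem hρ n))

theorem IsErgodic.W_triangle (hD : D.IsErgodic) {p q r : A} (hp : p ∈ D.density)
    (hq : q ∈ D.density) (hr : r ∈ D.density) : D.W p r ≤ D.W p q + D.W q r :=
  le_of_tendsto_of_tendsto' (hD.tendsto_W_approx hp hr)
    ((hD.tendsto_W_approx hp hq).add (hD.tendsto_W_approx hq hr)) fun n =>
      hD.distPos_triangle (approx_mem hp n) (approx_mem hq n) (approx_mem hr n)

theorem isCompact_density (D : DifferentialStructure A J B) : IsCompact D.density := by
  have hprop : ProperSpace A := FiniteDimensional.proper ℂ A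
  obtain ⟨R, -, hR⟩ := D.exists_norm_le_of_mem_density
  have hclosed : IsClosed D.density :=
    (isClosed_isPosSemidef D.τ).inter (isClosed_singleton.preimage D.continuous_trace)
  refine (isCompact_closedBall (0 : A) R).of_isClosed_subset hclosed fun ρ hρ => ?_
  rw [mem_closedBall_zero_iff]
  exact hR ρ hρ

/-! ### The kinetic energy of nearly minimising curves -/

/-- The kinetic energy spent by a nearly minimising curve up to time `s` is nearly proportional to
`s`. -/
theorem IsErgodic.sq_integral_sub_le (hD : D.IsErgodic) {ρ v : ℝ → A} (h : D.IsCurve ρ v)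
    {s : ℝ} (hs : s ∈ Icc (0 : ℝ) 1) :
    ((∫ u in (0 : ℝ)..s, D.normSq (ρ u) (v u)) - s * ∫ u in (0 : ℝ)..1, D.normSq (ρ u) (v u)) ^ 2 ≤
      ((∫ u in (0 : ℝ)..1, D.normSq (ρ u) (v u)) - D.distPos (ρ 0) (ρ 1) ^ 2) *
        ∫ u in (0 : ℝ)..1, D.normSq (ρ u) (v u) := by
  have hcont := hD.continuousOn_normSq h
  have h0 : (0 : ℝ) ∈ Icc (0 : ℝ) 1 := by simp
  have h1 : (1 : ℝ) ∈ Icc (0 : ℝ) 1 := by simp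
  have hadd := intervalIntegral.integral_add_adjacent_intervals
    ((hcont.mono (Icc_subset_Icc le_rfl hs.2)).intervalIntegrable_of_Icc
      (μ := MeasureTheory.volume) hs.1)
    ((hcont.mono (Icc_subset_Icc hs.1 le_rfl)).intervalIntegrable_of_Icc hs.2)
  have a1 := hD.distPos_sq_le_sub h h0 hs
  have a2 := hD.distPos_sq_le_sub h hs h1
  have hF : 0 ≤ ∫ u in (0 : ℝ)..s, D.normSq (ρ u) (v u) :=
    intervalIntegral.integral_nonneg hs.1 fun u hu =>
      hD.normSq_nonneg_of_isCurve h ⟨hu.1, hu.2.trans hs.2⟩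
  have hG : 0 ≤ ∫ u in s..1, D.normSq (ρ u) (v u) :=
    intervalIntegral.integral_nonneg hs.2 fun u hu =>
      hD.normSq_nonneg_of_isCurve h ⟨hs.1.trans hu.1, hu.2⟩
  rw [← hadd]
  set F := ∫ u in (0 : ℝ)..s, D.normSq (ρ u) (v u)
  set G := ∫ u in s..1, D.normSq (ρ u) (v u)
  have ht := hD.distPos_triangle (h.2 0 h0).1 (h.2 s hs).1 (h.2 1 h1).1
  have hn := D.distPos_nonneg (ρ 0) (ρ 1)
  have hn1 := D.distPos_nonneg (ρ 0) (ρ s)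
  have hn2 := D.distPos_nonneg (ρ s) (ρ 1)
  set d := D.distPos (ρ 0) (ρ 1)
  set x := D.distPos (ρ 0) (ρ s)
  set y := D.distPos (ρ s) (ρ 1)
  obtain ⟨hs0, hs1⟩ := hs
  have hs1' : 0 ≤ 1 - s := sub_nonneg.mpr hs1
  -- `p² = (1 - s) F`, `q² = s G`, and `p q` is also the product of the bounds for `x` and `y`
  obtain ⟨p, hp, hp2⟩ : ∃ p, 0 ≤ p ∧ p ^ 2 = (1 - s) * F :=
    ⟨_, Real.sqrt_nonneg _, Real.sq_sqrt (mul_nonneg hs1' hF)⟩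
  obtain ⟨q, hq, hq2⟩ : ∃ q, 0 ≤ q ∧ q ^ 2 = s * G :=
    ⟨_, Real.sqrt_nonneg _, Real.sq_sqrt (mul_nonneg hs0 hG)⟩
  have hxy : x * y ≤ p * q := by
    refine (sq_le_sq₀ (mul_nonneg hn1 hn2) (mul_nonneg hp hq)).mp ?_
    rw [mul_pow, mul_pow, hp2, hq2]
    rw [sub_zero] at a1
    calc x ^ 2 * y ^ 2 ≤ (s * F) * ((1 - s) * G) := by gcongr
      _ = _ := by ring
  have hd : d ^ 2 ≤ F + G - (p - q) ^ 2 := by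
    have : d ^ 2 ≤ (x + y) ^ 2 := by gcongr
    nlinarith
  have hpq : (p + q) ^ 2 ≤ F + G := by
    have hpq2 : (p * q) ^ 2 = (s * F) * ((1 - s) * G) := by rw [mul_pow, hp2, hq2]; ring
    have h2 : 2 * (p * q) ≤ s * F + (1 - s) * G := by
      have e1 := mul_nonneg hs0 hF
      have e2 := mul_nonneg hs1' hG
      refine (sq_le_sq₀ (by positivity) (by positivity)).mp ?_
      nlinarith [sq_nonneg (s * F - (1 - s) * G)]
    nlinarith
  have e : F - s * (F + G) = (p - q) * (p + q) := by
    have : (p - q) * (p + q) = p ^ 2 - q ^ 2 := by ring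
    rw [this, hp2, hq2]; ring
  rw [e, mul_pow]
  have h3 : (p - q) ^ 2 ≤ F + G - d ^ 2 := by linarith
  exact mul_le_mul h3 hpq (sq_nonneg _) ((sq_nonneg _).trans h3)

/-- Affine weights in the kinetic energy of a nearly minimising curve. -/
theorem IsErgodic.integral_affine_le (hD : D.IsErgodic) {ρ v : ℝ → A} (h : D.IsCurve ρ v)
    (a b : ℝ) :
    ∫ s in (0 : ℝ)..1, (a + b * s) * D.normSq (ρ s) (v s) ≤
      (a + b / 2) * (∫ s in (0 : ℝ)..1, D.normSq (ρ s) (v s)) + |b| * Real.sqrt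
        (((∫ s in (0 : ℝ)..1, D.normSq (ρ s) (v s)) - D.distPos (ρ 0) (ρ 1) ^ 2) *
          ∫ s in (0 : ℝ)..1, D.normSq (ρ s) (v s)) := by
  -- The continuous extension of the squared speed to the line, to which the fundamental theorem of
  -- calculus applies without boundary conditions.
  set e : ℝ → ℝ := IccExtend (zero_le_one' ℝ) (fun s => D.normSq (ρ s) (v s)) with he
  have hcont := hD.continuousOn_normSq h
  have hec : Continuous e := (continuousOn_iff_continuous_domRestrict.mp hcont).Icc_extend'
  have heq : ∀ s ∈ Icc (0 : ℝ) 1, e s = D.normSq (ρ s) (v s) := fun s hs =>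
    IccExtend_of_mem _ _ hs
  have hint : ∀ t ∈ Icc (0 : ℝ) 1, ∫ s in (0 : ℝ)..t, D.normSq (ρ s) (v s) =
      ∫ s in (0 : ℝ)..t, e s := fun t ht => by
    refine intervalIntegral.integral_congr fun s hs => ?_
    rw [uIcc_of_le ht.1] at hs
    exact (heq s ⟨hs.1, hs.2.trans ht.2⟩).symm
  have hbound := fun s hs => hD.sq_integral_sub_le h (s := s) hs
  have e1 : ∫ s in (0 : ℝ)..1, (a + b * s) * D.normSq (ρ s) (v s) =
      ∫ s in (0 : ℝ)..1, (a + b * s) * e s := by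
    refine intervalIntegral.integral_congr fun s hs => ?_
    rw [uIcc_of_le zero_le_one] at hs
    simp only [heq s hs]
  rw [e1]
  rw [hint 1 (by simp)] at hbound ⊢
  set E := ∫ s in (0 : ℝ)..1, e s with hE
  set R := Real.sqrt ((E - D.distPos (ρ 0) (ρ 1) ^ 2) * E) with hR
  set F : ℝ → ℝ := fun t => ∫ s in (0 : ℝ)..t, e s with hF
  have hFd : ∀ t, HasDerivAt F (e t) t := fun t => (hec.integral_hasStrictDerivAt 0 t).hasDerivAt
  have hFc : Continuous F := continuous_iff_continuousAt.mpr fun t => (hFd t).continuousAt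
  -- Integration by parts leaves the partial energies `F s`, which are close to `s E`.
  have hparts := intervalIntegral.integral_mul_deriv_eq_deriv_mul (a := 0) (b := 1)
    (u := fun s => a + b * s) (u' := fun _ => b) (v := F) (v' := e)
    (fun s _ => by simpa using ((hasDerivAt_id s).const_mul b).const_add a)
    (fun s _ => hFd s) (continuous_const.intervalIntegrable _ _) (hec.intervalIntegrable _ _)
  have hF0 : F 0 = 0 := intervalIntegral.integral_same
  have hF1 : F 1 = E := rfl
  rw [hF0, hF1] at hparts
  have hFb : ∀ s ∈ Icc (0 : ℝ) 1, |F s - s * E| ≤ R := fun s hs => by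
    have := hbound s hs
    rw [hint s hs] at this
    exact Real.abs_le_sqrt this
  have hkey : -∫ s in (0 : ℝ)..1, b * F s ≤ ∫ s in (0 : ℝ)..1, (|b| * R - b * E * s) := by
    rw [← intervalIntegral.integral_neg]
    refine intervalIntegral.integral_mono_on zero_le_one
      ((continuous_const.mul hFc).neg.intervalIntegrable _ _)
      (by apply Continuous.intervalIntegrable; fun_prop) fun s hs => ?_
    have h1 : -b * (F s - s * E) ≤ |b| * R := by
      refine (le_abs_self _).trans ?_
      rw [abs_mul, abs_neg]
      exact mul_le_mul_of_nonneg_left (hFb s hs) (abs_nonneg b)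
    linarith
  have hval : ∫ s in (0 : ℝ)..1, (|b| * R - b * E * s) = |b| * R - b * E / 2 := by
    rw [intervalIntegral.integral_sub (by simp) (by apply Continuous.intervalIntegrable; fun_prop),
      intervalIntegral.integral_const_mul (b * E), integral_id]
    simp
    ring
  rw [hparts]
  rw [hval] at hkey
  linarith

end DifferentialStructure

/-! ### Transport along the semigroup -/

theorem contDiff_flow {E : Type*} [NormedAddCommGroup E] [NormedSpace ℂ E] [FiniteDimensional ℂ E]
    (L : E →ₗ[ℂ] E) : ContDiff ℝ ((⊤ : ℕ∞) : WithTop ℕ∞) (flow L) := by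
  refine contDiff_infty.mpr fun n => ?_
  induction n with
  | zero =>
    exact contDiff_zero.mpr (continuous_iff_continuousAt.mpr fun t =>
      (hasDerivAt_flow L t).continuousAt)
  | succ n ih =>
    have hd : deriv (flow L) = fun t => flow L t * LinearMap.toContinuousLinearMap L :=
      funext fun t => (hasDerivAt_flow L t).deriv
    have h := (contDiff_succ_iff_deriv (n := (n : WithTop ℕ∞)) (f := flow L) (𝕜 := ℝ)).mpr
      ⟨fun t => (hasDerivAt_flow L t).differentiableAt, by simp, by
        rw [hd]; exact ih.mul contDiff_const⟩
    exact_mod_cast h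

namespace DifferentialStructure

variable {A : Type*} [CStarAlgebra A] [FiniteDimensional ℂ A] {J : Type*} [Fintype J] {ι : Type*}
  {B : ι → Type*} [∀ k, CStarAlgebra (B k)] [∀ k, FiniteDimensional ℂ (B k)]
  {D : DifferentialStructure A J B}

theorem trace_generatorAdj (D : DifferentialStructure A J B) (ρ : A) :
    D.τ (D.generatorAdj ρ) = 0 := by
  have := D.trace_mul_generatorAdj 1 ρ
  rwa [one_mul, generator_one, zero_mul, map_zero] at this

/-- By duality, the gradient estimate makes `P_t†` contract tangent vectors. -/
theorem GradientEstimate.normSq_semigroupAdj_le (hD : D.IsErgodic) {lam : ℝ}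
    (hG : D.GradientEstimate lam) {ρ : A} (hρ : ρ ∈ D.densityPos) {v : A} (hv : IsSelfAdjoint v)
    (hv0 : D.τ v = 0) {r : ℝ} (hr : 0 ≤ r) :
    D.normSq (D.semigroupAdj r ρ) (D.semigroupAdj r v) ≤
      Real.exp (-2 * lam * r) * D.normSq ρ v := by
  have hv' : IsSelfAdjoint (D.semigroupAdj r v) := by
    rw [IsSelfAdjoint, star_semigroupAdj, hv.star_eq]
  refine hD.normSq_le_of_forall (D.semigroupAdj_mem_densityPos hρ hr).1 hv'
    (by rw [trace_semigroupAdj, hv0]) fun a ha => ?_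
  rw [trace_mul_semigroupAdj]
  set k := Real.exp (-2 * lam * r) with hk
  have hk0 : 0 < k := Real.exp_pos _
  have hPa : IsSelfAdjoint (D.semigroup r a) := by
    rw [IsSelfAdjoint, star_semigroup, ha.star_eq]
  have h1 := hD.two_trace_le hρ.1 hv hv0 (a := k⁻¹ • D.semigroup r a)
    (IsSelfAdjoint.smul (star_trivial _) hPa)
  rw [smul_mul_assoc, ← Complex.coe_smul, ← Complex.coe_smul, map_smul, smul_eq_mul,
    Complex.re_ofReal_mul, energy_smul] at h1
  have h2 := mul_le_mul_of_nonneg_left h1 hk0.le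
  have e1 : k * (2 * (k⁻¹ * (D.τ (D.semigroup r a * v)).re)) =
      2 * (D.τ (D.semigroup r a * v)).re := by field_simp
  have e2 : k * (k⁻¹ ^ 2 * D.energy ρ (D.semigroup r a) + D.normSq ρ v) =
      k⁻¹ * D.energy ρ (D.semigroup r a) + k * D.normSq ρ v := by field_simp
  rw [e1, e2] at h2
  have h3 := mul_le_mul_of_nonneg_left (hG ρ hρ r hr a) (inv_pos.mpr hk0).le
  rw [← hk, ← mul_assoc, inv_mul_cancel₀ hk0.ne', one_mul] at h3
  linarith

/-- Adding a multiple of the gradient flow direction to a tangent vector is paid for by the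
derivative of the entropy. -/
theorem IsErgodic.normSq_add_entropyDeriv_le (hD : D.IsErgodic) {ρ : A} (hρ : ρ ∈ D.densityPos)
    {w : A} (hw : IsSelfAdjoint w) (hw0 : D.τ w = 0) (t : ℝ) :
    D.normSq ρ w + 2 * t * (D.τ (D.logRatio ρ * w)).re ≤
      D.normSq ρ (w - t • D.generatorAdj ρ) := by
  have hL : IsSelfAdjoint (D.generatorAdj ρ) := by
    rw [IsSelfAdjoint, star_generatorAdj, hρ.1.1.star_eq]
  have hspec := hD.Ksol_spec hρ.1 hw hw0
  set a₀ := D.Ksol ρ w with ha₀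
  set d := D.logRatio ρ with hd
  have hdsa : IsSelfAdjoint d := D.isSelfAdjoint_logRatio ρ
  have hKd : D.Kop ρ d = -D.generatorAdj ρ := D.Kop_log hρ.1
  have hv : w - t • D.generatorAdj ρ = D.Kop ρ (a₀ + (t : ℂ) • d) := by
    rw [Kop_add, Kop_smul, hspec.2, hKd, smul_neg, Complex.coe_smul, sub_eq_add_neg]
  have hasa : IsSelfAdjoint (a₀ + (t : ℂ) • d) := by
    rw [Complex.coe_smul]
    exact hspec.1.1.add (IsSelfAdjoint.smul (star_trivial _) hdsa)
  have h1 := hD.two_trace_le hρ.1 (v := w - t • D.generatorAdj ρ)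
    (hw.sub (IsSelfAdjoint.smul (star_trivial _) hL))
    (by rw [map_sub, hw0, ← Complex.coe_smul, map_smul, trace_generatorAdj, smul_zero, sub_zero])
    hasa
  have h2 : D.energy ρ (a₀ + (t : ℂ) • d) =
      (D.τ ((a₀ + (t : ℂ) • d) * (w - t • D.generatorAdj ρ))).re := by
    rw [energy_eq_trace, hasa.star_eq, hv]
  have h3 : (D.τ ((a₀ + (t : ℂ) • d) * (w - t • D.generatorAdj ρ))).re =
      D.normSq ρ w + 2 * t * (D.τ (d * w)).re + t ^ 2 * D.energy ρ d := by
    rw [hv, Kop_add, Kop_smul, hspec.2]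
    have c1 := D.trace_Kop_comm ρ a₀ d
    rw [hspec.1.1.star_eq, hdsa.star_eq, hspec.2] at c1
    simp only [add_mul, mul_add, smul_mul_assoc, mul_smul_comm, map_add, map_smul, smul_eq_mul,
      Complex.add_re, Complex.re_ofReal_mul]
    rw [c1, energy_eq_trace, hdsa.star_eq, D.τ.tracial a₀ w]
    unfold normSq
    ring
  have h4 := D.energy_nonneg hρ.1 d
  have h5 : 0 ≤ t ^ 2 * D.energy ρ d := mul_nonneg (sq_nonneg t) h4
  rw [h2] at h1
  linarith

/-- A curve whose point at time `s` is moved by `P_{ts}†`. -/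
theorem IsCurve.semigroupAdj {ρ v : ℝ → A} (h : D.IsCurve ρ v) {t : ℝ} (ht : 0 ≤ t) :
    D.IsCurve (fun s => D.semigroupAdj (t * s) (ρ s))
      (fun s => D.semigroupAdj (t * s) (v s) +
        t • D.generatorAdj (D.semigroupAdj (t * s) (ρ s))) := by
  simp only [semigroupAdj_apply]
  have hfl : ContDiff ℝ ((⊤ : ℕ∞) : WithTop ℕ∞) fun s : ℝ => flow D.generatorAdj (t * s) :=
    (contDiff_flow D.generatorAdj).comp (contDiff_const.mul contDiff_id)
  have hb : IsBoundedBilinearMap ℝ (fun p : (A →L[ℂ] A) × A => p.1 p.2) :=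
    ⟨fun _ _ _ => rfl, fun _ _ _ => rfl, fun _ _ _ => map_add _ _ _,
      fun c x y => by simp,
      ⟨1, one_pos, fun x y => by simpa using x.le_opNorm y⟩⟩
  refine ⟨hb.contDiff.comp_contDiffOn (hfl.contDiffOn.prodMk h.1), fun s hs => ⟨?_, ?_⟩⟩
  · have := D.semigroupAdj_mem_densityPos (h.2 s hs).1 (mul_nonneg ht hs.1)
    rwa [semigroupAdj_apply] at this
  · have h1 : HasDerivAt (fun s : ℝ => flow D.generatorAdj (t * s))
        (t • (LinearMap.toContinuousLinearMap D.generatorAdj * flow D.generatorAdj (t * s))) s := by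
      have h0 : HasDerivAt (fun s : ℝ => t * s) t s := by
        simpa using (hasDerivAt_id s).const_mul t
      exact (hasDerivAt_flow' D.generatorAdj (t * s)).scomp s h0
    have h2 := (hb.hasFDerivAt (flow D.generatorAdj (t * s), ρ s)).comp_hasDerivWithinAt s
      (h1.hasDerivWithinAt.prodMk (h.2 s hs).2)
    exact h2

theorem IsCurve.continuousOn_velocity {ρ v : ℝ → A} (h : D.IsCurve ρ v) :
    ContinuousOn v (Icc 0 1) := by
  refine (h.1.continuousOn_derivWithin uniqueDiffOn_Icc_zero_one (by simp)).congr fun t ht => ?_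
  exact ((h.2 t ht).2.derivWithin (uniqueDiffOn_Icc_zero_one t ht)).symm

/-- The chain rule for the entropy along curves. -/
theorem IsCurve.integral_entropyDeriv {ρ v : ℝ → A} (h : D.IsCurve ρ v) :
    IntervalIntegrable (fun s => (D.τ (D.logRatio (ρ s) * v s)).re) MeasureTheory.volume 0 1 ∧
    ∫ s in (0 : ℝ)..1, (D.τ (D.logRatio (ρ s) * v s)).re =
      D.entropy (ρ 1) - D.entropy (ρ 0) := by
  have hd : ∀ s ∈ Icc (0 : ℝ) 1, HasDerivWithinAt (fun s => D.entropy (ρ s))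
      (D.τ (D.logRatio (ρ s) * v s)).re (Icc 0 1) s := fun s hs =>
    D.hasDerivWithinAt_entropy (fun u hu => (h.2 u hu).1) hs (h.2 s hs).2
  have hc : ContinuousOn (fun s => (D.τ (D.logRatio (ρ s) * v s)).re) (Icc 0 1) :=
    D.reτ.continuous.comp_continuousOn
      ((D.continuousOn_logRatio.comp h.1.continuousOn fun s hs => (h.2 s hs).1).mul
        h.continuousOn_velocity)
  have hi := hc.intervalIntegrable_of_Icc (μ := MeasureTheory.volume) zero_le_one
  refine ⟨hi, intervalIntegral.integral_eq_sub_of_hasDerivAt_of_le zero_le_one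
    (fun s hs => (hd s hs).continuousWithinAt)
    (fun s hs => (hd s (Ioo_subset_Icc_self hs)).hasDerivAt (Icc_mem_nhds hs.1 hs.2)) hi⟩

/-- The kinetic energy of the curve `s ↦ P_{ts}† ρ_s`. Its velocity is the transported velocity,
contracted by the gradient estimate, plus a multiple of the gradient flow direction, paid for by the
derivative of the entropy; moreover `e^{-2 lam t s} ≤ 1 - 2 lam t s + 4 lam² t²` for small `t`. -/
theorem GradientEstimate.distPos_semigroupAdj_sq_le_integral (hD : D.IsErgodic) {lam : ℝ}
    (hG : D.GradientEstimate lam) {ρ v : ℝ → A} (h : D.IsCurve ρ v) {t : ℝ} (ht : 0 ≤ t)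
    (hlt : |2 * lam * t| ≤ 1) :
    D.distPos (ρ 0) (D.semigroupAdj t (ρ 1)) ^ 2 ≤
      (∫ s in (0 : ℝ)..1, ((1 + 4 * lam ^ 2 * t ^ 2) + (-2 * lam * t) * s) *
        D.normSq (ρ s) (v s)) +
      2 * t * (D.entropy (ρ 0) - D.entropy (D.semigroupAdj t (ρ 1))) := by
  have h' := h.semigroupAdj ht
  have hmain := hD.distPos_sq_le h'
  obtain ⟨hi, hent⟩ := h'.integral_entropyDeriv
  simp only [mul_zero, mul_one, semigroupAdj_zero] at hmain hent
  refine hmain.trans ?_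
  have e : 2 * t * (D.entropy (ρ 0) - D.entropy (D.semigroupAdj t (ρ 1))) =
      -(2 * t * ∫ s in (0 : ℝ)..1, (D.τ (D.logRatio (D.semigroupAdj (t * s) (ρ s)) *
        (D.semigroupAdj (t * s) (v s) +
          t • D.generatorAdj (D.semigroupAdj (t * s) (ρ s))))).re) := by
    rw [hent]; ring
  have hcont : ContinuousOn (fun s => ((1 + 4 * lam ^ 2 * t ^ 2) + (-2 * lam * t) * s) *
        D.normSq (ρ s) (v s)) (Icc 0 1) :=
    ContinuousOn.mul (by fun_prop) (hD.continuousOn_normSq h)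
  rw [e, ← sub_eq_add_neg, ← intervalIntegral.integral_const_mul,
    ← intervalIntegral.integral_sub (hcont.intervalIntegrable_of_Icc zero_le_one)
      (hi.const_mul (2 * t))]
  refine intervalIntegral.integral_mono_on zero_le_one
    ((hD.continuousOn_normSq h').intervalIntegrable_of_Icc zero_le_one)
    ((hcont.intervalIntegrable_of_Icc zero_le_one).sub (hi.const_mul (2 * t))) fun s hs => ?_
  have hvs := hD.isCurve_velocity h hs
  have hws := hD.isCurve_velocity h' hs
  have h1 := hD.normSq_add_entropyDeriv_le (h'.2 s hs).1 hws.1 hws.2 t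
  rw [add_sub_cancel_right] at h1
  have h2 := hG.normSq_semigroupAdj_le hD (h.2 s hs).1 hvs.1 hvs.2 (mul_nonneg ht hs.1)
  have h3 : Real.exp (-2 * lam * (t * s)) ≤ (1 + 4 * lam ^ 2 * t ^ 2) + (-2 * lam * t) * s := by
    have hx : |-2 * lam * (t * s)| ≤ 1 := by
      have : -2 * lam * (t * s) = -(2 * lam * t) * s := by ring
      rw [this, abs_mul, abs_neg, abs_of_nonneg hs.1]
      exact mul_le_one₀ hlt hs.1 hs.2
    have h4 := (abs_le.mp (Real.abs_exp_sub_one_sub_id_le hx)).2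
    have h5 : (-2 * lam * (t * s)) ^ 2 ≤ 4 * lam ^ 2 * t ^ 2 := by
      have : (-2 * lam * (t * s)) ^ 2 = 4 * lam ^ 2 * t ^ 2 * s ^ 2 := by ring
      rw [this]
      exact mul_le_of_le_one_right (by positivity) (pow_le_one₀ hs.1 hs.2)
    linarith
  have h4 := mul_le_mul_of_nonneg_right h3 (hD.normSq_nonneg_of_isCurve h hs)
  linarith

theorem GradientEstimate.distPos_semigroupAdj_sq_le (hD : D.IsErgodic) {lam : ℝ}
    (hG : D.GradientEstimate lam) {ρ ν : A} (hρ : ρ ∈ D.densityPos) (hν : ν ∈ D.densityPos)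
    {t : ℝ} (ht : 0 ≤ t) (hlt : |2 * lam * t| ≤ 1) :
    D.distPos ν (D.semigroupAdj t ρ) ^ 2 ≤
      (1 - lam * t + 4 * lam ^ 2 * t ^ 2) * D.distPos ν ρ ^ 2 +
      2 * t * (D.entropy ν - D.entropy (D.semigroupAdj t ρ)) := by
  set d := D.distPos ν ρ with hd
  have key : ∀ n : ℕ, ∃ E : ℝ, d ^ 2 ≤ E ∧ E ≤ d ^ 2 + mixRate n ∧
      D.distPos ν (D.semigroupAdj t ρ) ^ 2 ≤
        (1 - lam * t + 4 * lam ^ 2 * t ^ 2) * E + |-2 * lam * t| * Real.sqrt ((E - d ^ 2) * E) +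
        2 * t * (D.entropy ν - D.entropy (D.semigroupAdj t ρ)) := fun n => by
    obtain ⟨γ, v, h, h0, h1, hlt'⟩ := hD.exists_curve_lt hν hρ (c := d ^ 2 + mixRate n)
      (by have := (mixRate_mem n).1; linarith)
    have a1 := hD.distPos_sq_le h
    have a2 := hG.distPos_semigroupAdj_sq_le_integral hD h ht hlt
    have a3 := hD.integral_affine_le h (1 + 4 * lam ^ 2 * t ^ 2) (-2 * lam * t)
    rw [h0, h1] at a1 a3
    rw [h0, h1] at a2
    refine ⟨_, a1, hlt'.le, a2.trans ?_⟩
    have : 1 - lam * t + 4 * lam ^ 2 * t ^ 2 = 1 + 4 * lam ^ 2 * t ^ 2 + -2 * lam * t / 2 := by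
      ring
    rw [this]
    linarith
  choose E hE1 hE2 hE3 using key
  have hlim : Tendsto E atTop (𝓝 (d ^ 2)) := by
    refine tendsto_of_tendsto_of_tendsto_of_le_of_le tendsto_const_nhds ?_ hE1 hE2
    simpa using tendsto_mixRate.const_add (d ^ 2)
  have hc : Continuous fun E : ℝ => (1 - lam * t + 4 * lam ^ 2 * t ^ 2) * E +
      |-2 * lam * t| * Real.sqrt ((E - d ^ 2) * E) +
        2 * t * (D.entropy ν - D.entropy (D.semigroupAdj t ρ)) := by fun_prop
  have h2 := (hc.tendsto (d ^ 2)).comp hlim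
  simp only [sub_self, zero_mul, Real.sqrt_zero, mul_zero, add_zero] at h2
  exact ge_of_tendsto' h2 hE3

theorem semigroupAdj_continuous (D : DifferentialStructure A J B) (t : ℝ) :
    Continuous (D.semigroupAdj t) :=
  (D.semigroupAdj t).continuous_of_finiteDimensional

theorem tendsto_entropy (D : DifferentialStructure A J B) {α : Type*} {l : Filter α} {x : α → A}
    {y : A} (hx : Tendsto x l (𝓝 y)) (hm : ∀ᶠ i in l, x i ∈ D.density) (hy : y ∈ D.density) :
    Tendsto (fun i => D.entropy (x i)) l (𝓝 (D.entropy y)) :=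
  Tendsto.comp (g := D.entropy) (D.continuousOn_entropy y hy)
    (tendsto_nhdsWithin_iff.mpr ⟨hx, hm⟩)

/-- The discrete form of the evolution variational inequality. -/
theorem GradientEstimate.W_semigroupAdj_sq_le (hD : D.IsErgodic) {lam : ℝ}
    (hG : D.GradientEstimate lam) {ρ ν : A} (hρ : ρ ∈ D.density) (hν : ν ∈ D.density)
    {t : ℝ} (ht : 0 ≤ t) (hlt : |2 * lam * t| ≤ 1) :
    D.W ν (D.semigroupAdj t ρ) ^ 2 ≤
      (1 - lam * t + 4 * lam ^ 2 * t ^ 2) * D.W ν ρ ^ 2 +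
      2 * t * (D.entropy ν - D.entropy (D.semigroupAdj t ρ)) := by
  have hPρ := D.semigroupAdj_mem_density hρ ht
  have hPn := fun n => D.semigroupAdj_mem_densityPos (approx_mem hρ n) ht
  have hsub := D.densityPos_subset_density
  have l1 := (tendsto_approx (D := D) ν)
  have l2 : Tendsto (fun n => D.semigroupAdj t (D.approx ρ n)) atTop (𝓝 (D.semigroupAdj t ρ)) :=
    ((D.semigroupAdj_continuous t).tendsto ρ).comp (tendsto_approx ρ)
  have w1 := hD.tendsto_W l1 l2 (fun n => hsub (approx_mem hν n)) (fun n => hsub (hPn n)) hν hPρ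
  have w2 := hD.tendsto_W_approx hν hρ
  have n1 := D.tendsto_entropy l1 (Eventually.of_forall fun n => hsub (approx_mem hν n)) hν
  have n2 := D.tendsto_entropy l2 (Eventually.of_forall fun n => hsub (hPn n)) hPρ
  refine le_of_tendsto_of_tendsto' (w1.pow 2)
    (((w2.pow 2).const_mul _).add ((n1.sub n2).const_mul (2 * t))) fun n => ?_
  rw [hD.W_eq_distPos (approx_mem hν n) (hPn n)]
  exact hG.distPos_semigroupAdj_sq_le hD (approx_mem hρ n) (approx_mem hν n) ht hlt

end DifferentialStructure

/-! ### Evolution variational inequality and geodesic convexity -/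

namespace DifferentialStructure

variable {A : Type*} [CStarAlgebra A] [FiniteDimensional ℂ A] {J : Type*} [Fintype J] {ι : Type*}
  {B : ι → Type*} [∀ k, CStarAlgebra (B k)] [∀ k, FiniteDimensional ℂ (B k)]
  {D : DifferentialStructure A J B}

theorem tendsto_semigroupAdj_zero (D : DifferentialStructure A J B) (ρ : A) :
    Tendsto (fun h : ℝ => D.semigroupAdj h ρ) (𝓝[>] 0) (𝓝 ρ) := by
  have := (D.hasDerivAt_semigroupAdj ρ 0).continuousAt.tendsto
  rw [semigroupAdj_zero] at this
  exact this.mono_left nhdsWithin_le_nhds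

theorem tendsto_entropy_semigroupAdj (D : DifferentialStructure A J B) {ρ : A}
    (hρ : ρ ∈ D.density) :
    Tendsto (fun h : ℝ => D.entropy (D.semigroupAdj h ρ)) (𝓝[>] 0) (𝓝 (D.entropy ρ)) :=
  D.tendsto_entropy (D.tendsto_semigroupAdj_zero ρ)
    (eventually_mem_nhdsWithin.mono fun _ hh => D.semigroupAdj_mem_density hρ (mem_Ioi.mp hh).le) hρ

theorem eventually_small (lam : ℝ) : ∀ᶠ h : ℝ in 𝓝[>] 0, 0 < h ∧ |2 * lam * h| ≤ 1 := by
  have hc : Continuous fun h : ℝ => |2 * lam * h| := by fun_prop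
  have h1 : ∀ᶠ h : ℝ in 𝓝[>] 0, |2 * lam * h| < 1 :=
    ((hc.tendsto 0).mono_left nhdsWithin_le_nhds).eventually (gt_mem_nhds (by simp))
  filter_upwards [h1, self_mem_nhdsWithin] with h hh hpos using ⟨hpos, hh.le⟩

/-- Dividing the discrete inequality by the time step and letting the step tend to `0` gives the
evolution variational inequality. -/
theorem GradientEstimate.evi (hD : D.IsErgodic) {lam : ℝ} (hG : D.GradientEstimate lam) :
    D.EVI lam := by
  intro ρ hρ ν hν r hr
  set μ := D.semigroupAdj r ρ with hμ
  have hμm : μ ∈ D.density := D.semigroupAdj_mem_density hρ hr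
  set g : ℝ → ℝ := fun h => (-lam + 4 * lam ^ 2 * h) * D.W μ ν ^ 2 +
    2 * (D.entropy ν - D.entropy (D.semigroupAdj h μ)) with hg
  have hlim : Tendsto g (𝓝[>] 0) (𝓝 (-lam * D.W μ ν ^ 2 + 2 * (D.entropy ν - D.entropy μ))) := by
    have h1 : Tendsto (fun h : ℝ => (-lam + 4 * lam ^ 2 * h) * D.W μ ν ^ 2) (𝓝[>] 0)
        (𝓝 (-lam * D.W μ ν ^ 2)) := by
      have hc : Continuous fun h : ℝ => (-lam + 4 * lam ^ 2 * h) * D.W μ ν ^ 2 := by fun_prop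
      have := hc.tendsto 0
      rw [mul_zero, add_zero] at this
      exact this.mono_left nhdsWithin_le_nhds
    exact h1.add (((D.tendsto_entropy_semigroupAdj hμm).const_sub _).const_mul 2)
  have hle : upperRightDeriv (fun s => D.W (D.semigroupAdj s ρ) ν ^ 2) r ≤
      ((-lam * D.W μ ν ^ 2 + 2 * (D.entropy ν - D.entropy μ) : ℝ) : EReal) := by
    have hlim' : Tendsto (fun h => ((g h : ℝ) : EReal)) (𝓝[>] 0)
        (𝓝 ((-lam * D.W μ ν ^ 2 + 2 * (D.entropy ν - D.entropy μ) : ℝ) : EReal)) :=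
      (continuous_coe_real_ereal.tendsto _).comp hlim
    rw [← hlim'.limsup_eq]
    refine limsup_le_limsup ?_
    filter_upwards [eventually_small lam] with h hh
    have hPm := D.semigroupAdj_mem_density hμm hh.1.le
    have h1 := hG.W_semigroupAdj_sq_le hD hμm hν hh.1.le hh.2
    rw [hD.W_comm hν hPm, hD.W_comm hν hμm] at h1
    refine EReal.coe_le_coe_iff.mpr ?_
    rw [add_comm r h, semigroupAdj_add, div_le_iff₀ hh.1]
    simp only [hg]
    linarith
  have hhalf : ((1 / 2 : ℝ) : EReal) * upperRightDeriv (fun s => D.W (D.semigroupAdj s ρ) ν ^ 2) r ≤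
      ((1 / 2 : ℝ) : EReal) *
        ((-lam * D.W μ ν ^ 2 + 2 * (D.entropy ν - D.entropy μ) : ℝ) : EReal) :=
    mul_le_mul_of_nonneg_left hle (EReal.coe_nonneg.mpr (by norm_num))
  refine (add_le_add_left hhalf _).trans ?_
  rw [← EReal.coe_mul, ← EReal.coe_add, EReal.coe_le_coe_iff]
  linarith

/-- The discrete evolution variational inequality, applied from a point of a geodesic towards both
of its ends, gives convexity of the entropy. -/
theorem GradientEstimate.stronglyConvex (hD : D.IsErgodic) {lam : ℝ}
    (hG : D.GradientEstimate lam) : D.StronglyConvex lam := by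
  intro γ hγ t ht
  have h0 : (0 : ℝ) ∈ Icc (0 : ℝ) 1 := by simp
  have h1 : (1 : ℝ) ∈ Icc (0 : ℝ) 1 := by simp
  have m0 := hγ.1 0 h0
  have m1 := hγ.1 1 h1
  have mt := hγ.1 t ht
  set w := D.W (γ 0) (γ 1) with hw
  have w0 : D.W (γ 0) (γ t) = t * w := by
    rw [hγ.2 0 h0 t ht, zero_sub, abs_neg, abs_of_nonneg ht.1]
  have w1 : D.W (γ 1) (γ t) = (1 - t) * w := by
    rw [hγ.2 1 h1 t ht, abs_of_nonneg (sub_nonneg.mpr ht.2)]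
  have hs : 0 ≤ 1 - t := sub_nonneg.mpr ht.2
  have key : ∀ᶠ h : ℝ in 𝓝[>] 0, 0 ≤ (-lam + 4 * lam ^ 2 * h) * (t * (1 - t) * w ^ 2) +
      2 * ((1 - t) * D.entropy (γ 0) + t * D.entropy (γ 1) -
        D.entropy (D.semigroupAdj h (γ t))) := by
    filter_upwards [eventually_small lam] with h hh
    have mP := D.semigroupAdj_mem_density mt hh.1.le
    have e0 := hG.W_semigroupAdj_sq_le hD mt m0 hh.1.le hh.2
    have e1 := hG.W_semigroupAdj_sq_le hD mt m1 hh.1.le hh.2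
    rw [w0] at e0
    rw [w1] at e1
    have tri := hD.W_triangle m0 mP m1
    rw [hD.W_comm mP m1] at tri
    have hwn : 0 ≤ w := hD.W_nonneg m0 m1
    set x := D.W (γ 0) (D.semigroupAdj h (γ t))
    set y := D.W (γ 1) (D.semigroupAdj h (γ t))
    have hsq : w ^ 2 ≤ (x + y) ^ 2 := by gcongr
    -- The triangle inequality gives `w ≤ x + y`, and `t (1 - t) (x + y)² ≤ (1 - t) x² + t y²`.
    have hconv : t * (1 - t) * w ^ 2 ≤ (1 - t) * x ^ 2 + t * y ^ 2 := by
      have h2 := mul_le_mul_of_nonneg_left hsq (mul_nonneg ht.1 hs)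
      nlinarith [sq_nonneg ((1 - t) * x - t * y)]
    have f0 := mul_le_mul_of_nonneg_left e0 hs
    have f1 := mul_le_mul_of_nonneg_left e1 ht.1
    have hfin : 0 ≤ h * ((-lam + 4 * lam ^ 2 * h) * (t * (1 - t) * w ^ 2) +
      2 * ((1 - t) * D.entropy (γ 0) + t * D.entropy (γ 1) -
        D.entropy (D.semigroupAdj h (γ t)))) := by
      have : (1 - t) * ((1 - lam * h + 4 * lam ^ 2 * h ^ 2) * (t * w) ^ 2 + 2 * h *
            (D.entropy (γ 0) - D.entropy (D.semigroupAdj h (γ t)))) +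
          t * ((1 - lam * h + 4 * lam ^ 2 * h ^ 2) * ((1 - t) * w) ^ 2 + 2 * h *
            (D.entropy (γ 1) - D.entropy (D.semigroupAdj h (γ t)))) - t * (1 - t) * w ^ 2 =
          h * ((-lam + 4 * lam ^ 2 * h) * (t * (1 - t) * w ^ 2) +
            2 * ((1 - t) * D.entropy (γ 0) + t * D.entropy (γ 1) -
              D.entropy (D.semigroupAdj h (γ t)))) := by ring
      linarith
    exact nonneg_of_mul_nonneg_right hfin hh.1
  have hlim : Tendsto (fun h : ℝ => (-lam + 4 * lam ^ 2 * h) * (t * (1 - t) * w ^ 2) +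
      2 * ((1 - t) * D.entropy (γ 0) + t * D.entropy (γ 1) -
        D.entropy (D.semigroupAdj h (γ t)))) (𝓝[>] 0) (𝓝 (-lam * (t * (1 - t) * w ^ 2) +
      2 * ((1 - t) * D.entropy (γ 0) + t * D.entropy (γ 1) - D.entropy (γ t)))) := by
    have h1 : Tendsto (fun h : ℝ => (-lam + 4 * lam ^ 2 * h) * (t * (1 - t) * w ^ 2)) (𝓝[>] 0)
        (𝓝 (-lam * (t * (1 - t) * w ^ 2))) := by
      have hc : Continuous fun h : ℝ => (-lam + 4 * lam ^ 2 * h) * (t * (1 - t) * w ^ 2) := by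
        fun_prop
      have := hc.tendsto 0
      rw [mul_zero, add_zero] at this
      exact this.mono_left nhdsWithin_le_nhds
    exact h1.add (((D.tendsto_entropy_semigroupAdj mt).const_sub _).const_mul 2)
  have := ge_of_tendsto hlim key
  linarith

/-- Nearly minimising curves have nearly constant speed. -/
theorem IsErgodic.distPos_sq_le_of_isCurve (hD : D.IsErgodic) {ρ v : ℝ → A} (h : D.IsCurve ρ v)
    {s t : ℝ} (hs : s ∈ Icc (0 : ℝ) 1) (ht : t ∈ Icc (0 : ℝ) 1) (hst : s ≤ t) :
    D.distPos (ρ s) (ρ t) ^ 2 ≤ (t - s) * ((t - s) * (∫ u in (0 : ℝ)..1, D.normSq (ρ u) (v u)) +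
      2 * Real.sqrt (((∫ u in (0 : ℝ)..1, D.normSq (ρ u) (v u)) - D.distPos (ρ 0) (ρ 1) ^ 2) *
        ∫ u in (0 : ℝ)..1, D.normSq (ρ u) (v u))) := by
  refine (hD.distPos_sq_le_sub h hs ht).trans
    (mul_le_mul_of_nonneg_left ?_ (sub_nonneg.mpr hst))
  have hcont := hD.continuousOn_normSq h
  have hadd := intervalIntegral.integral_add_adjacent_intervals
    ((hcont.mono (Icc_subset_Icc le_rfl hs.2)).intervalIntegrable_of_Icc
      (μ := MeasureTheory.volume) hs.1)
    ((hcont.mono (Icc_subset_Icc hs.1 ht.2)).intervalIntegrable_of_Icc hst)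
  have a1 := (abs_le.mp (Real.abs_le_sqrt (hD.sq_integral_sub_le h hs))).1
  have a2 := (abs_le.mp (Real.abs_le_sqrt (hD.sq_integral_sub_le h ht))).2
  linarith

/-- Pointwise limits of nearly minimising curves between approximations of the end points, along
an ultrafilter, are geodesics. -/
theorem IsErgodic.exists_isGeodesic (hD : D.IsErgodic) {ρ₀ ρ₁ : A} (h₀ : ρ₀ ∈ D.density)
    (h₁ : ρ₁ ∈ D.density) : ∃ γ : ℝ → A, γ 0 = ρ₀ ∧ γ 1 = ρ₁ ∧ D.IsGeodesic γ := by
  set d : ℕ → ℝ := fun n => D.distPos (D.approx ρ₀ n) (D.approx ρ₁ n) with hd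
  set w := D.W ρ₀ ρ₁ with hw
  have hdw : Tendsto d atTop (𝓝 w) := hD.tendsto_W_approx h₀ h₁
  have hex : ∀ n, ∃ ρ v : ℝ → A, D.IsCurve ρ v ∧ ρ 0 = D.approx ρ₀ n ∧ ρ 1 = D.approx ρ₁ n ∧
      ∫ t in (0 : ℝ)..1, D.normSq (ρ t) (v t) < d n ^ 2 + mixRate n := fun n =>
    hD.exists_curve_lt (approx_mem h₀ n) (approx_mem h₁ n)
      (by have := (mixRate_mem n).1; linarith)
  choose ρ v hcur h0 h1 hlt using hex
  set E : ℕ → ℝ := fun n => ∫ t in (0 : ℝ)..1, D.normSq (ρ n t) (v n t) with hE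
  have hdE : ∀ n, d n ^ 2 ≤ E n := fun n => by
    have := hD.distPos_sq_le (hcur n)
    rwa [h0, h1] at this
  have hElim : Tendsto E atTop (𝓝 (w ^ 2)) := by
    refine tendsto_of_tendsto_of_tendsto_of_le_of_le (hdw.pow 2) ?_ hdE fun n => (hlt n).le
    simpa using (hdw.pow 2).add tendsto_mixRate
  set U : Filter ℕ := (hyperfilter ℕ : Filter ℕ) with hU
  have hUle : U ≤ atTop := by
    rw [← Nat.cofinite_eq_atTop]; exact hyperfilter_le_cofinite
  have hmem : ∀ n, ∀ t ∈ Icc (0 : ℝ) 1, ρ n t ∈ D.densityPos := fun n t ht => ((hcur n).2 t ht).1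
  -- The ultrafilter selects the limits at all times simultaneously.
  have hex : ∀ t : ℝ, ∃ x : A, t ∈ Icc (0 : ℝ) 1 →
      x ∈ D.density ∧ Tendsto (fun n => ρ n t) U (𝓝 x) := fun t => by
    by_cases ht : t ∈ Icc (0 : ℝ) 1
    · have hle : ((hyperfilter ℕ).map fun n => ρ n t : Filter A) ≤ 𝓟 D.density := by
        rw [le_principal_iff]
        exact mem_map.mpr (Eventually.of_forall fun n =>
          D.densityPos_subset_density (hmem n t ht))
      obtain ⟨x, hx, hxl⟩ := D.isCompact_density.ultrafilter_le_nhds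
        ((hyperfilter ℕ).map fun n => ρ n t) hle
      exact ⟨x, fun _ => ⟨hx, hxl⟩⟩
    · exact ⟨0, fun h => absurd h ht⟩
  choose γ hγ using hex
  have z0 : (0 : ℝ) ∈ Icc (0 : ℝ) 1 := by simp
  have z1 : (1 : ℝ) ∈ Icc (0 : ℝ) 1 := by simp
  have g0 : γ 0 = ρ₀ := tendsto_nhds_unique ((hγ 0 z0).2.congr h0)
    ((tendsto_approx ρ₀).mono_left hUle)
  have g1 : γ 1 = ρ₁ := tendsto_nhds_unique ((hγ 1 z1).2.congr h1)
    ((tendsto_approx ρ₁).mono_left hUle)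
  have hw0 : 0 ≤ w := hD.W_nonneg h₀ h₁
  have hle : ∀ s ∈ Icc (0 : ℝ) 1, ∀ t ∈ Icc (0 : ℝ) 1, s ≤ t →
      D.W (γ s) (γ t) ≤ (t - s) * w := fun s hs t ht hst => by
    have l1 : Tendsto (fun n => D.distPos (ρ n s) (ρ n t)) U (𝓝 (D.W (γ s) (γ t))) := by
      refine (hD.tendsto_W (hγ s hs).2 (hγ t ht).2
        (fun n => D.densityPos_subset_density (hmem n s hs))
        (fun n => D.densityPos_subset_density (hmem n t ht)) (hγ s hs).1 (hγ t ht).1).congr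
          fun n => ?_
      rw [hD.W_eq_distPos (hmem n s hs) (hmem n t ht)]
    have l2 : Tendsto (fun n => (t - s) * ((t - s) * E n + 2 * Real.sqrt ((E n - d n ^ 2) * E n)))
        U (𝓝 (((t - s) * w) ^ 2)) := by
      have h2 : Tendsto (fun n => Real.sqrt ((E n - d n ^ 2) * E n)) U (𝓝 0) := by
        have h3 := (Real.continuous_sqrt.tendsto _).comp
          (((hElim.sub (hdw.pow 2)).mul hElim).mono_left hUle)
        rw [sub_self, zero_mul, Real.sqrt_zero] at h3
        exact h3
      have h4 := (((hElim.mono_left hUle).const_mul (t - s)).add (h2.const_mul 2)).const_mul (t - s)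
      refine h4.trans_eq ?_
      congr 1
      ring
    have hsq : D.W (γ s) (γ t) ^ 2 ≤ ((t - s) * w) ^ 2 :=
      le_of_tendsto_of_tendsto' (l1.pow 2) l2 fun n => by
        have := hD.distPos_sq_le_of_isCurve (hcur n) hs ht hst
        rw [h0, h1] at this
        exact this
    exact (sq_le_sq₀ (hD.W_nonneg (hγ s hs).1 (hγ t ht).1)
      (mul_nonneg (sub_nonneg.mpr hst) hw0)).mp hsq
  -- Were one of the bounds strict, the triangle inequality would make the end points too close.
  have heq : ∀ s ∈ Icc (0 : ℝ) 1, ∀ t ∈ Icc (0 : ℝ) 1, s ≤ t →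
      D.W (γ s) (γ t) = (t - s) * w := fun s hs t ht hst => by
    refine le_antisymm (hle s hs t ht hst) ?_
    have t1 := hD.W_triangle (hγ 0 z0).1 (hγ s hs).1 (hγ 1 z1).1
    have t2 := hD.W_triangle (hγ s hs).1 (hγ t ht).1 (hγ 1 z1).1
    have b1 := hle 0 z0 s hs hs.1
    have b2 := hle t ht 1 z1 ht.2
    rw [g0, g1] at t1
    rw [g0] at b1
    rw [g1] at b2 t2
    linarith
  refine ⟨γ, g0, g1, fun t ht => (hγ t ht).1, fun s hs t ht => ?_⟩
  rw [g0, g1]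
  rcases le_total s t with hst | hst
  · rw [heq s hs t ht hst, abs_sub_comm, abs_of_nonneg (sub_nonneg.mpr hst)]
  · rw [hD.W_comm (hγ s hs).1 (hγ t ht).1, heq t ht s hs hst, abs_of_nonneg (sub_nonneg.mpr hst)]

theorem GradientEstimate.ricciBoundedBelow (hD : D.IsErgodic) {lam : ℝ}
    (hG : D.GradientEstimate lam) : D.RicciBoundedBelow lam := by
  refine ⟨fun ρ₀ h₀ ρ₁ h₁ => ?_, hG.stronglyConvex hD, hG.evi hD, hG.hessianBound⟩
  obtain ⟨γ, g0, g1, hγ⟩ := hD.exists_isGeodesic h₀ h₁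
  exact ⟨γ, g0, g1, hγ, hG.stronglyConvex hD γ hγ⟩

end DifferentialStructure

/-! ### The fermionic Ornstein-Uhlenbeck semigroup -/

namespace DifferentialStructure

variable {A : Type*} [CStarAlgebra A] [FiniteDimensional ℂ A] {J : Type*} [Fintype J] {ι : Type*}
  {B : ι → Type*} [∀ k, CStarAlgebra (B k)] [∀ k, FiniteDimensional ℂ (B k)]
  (D : DifferentialStructure A J B)

theorem isErgodic_of_generator_eq_zero (h : ∀ a, D.generator a = 0 → ∃ k : ℂ, a = k • 1) :
    D.IsErgodic := by
  refine le_antisymm (fun a ha => ?_) ?_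
  · obtain ⟨k, hk⟩ := h a ha
    exact Submodule.mem_span_singleton.mpr ⟨k, hk.symm⟩
  · rw [Submodule.span_le, Set.singleton_subset_iff]
    exact D.generator_one

/-- An operator that commutes with the generator up to a multiple of itself commutes with the
semigroup up to an exponential factor. -/
theorem map_semigroup (P : A →ₗ[ℂ] A) {k : ℝ}
    (hk : ∀ a, P (D.generator a) = D.generator (P a) - (k : ℂ) • P a) (a : A) (t : ℝ) :
    P (D.semigroup t a) = ((Real.exp (-(k * t)) : ℝ) : ℂ) • D.semigroup t (P a) := by
  have hyd : ∀ t, HasDerivAt (fun t => Real.exp (k * t) • P (D.semigroup t a))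
      (D.generator (Real.exp (k * t) • P (D.semigroup t a))) t := fun t => by
    have h1 : HasDerivAt (fun t => Real.exp (k * t)) (Real.exp (k * t) * k) t := by
      simpa using ((hasDerivAt_id t).const_mul k).exp
    have h2 : HasDerivAt (fun t => P (D.semigroup t a)) (P (D.generator (D.semigroup t a))) t :=
      ((LinearMap.toContinuousLinearMap P).restrictScalars ℝ).hasFDerivAt.comp_hasDerivAt t
        (D.hasDerivAt_semigroup a t)
    refine (h1.smul h2).congr_deriv ?_
    rw [hk, Complex.coe_smul, ← Complex.coe_smul (Real.exp (k * t)) (P (D.semigroup t a)), map_smul,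
      Complex.coe_smul, smul_sub, smul_smul]
    abel
  have h3 := eq_flow_of_hasDerivAt D.generator hyd t
  simp only [mul_zero, Real.exp_zero, one_smul, D.semigroup_zero] at h3
  rw [D.semigroup_apply t (P a), ← h3, Complex.coe_smul, smul_smul, ← Real.exp_add,
    neg_add_cancel, Real.exp_zero, one_smul]

end DifferentialStructure

section Fermions

variable {n : ℕ}

theorem Cl.Q_mul_Q_add (i j : Fin n) :
    Cl.Q i * Cl.Q j + Cl.Q j * Cl.Q i = if i = j then 2 else 0 := by
  refine Cl.val_injective ?_
  rw [map_add, map_mul, map_mul, Cl.val_Q, Cl.val_Q, fermiQ_car]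
  split_ifs
  · rw [map_ofNat]
  · rw [map_zero]

theorem Cl.Q_mul_self (j : Fin n) : Cl.Q j * Cl.Q j = 1 := by
  have h := Cl.Q_mul_Q_add j j
  rw [if_pos rfl, ← two_smul ℂ, ← one_add_one_eq_two (R := Cl n), ← two_smul ℂ (1 : Cl n)] at h
  exact smul_right_injective _ (two_ne_zero (α := ℂ)) h

theorem Cl.Q_anticomm {i j : Fin n} (h : i ≠ j) : Cl.Q i * Cl.Q j = -(Cl.Q j * Cl.Q i) := by
  have := Cl.Q_mul_Q_add i j
  rw [if_neg h] at this
  exact eq_neg_of_add_eq_zero_left this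

/-- The automorphism `a ↦ Q_j Γ(a) Q_j`, which changes the sign of `Q_j` and fixes the other
generators. -/
noncomputable def Cl.twist (j : Fin n) : Cl n →ₗ[ℂ] Cl n :=
  LinearMap.mulLeft ℂ (Cl.Q j) ∘ₗ LinearMap.mulRight ℂ (Cl.Q j) ∘ₗ
    (Cl.Γ n).toAlgHom.toLinearMap

theorem Cl.twist_apply (j : Fin n) (a : Cl n) :
    Cl.twist j a = Cl.Q j * Cl.Γ n a * Cl.Q j := (mul_assoc _ _ _).symm

theorem Cl.twist_mul (j : Fin n) (a b : Cl n) :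
    Cl.twist j (a * b) = Cl.twist j a * Cl.twist j b := by
  simp only [Cl.twist_apply, map_mul]
  calc Cl.Q j * (Cl.Γ n a * Cl.Γ n b) * Cl.Q j
      = Cl.Q j * Cl.Γ n a * 1 * Cl.Γ n b * Cl.Q j := by noncomm_ring
    _ = _ := by rw [← Cl.Q_mul_self j]; noncomm_ring

theorem Cl.twist_one (j : Fin n) : Cl.twist j 1 = 1 := by
  rw [Cl.twist_apply, map_one, mul_one, Cl.Q_mul_self]

theorem Cl.twist_star (j : Fin n) (a : Cl n) : Cl.twist j (star a) = star (Cl.twist j a) := by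
  simp only [Cl.twist_apply, star_mul, Cl.star_Q, map_star, mul_assoc]

theorem Cl.trace_twist (j : Fin n) (a : Cl n) : Cl.trace n (Cl.twist j a) = Cl.trace n a := by
  rw [Cl.twist_apply, (Cl.trace n).tracial, ← mul_assoc, Cl.Q_mul_self, one_mul, Cl.trace_Γ]

theorem Cl.twist_Q_self (j : Fin n) : Cl.twist j (Cl.Q j) = -Cl.Q j := by
  rw [Cl.twist_apply, Cl.Γ_Q, mul_neg, neg_mul, Cl.Q_mul_self, one_mul]

theorem Cl.twist_Q_of_ne {i j : Fin n} (h : i ≠ j) : Cl.twist j (Cl.Q i) = Cl.Q i := by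
  rw [Cl.twist_apply, Cl.Γ_Q, mul_neg, neg_mul, Cl.Q_anticomm h.symm, neg_mul, neg_neg, mul_assoc,
    Cl.Q_mul_self, mul_one]

theorem Cl.twist_twist (j : Fin n) (a : Cl n) : Cl.twist j (Cl.twist j a) = a := by
  rw [Cl.twist_apply j (Cl.twist j a), Cl.twist_apply j a, map_mul, map_mul, Cl.Γ_Q, Cl.Γ_Γ]
  calc Cl.Q j * (-Cl.Q j * a * -Cl.Q j) * Cl.Q j
      = (Cl.Q j * Cl.Q j) * a * (Cl.Q j * Cl.Q j) := by noncomm_ring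
    _ = a := by rw [Cl.Q_mul_self, one_mul, mul_one]

theorem Cl.twist_comm (i j : Fin n) (a : Cl n) :
    Cl.twist i (Cl.twist j a) = Cl.twist j (Cl.twist i a) := by
  rcases eq_or_ne i j with rfl | h
  · rfl
  · have e : ∀ i j : Fin n, Cl.twist i (Cl.twist j a) =
        Cl.Q i * Cl.Q j * a * (Cl.Q j * Cl.Q i) := fun i j => by
      rw [Cl.twist_apply i, Cl.twist_apply j, map_mul, map_mul, Cl.Γ_Q, Cl.Γ_Γ]
      noncomm_ring
    rw [e, e, Cl.Q_anticomm h, Cl.Q_anticomm h.symm]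
    noncomm_ring

theorem Cl.twist_Γ (j : Fin n) (a : Cl n) : Cl.twist j (Cl.Γ n a) = Cl.Γ n (Cl.twist j a) := by
  rw [Cl.twist_apply, Cl.twist_apply, map_mul, map_mul, Cl.Γ_Q, Cl.Γ_Γ]
  noncomm_ring

/-! ### Elements fixed by all sign changes -/

/-- The product of the generators in a list. -/
noncomputable def Cl.mono (L : List (Fin n)) : Cl n := (L.map Cl.Q).prod

theorem Cl.twist_mono_of_notMem {i : Fin n} {L : List (Fin n)} (h : i ∉ L) :
    Cl.twist i (Cl.mono L) = Cl.mono L := by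
  induction L with
  | nil => exact Cl.twist_one i
  | cons k L ih =>
    rw [List.mem_cons, not_or] at h
    simp only [Cl.mono, List.map_cons, List.prod_cons] at ih ⊢
    rw [Cl.twist_mul, ih h.2, Cl.twist_Q_of_ne (Ne.symm h.1)]

theorem Cl.Q_mul_mono {i : Fin n} {L : List (Fin n)} (h : i ∉ L) :
    ∃ c : ℂ, Cl.Q i * Cl.mono L = c • (Cl.mono L * Cl.Q i) := by
  induction L with
  | nil => exact ⟨1, by simp [Cl.mono]⟩
  | cons k L ih =>
    rw [List.mem_cons, not_or] at h
    obtain ⟨c, hc⟩ := ih h.2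
    refine ⟨-c, ?_⟩
    simp only [Cl.mono, List.map_cons, List.prod_cons] at hc ⊢
    rw [← mul_assoc, Cl.Q_anticomm h.1, neg_mul, mul_assoc, hc, mul_smul_comm, neg_smul, mul_assoc]

/-- A monomial is either scalar or changes sign under one of the automorphisms: a generator that
occurs once can be detected, one that occurs twice can be cancelled. -/
theorem Cl.mono_cases (L : List (Fin n)) :
    (∃ j, Cl.twist j (Cl.mono L) = -Cl.mono L) ∨ ∃ c : ℂ, Cl.mono L = c • 1 := by
  induction hk : L.length using Nat.strong_induction_on generalizing L with
  | _ k ih =>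
    cases L with
    | nil => exact Or.inr ⟨1, by simp [Cl.mono]⟩
    | cons i L =>
      by_cases hi : i ∈ L
      · obtain ⟨L₁, L₂, rfl, h1⟩ := List.eq_append_cons_of_mem hi
        obtain ⟨c, hc⟩ := Cl.Q_mul_mono h1
        have e : Cl.mono (i :: (L₁ ++ i :: L₂)) = c • Cl.mono (L₁ ++ L₂) := by
          simp only [Cl.mono, List.map_cons, List.map_append, List.prod_cons,
            List.prod_append] at hc ⊢
          rw [← mul_assoc, hc, smul_mul_assoc, mul_assoc, ← mul_assoc (Cl.Q i), Cl.Q_mul_self,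
            one_mul]
        rcases ih (L₁ ++ L₂).length (by rw [← hk]; simp) _ rfl with ⟨j, hj⟩ | ⟨d, hd⟩
        · exact Or.inl ⟨j, by rw [e, map_smul, hj, smul_neg]⟩
        · exact Or.inr ⟨c * d, by rw [e, hd, smul_smul]⟩
      · refine Or.inl ⟨i, ?_⟩
        have h1 := Cl.twist_mono_of_notMem hi
        simp only [Cl.mono, List.map_cons, List.prod_cons] at h1 ⊢
        rw [Cl.twist_mul, h1, Cl.twist_Q_self, neg_mul]

/-- The monomials span the Clifford algebra, which is generated by self-adjoint elements. -/
theorem Cl.span_mono : Submodule.span ℂ (Set.range (Cl.mono (n := n))) = ⊤ := by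
  rw [eq_top_iff]
  intro x _
  have hx : (Cl.val x) ∈ (cliffordSubalgebra n).toSubalgebra := x.2
  have hstar : star (Set.range (fermiQ (n := n))) = Set.range fermiQ := by
    ext y
    constructor
    · rintro ⟨j, hj⟩
      exact ⟨j, by rw [← star_star y, ← hj, fermiQ_star]⟩
    · rintro ⟨j, rfl⟩
      exact ⟨j, (fermiQ_star j).symm⟩
  rw [cliffordSubalgebra, StarAlgebra.adjoin_toSubalgebra, hstar, union_self,
    ← Subalgebra.mem_toSubmodule, Algebra.adjoin_eq_span] at hx
  have hle : Submodule.span ℂ ((Submonoid.closure (Set.range (fermiQ (n := n))) : Submonoid _) :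
      Set (Matrix (Finset (Fin n)) (Finset (Fin n)) ℂ)) ≤
      (Submodule.span ℂ (Set.range (Cl.mono (n := n)))).map (Cl.val (n := n)).toAlgHom.toLinearMap := by
    rw [Submodule.span_le]
    intro y hy
    obtain ⟨l, hl, rfl⟩ := Submonoid.exists_list_of_mem_closure hy
    clear hy
    have : ∃ L : List (Fin n), l = L.map fermiQ := by
      induction l with
      | nil => exact ⟨[], rfl⟩
      | cons z l ih =>
        obtain ⟨j, rfl⟩ := hl z (by simp)
        have hl' : ∀ y ∈ l, y ∈ Set.range (fermiQ (n := n)) := fun y hy => hl y (by simp [hy])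
        obtain ⟨L, rfl⟩ := ih hl'
        exact ⟨j :: L, rfl⟩
    obtain ⟨L, rfl⟩ := this
    refine ⟨Cl.mono L, Submodule.subset_span ⟨L, rfl⟩, ?_⟩
    change Cl.val (Cl.mono L) = _
    rw [Cl.mono, map_list_prod, List.map_map]
    rfl
  obtain ⟨y, hy, hyx⟩ := hle hx
  rwa [← Cl.val_injective hyx]

/-- Elements fixed by all sign changes are scalar: they are orthogonal to every monomial that
changes sign. -/
theorem Cl.eq_smul_one_of_twist_eq {a : Cl n} (h : ∀ j, Cl.twist j a = a) :
    ∃ c : ℂ, a = c • 1 := by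
  refine ⟨Cl.trace n a, ?_⟩
  set a' := a - Cl.trace n a • (1 : Cl n) with ha'
  have hfix : ∀ j, Cl.twist j a' = a' := fun j => by
    rw [ha', map_sub, map_smul, Cl.twist_one, h]
  have htr : Cl.trace n a' = 0 := by
    rw [ha', map_sub, map_smul, Cl.trace_one, smul_eq_mul, mul_one, sub_self]
  have horth : ∀ y, Cl.trace n (star a' * y) = 0 := fun y => by
    have hy : y ∈ Submodule.span ℂ (Set.range (Cl.mono (n := n))) := by
      rw [Cl.span_mono]; trivial
    induction hy using Submodule.span_induction with
    | mem y hy =>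
      obtain ⟨L, rfl⟩ := hy
      rcases Cl.mono_cases L with ⟨j, hj⟩ | ⟨c, hc⟩
      · have h1 := Cl.trace_twist j (star a' * Cl.mono L)
        rw [Cl.twist_mul, Cl.twist_star, hfix, hj, mul_neg, map_neg] at h1
        exact neg_eq_self.mp h1
      · rw [hc, mul_smul_comm, mul_one, map_smul, (Cl.trace n).map_star, htr, star_zero, smul_zero]
    | zero => rw [mul_zero, map_zero]
    | add x y _ _ hx hy => rw [mul_add, map_add, hx, hy, add_zero]
    | smul c x _ hx => rw [mul_smul_comm, map_smul, hx, smul_zero]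
  exact sub_eq_zero.mp ((Cl.trace n).faithful a' (horth a'))

/-! ### The generator and its commutation relations -/

theorem Cl.mul_sum {ι : Type*} (s : Finset ι) (x : Cl n) (f : ι → Cl n) :
    x * ∑ i ∈ s, f i = ∑ i ∈ s, x * f i :=
  Finset.mul_sum s f x

variable {c : ℝ} (hc : c ≠ 0)

theorem fermionicStructure_corr (j : Fin n) (p q : Cl n) :
    (fermionicStructure n c hc).corr j p q = (c : ℂ) ^ 2 * Cl.trace n (Cl.twist j p * q) := by
  change Cl.trace n (star ((c : ℂ) • Cl.Q j) * Cl.Γ n p * ((c : ℂ) • Cl.Q j) * q) = _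
  rw [star_smul, Cl.star_Q, RCLike.star_def, Complex.conj_ofReal, smul_mul_assoc, smul_mul_smul_comm,
    smul_mul_assoc, map_smul, smul_eq_mul, Cl.twist_apply, sq]

/-- The generator is a multiple of `∑ (T_j - 1)` for the sign changes `T_j`. -/
theorem fermionicStructure_generator (b : Cl n) : (fermionicStructure n c hc).generator b =
    (2 * (c : ℂ) ^ 2) • ∑ j, (Cl.twist j b - b) := by
  refine (Cl.trace n).ext_mul fun x => ?_
  refine ((fermionicStructure n c hc).trace_mul_generator x b).trans ?_
  have h1 : Cl.trace n (x * ((2 * (c : ℂ) ^ 2) • ∑ j, (Cl.twist j b - b))) =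
      ∑ j, 2 * (c : ℂ) ^ 2 * (Cl.trace n (x * Cl.twist j b) - Cl.trace n (x * b)) := by
    rw [mul_smul_comm, map_smul, smul_eq_mul, Cl.mul_sum, map_sum,
      Finset.mul_sum]
    simp only [mul_sub, map_sub]
  refine Eq.trans (Finset.sum_congr rfl fun j _ => ?_) h1.symm
  have h0 : (fermionicStructure n c hc).ω j = 0 := rfl
  rw [h0, fermionicStructure_corr, fermionicStructure_corr, fermionicStructure_corr, Cl.twist_one,
    one_mul, one_mul, (Cl.trace n).tracial b x, (Cl.trace n).tracial x (Cl.twist j b)]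
  simp
  ring

theorem fermionicStructure_partialD (j : Fin n) (a : Cl n) :
    (fermionicStructure n c hc).partialD j a = (c : ℂ) • (Cl.Q j * (a - Cl.twist j a)) := by
  change ((c : ℂ) • Cl.Q j) * a - Cl.Γ n a * ((c : ℂ) • Cl.Q j) = _
  rw [smul_mul_assoc, mul_smul_comm, ← smul_sub, mul_sub, Cl.twist_apply, mul_assoc (Cl.Q j),
    ← mul_assoc (Cl.Q j) (Cl.Q j), Cl.Q_mul_self, one_mul]

/-- If `∑ (T_j a - a) = 0`, then pairing with `a` gives `∑ ‖T_j a - a‖² = 0`, because each `T_j` is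
isometric; hence `a` is fixed by all sign changes. -/
theorem fermionicStructure_isErgodic : (fermionicStructure n c hc).IsErgodic := by
  refine DifferentialStructure.isErgodic_of_generator_eq_zero _ fun a ha => ?_
  · rw [fermionicStructure_generator] at ha
    have hc2 : (2 * (c : ℂ) ^ 2) ≠ 0 :=
      mul_ne_zero two_ne_zero (pow_ne_zero 2 (by exact_mod_cast hc))
    have hs := (smul_eq_zero.mp ha).resolve_left hc2
    have hsq : ∀ j, (Cl.trace n (star (Cl.twist j a - a) * (Cl.twist j a - a))).re =
        -2 * (Cl.trace n (star a * (Cl.twist j a - a))).re := fun j => by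
      have h1 : (Cl.trace n (star (Cl.twist j a) * Cl.twist j a)).re =
          (Cl.trace n (star a * a)).re := by
        rw [← Cl.twist_star, ← Cl.twist_mul, Cl.trace_twist]
      have h2 := (Cl.trace n).re_inner_comm (Cl.twist j a) a
      simp only [star_sub, sub_mul, mul_sub, map_sub, Complex.sub_re] at h1 h2 ⊢
      linarith
    have hsum : ∑ j, (Cl.trace n (star (Cl.twist j a - a) * (Cl.twist j a - a))).re = 0 := by
      rw [Finset.sum_congr rfl fun j _ => hsq j, ← Finset.mul_sum, ← Complex.re_sum, ← map_sum,
        ← Cl.mul_sum, hs, mul_zero, map_zero, Complex.zero_re, mul_zero]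
    rw [Finset.sum_eq_zero_iff_of_nonneg fun j _ => ((Cl.trace n).nonneg _).1] at hsum
    obtain ⟨k, hk⟩ := Cl.eq_smul_one_of_twist_eq (a := a) fun j =>
      sub_eq_zero.mp ((Cl.trace n).faithful _
        (Complex.ext (hsum j (Finset.mem_univ j)) ((Cl.trace n).nonneg _).2))
    exact ⟨k, hk⟩

/-- Multiplication by `Q_j` commutes with every sign change except `T_j`, with which it
anticommutes; this shifts the spectrum of the generator by `4 c²`. -/
theorem fermionicStructure_partialD_generator (j : Fin n) (a : Cl n) :
    (fermionicStructure n c hc).partialD j ((fermionicStructure n c hc).generator a) =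
      (fermionicStructure n c hc).generator ((fermionicStructure n c hc).partialD j a) -
        (4 * (c : ℂ) ^ 2) • (fermionicStructure n c hc).partialD j a := by
  simp only [fermionicStructure_partialD, fermionicStructure_generator]
  have h1 : ∀ i, Cl.Q j * ((Cl.twist i a - a) - Cl.twist j (Cl.twist i a - a)) =
      (Cl.twist i (Cl.Q j * (a - Cl.twist j a)) - Cl.Q j * (a - Cl.twist j a)) -
        if i = j then (2 : ℂ) • (Cl.Q j * (a - Cl.twist j a)) else 0 := fun i => by
    rcases eq_or_ne i j with rfl | h
    · rw [if_pos rfl, Cl.twist_mul, Cl.twist_Q_self, map_sub, map_sub, Cl.twist_twist, two_smul]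
      noncomm_ring
    · rw [if_neg h, Cl.twist_mul, Cl.twist_Q_of_ne h.symm, map_sub, map_sub, Cl.twist_comm j i]
      noncomm_ring
  have h2 : Cl.Q j * (∑ i, (Cl.twist i a - a) - Cl.twist j (∑ i, (Cl.twist i a - a))) =
      ∑ i, (Cl.twist i (Cl.Q j * (a - Cl.twist j a)) - Cl.Q j * (a - Cl.twist j a)) -
        (2 : ℂ) • (Cl.Q j * (a - Cl.twist j a)) := by
    calc Cl.Q j * (∑ i, (Cl.twist i a - a) - Cl.twist j (∑ i, (Cl.twist i a - a)))
        = ∑ i, Cl.Q j * ((Cl.twist i a - a) - Cl.twist j (Cl.twist i a - a)) := by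
          rw [map_sum, mul_sub, Cl.mul_sum, Cl.mul_sum]
          refine (Finset.sum_sub_distrib _ _).symm.trans ?_
          exact Finset.sum_congr rfl fun i _ => (mul_sub _ _ _).symm
      _ = _ := by
          rw [Finset.sum_congr rfl fun i _ => h1 i]
          refine (Finset.sum_sub_distrib _ _).trans ?_
          rw [Finset.sum_ite_eq' Finset.univ j, if_pos (Finset.mem_univ j)]
          rfl
  have h3 : ∑ i, (Cl.twist i ((c : ℂ) • (Cl.Q j * (a - Cl.twist j a))) -
      (c : ℂ) • (Cl.Q j * (a - Cl.twist j a))) =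
      (c : ℂ) • ∑ i, (Cl.twist i (Cl.Q j * (a - Cl.twist j a)) - Cl.Q j * (a - Cl.twist j a)) := by
    rw [Finset.smul_sum]
    exact Finset.sum_congr rfl fun i _ => by rw [map_smul, smul_sub]
  rw [map_smul (Cl.twist j), ← smul_sub, mul_smul_comm, h2, h3]
  simp only [smul_smul, smul_sub]
  congr 2 <;> ring

/-- The derivations intertwine the semigroup with a multiple of itself. -/
theorem fermionicStructure_partialD_semigroup (j : Fin n) (a : Cl n) (t : ℝ) :
    (fermionicStructure n c hc).partialD j ((fermionicStructure n c hc).semigroup t a) =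
      ((Real.exp (-4 * c ^ 2 * t) : ℝ) : ℂ) • (fermionicStructure n c hc).semigroup t
        ((fermionicStructure n c hc).partialD j a) := by
  have h := (fermionicStructure n c hc).map_semigroup
    ((fermionicStructure n c hc).partialD j) (k := 4 * c ^ 2) (fun b => by
      rw [show ((4 * c ^ 2 : ℝ) : ℂ) = 4 * (c : ℂ) ^ 2 by push_cast; rfl]
      exact fermionicStructure_partialD_generator hc j b) a t
  rw [← neg_mul, ← neg_mul] at h
  exact h

theorem fermionicStructure_semigroup_Γ (a : Cl n) (t : ℝ) :
    (fermionicStructure n c hc).semigroup t (Cl.Γ n a) =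
      Cl.Γ n ((fermionicStructure n c hc).semigroup t a) := by
  have h := (fermionicStructure n c hc).map_semigroup (Cl.Γ n).toAlgHom.toLinearMap (k := 0)
    (fun b => by
      change Cl.Γ n _ = _ - _ • Cl.Γ n b
      rw [Complex.ofReal_zero, zero_smul, sub_zero]
      change _ = (fermionicStructure n c hc).generator (Cl.Γ n b)
      rw [fermionicStructure_generator, fermionicStructure_generator, map_smul, map_sum]
      simp only [map_sub, Cl.twist_Γ]) a t
  rw [zero_mul, neg_zero, Real.exp_zero, Complex.ofReal_one, one_smul] at h
  exact h.symm

theorem fermionicStructure_isIdentification :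
    (fermionicStructure n c hc).IsIdentification (fun _ => StarAlgEquiv.refl ℂ (Cl n)) := fun _ =>
  ⟨fun _ => rfl, fun t _ a => ⟨fermionicStructure_semigroup_Γ hc a t, rfl⟩⟩

/-- The damped semigroup acting on every component. -/
noncomputable def fermionicIntertwiner (n : ℕ) (c : ℝ) (hc : c ≠ 0) (t : ℝ) :
    (∀ j, (fun _ : Unit => Cl n) ((fermionicStructure n c hc).κ j)) →ₗ[ℂ]
      (∀ j, (fun _ : Unit => Cl n) ((fermionicStructure n c hc).κ j)) :=
  ((Real.exp (-4 * c ^ 2 * t) : ℝ) : ℂ) • LinearMap.pi fun j : Fin n =>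
    (fermionicStructure n c hc).semigroup t ∘ₗ LinearMap.proj j

theorem fermionicIntertwiner_apply (t : ℝ) (b : Fin n → Cl n) (j : Fin n) :
    fermionicIntertwiner n c hc t b j =
      ((Real.exp (-4 * c ^ 2 * t) : ℝ) : ℂ) • (fermionicStructure n c hc).semigroup t (b j) := rfl

theorem fermionicIntertwiner_adjoint (t : ℝ) (b : Fin n → Cl n) :
    traceAdjoint (fermionicStructure n c hc).τProd (fermionicStructure n c hc).τProd
      (fermionicIntertwiner n c hc t) b = fun j =>
        ((Real.exp (-4 * c ^ 2 * t) : ℝ) : ℂ) • (fermionicStructure n c hc).semigroupAdj t (b j) := by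
  set D := fermionicStructure n c hc with hD
  refine D.τProd.ext_inner fun a => ?_
  rw [traceAdjoint_spec]
  have hsum : ∀ x y : Fin n → Cl n, D.τProd (star x * y) =
      ∑ j, Cl.trace n (star (x j) * y j) := fun x y => by
    simp [DifferentialStructure.τProd, FaithfulTrace.pi]
    rfl
  refine (hsum _ _).trans (Eq.trans ?_ (hsum _ _).symm)
  refine Finset.sum_congr rfl fun j _ => ?_
  rw [fermionicIntertwiner_apply, star_smul, RCLike.star_def, Complex.conj_ofReal, smul_mul_assoc,
    mul_smul_comm, map_smul, map_smul]
  congr 1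
  refine Eq.trans ?_ (D.trace_mul_semigroupAdj t (star (a j)) (b j)).symm
  rw [D.star_semigroup]
  rfl

theorem DifferentialStructure.action_smul {A : Type*} [CStarAlgebra A] [FiniteDimensional ℂ A]
    {J : Type*} [Fintype J] {ι : Type*} {B : ι → Type*} [∀ k, CStarAlgebra (B k)]
    [∀ k, FiniteDimensional ℂ (B k)] (D : DifferentialStructure A J B) (ρ : A) (k : ℝ)
    (b : ∀ j, B (D.κ j)) : D.action ρ (fun j => (k : ℂ) • b j) = k ^ 2 * D.action ρ b := by
  unfold action
  rw [Finset.mul_sum]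
  refine Finset.sum_congr rfl fun j _ => ?_
  rw [doubleSum_smul, star_smul, RCLike.star_def, Complex.conj_ofReal, smul_mul_smul_comm, map_smul,
    smul_eq_mul, ← Complex.ofReal_mul, Complex.re_ofReal_mul, sq]

theorem DifferentialStructure.action_nonneg {A : Type*} [CStarAlgebra A] [FiniteDimensional ℂ A]
    {J : Type*} [Fintype J] {ι : Type*} {B : ι → Type*} [∀ k, CStarAlgebra (B k)]
    [∀ k, FiniteDimensional ℂ (B k)] (D : DifferentialStructure A J B) {ρ : A} (hρ : IsPosDef ρ)
    (b : ∀ j, B (D.κ j)) : 0 ≤ D.action ρ b :=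
  Finset.sum_nonneg fun j _ => trace_doubleSum_nonneg _
    (fun x hx y hy => inv_nonneg.mpr (D.θ_pos_of_mem hρ j x hx y hy).le) _

/-- The damping rate `4 c²` is at least `1`, and the damped semigroup is intertwining at every
smaller rate. -/
theorem fermionicStructure_isIntertwining (h4 : 1 ≤ 4 * c ^ 2) :
    (fermionicStructure n c hc).IsIntertwining 1
      ((fermionicStructure n c hc).transported fun _ => StarAlgEquiv.refl ℂ (Cl n))
      (fermionicIntertwiner n c hc) := by
  set D := fermionicStructure n c hc with hD
  refine ⟨fun a t _ => funext fun j => fermionicStructure_partialD_semigroup hc j a t,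
    fun ρ hρ b t ht => ?_⟩
  rw [fermionicIntertwiner_adjoint hc t b]
  refine (D.action_smul ρ (Real.exp (-4 * c ^ 2 * t)) fun j => D.semigroupAdj t (b j)).trans_le ?_
  refine mul_le_mul_of_nonneg_right ?_ (D.action_nonneg hρ.1 _)
  rw [sq, ← Real.exp_add, Real.exp_le_exp]
  nlinarith

theorem fermionicStructure_ricciBoundedBelow (h4 : 1 ≤ 4 * c ^ 2) :
    (fermionicStructure n c hc).RicciBoundedBelow 1 :=
  (DifferentialStructure.IsIntertwining.gradientEstimate _
    (DifferentialStructure.IsIdentification.acts _ (fermionicStructure_isIdentification hc))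
    (fermionicStructure_isIntertwining hc h4)).ricciBoundedBelow (fermionicStructure_isErgodic hc)

end Fermions

end QuantumTransport

theorem mainTheorem7 :
    (∀ (A : Type u) [CStarAlgebra A] [FiniteDimensional ℂ A] (J : Type v) [Fintype J]
        (ι : Type w) (B : ι → Type x) [∀ k, CStarAlgebra (B k)] [∀ k, FiniteDimensional ℂ (B k)]
        (D : QuantumTransport.DifferentialStructure A J B), D.IsErgodic →
        ∀ (lam : ℝ) (Pv : ℝ → (∀ j, B (D.κ j)) →ₗ[ℂ] (∀ j, B (D.κ j))),
      (∀ Q : ℝ → ∀ j, B (D.κ j) →ₗ[ℂ] B (D.κ j),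
        D.IsExtension Q → D.IsIntertwining lam Q Pv → D.RicciBoundedBelow lam) ∧
      (∀ φ : ∀ j, A ≃⋆ₐ[ℂ] B (D.κ j),
        D.IsIdentification φ → D.IsIntertwining lam (D.transported φ) Pv →
          D.RicciBoundedBelow lam)) ∧
    (∀ n : ℕ, 1 ≤ n →
      ((QuantumTransport.fermionicStructure n 1 one_ne_zero).IsErgodic ∧
        (QuantumTransport.fermionicStructure n 1 one_ne_zero).RicciBoundedBelow 1) ∧
      ((QuantumTransport.fermionicStructure n (1 / 2) (by norm_num)).IsErgodic ∧
        (QuantumTransport.fermionicStructure n (1 / 2) (by norm_num)).RicciBoundedBelow 1)) := by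
  refine ⟨fun A _ _ J _ ι B _ _ D hD lam Pv => ⟨fun Q hQ hP => ?_, fun φ hφ hP => ?_⟩,
    fun n _ => ⟨⟨?_, ?_⟩, ?_, ?_⟩⟩
  · exact (QuantumTransport.DifferentialStructure.IsIntertwining.gradientEstimate D
      (QuantumTransport.DifferentialStructure.IsExtension.acts D hQ) hP).ricciBoundedBelow hD
  · exact (QuantumTransport.DifferentialStructure.IsIntertwining.gradientEstimate D
      (QuantumTransport.DifferentialStructure.IsIdentification.acts D hφ) hP).ricciBoundedBelow hD
  · exact QuantumTransport.fermionicStructure_isErgodic one_ne_zero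
  · exact QuantumTransport.fermionicStructure_ricciBoundedBelow one_ne_zero (by norm_num)
  · exact QuantumTransport.fermionicStructure_isErgodic _
  · exact QuantumTransport.fermionicStructure_ricciBoundedBelow _ (by norm_num)
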